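/- **Setting.** All spaces are real. Let $V\subset H\subset V'$ be a Gelfand triple: $H$ is a Hilbert space, identified with a subspace of $V'$ through $\langle h,z\rangle_{V',V}=(h,z)_H$, and $V\subset H$ with dense, continuous and compact inclusion. Let $A\in\mathcal L(V,V')$ be symmetric and such that $(y,z)_V:=\langle Ay,z\rangle_{V',V}$ is a complete scalar product on $V$; $V$ is endowed with this scalar product and $V'$ with the dual norm. *Actuators.* Let $\sigma:\{1,2,\dots\}\to\{1,2,\dots\}$ be strictly increasing. For each $M\ge1$ let $\Phi^M_1,\dots,\Phi^M_{\sigma(M)}\in H$ be linearly independent, with span $\mathcal U_M$, and let $P_{\mathcal U_M}$ be the orthogonal projection in $H$ onto $\mathcal U_M$. Assume that $$\xi_{M_+}:=\inf\Big\{\tfrac{|\Theta|_V^2}{|\Theta|_H^2}\;:\;\Theta\in (V\cap\mathcal U_M^\perp)\setminus\{0\}\Big\}\longrightarrow+\infty\quad\text{as } M\to\infty .$$ *Reaction–convection.* For a.e. $t>0$, $A_{\rm rc}(t)\in\mathcal L(H,V')+\mathcal L(V,H)$; $t\mapsto A_{\rm rc}(t)z\in V'$ is strongly measurable for every $z\in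 V$; and the norm of $A_{\rm rc}(t)$ in the sum space, that is, the infimum of $(\|B\|^2+\|G\|^2)^{1/2}$ over $A_{\rm rc}(t)=B+G$ with $B\in\mathcal L(H,V')$ and $G\in\mathcal L(V,H)$, is at most $C_{\rm rc}$ for a.e. $t>0$. *Nonlinearities.* Fix $n$ and exponents $\zeta_{1j},\zeta_{2j},\delta_{1j},\delta_{2j}\ge0$ with $\zeta_{2j}+\delta_{2j}<1$ and $\delta_{1j}+\delta_{2j}\ge1$, $1\le j\le n$. A map $\mathcal N:(0,\infty)\times V\to V'$ is called *admissible* with these exponents and the constant $C_{\mathcal N}\ge0$ if: for a.e. $t>0$, $\mathcal N(t,\cdot)$ is continuous and $|\mathcal N(t,y)|_{V'}\le\mathfrak i(|y|_V)$ for all $y\in V$, for some continuous nondecreasing $\mathfrak i:[0,\infty)\to\mathbb R$ with $\mathfrak i(0)=0$ (which may depend on $t$); for all $t>0$ and $y_1,y_2\in V$, $$|\mathcal N(t,y_1)-\mathcal N(t,y_2)|_{V'}\le C_{\mathcal N}\sum_{j=1}^n\big(|y_1|_H^{\zeta_{1j}}|y_1|_V^{\zeta_{2j}}+|y_2|_H^{\zeta_{1j}}|y_2|_V^{\zeta_{2j}}\big)|y_1-y_2|_H^{\delta_{1j}}|y_1-y_2|_V^{\delta_{2j}}$$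 (with $0^0=1$); and $\mathcal N(\cdot,y)\in L^1_{\rm loc}((0,\infty),V')$ for every $y\in V$. *Feedback.* For $\overline\lambda>0$, $\mathcal K_M:(0,\infty)\times\mathcal U_M\to\mathcal U_M$ is called *admissible* with $\overline\lambda$ if $(t,y)\mapsto\mathcal K_M(t,P_{\mathcal U_M}y)$ is an admissible nonlinearity (for some $n$, exponents and constant of its own) and $\mathcal K_M\preceq-\overline\lambda\mathbf 1$, that is, for a.e. $t>0$, $(\mathcal K_M(t,p),p)_H\le-\overline\lambda|p|_H^2$ for all $p\in\mathcal U_M$. *Weak solutions.* A weak solution of $$\dot y+Ay+A_{\rm rc}(t)y+\mathcal N(t,y)=\mathcal K_M(t,P_{\mathcal U_M}y),\qquad y(0)=y_0\in H, \qquad (*)$$ is a continuous $y:[0,\infty)\to H$ with $y(0)=y_0$ such that, for every $T>0$, $y\in L^2((0,T),V)$ and its distributional derivative $\dot y$ lies in $L^2((0,T),V')$, and such that the equation holds in $V'$ for a.e. $t>0$. **Theorem.** Fix $V,H,A$, the actuators $(\Phi^M_j)$, $n$ and the exponents. There are nondecreasing functions $\overline M(R,\mu,C_{\rm rc},C_{\mathcal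 N})\in\{1,2,\dots\}$ and $\overline\Lambda(M,R,\mu,C_{\rm rc},C_{\mathcal N})\in[0,\infty)$ (nondecreasing in every argument) such that the following holds for all $R,\mu>0$ and $C_{\rm rc},C_{\mathcal N}\ge0$, all $A_{\rm rc}$ as above with bound $C_{\rm rc}$, all admissible $\mathcal N$ with the given exponents and constant $C_{\mathcal N}$, all $M\ge\overline M(R,\mu,C_{\rm rc},C_{\mathcal N})$, all $\overline\lambda>0$ with $\overline\lambda\ge\overline\Lambda(M,R,\mu,C_{\rm rc},C_{\mathcal N})$, all $\mathcal K_M$ admissible with $\overline\lambda$, and all $y_0\in H$ with $|y_0|_H<R$. The system $(*)$ has exactly one weak solution $y$, and it satisfies $$|y(t)|_H\le e^{-\mu(t-s)}|y(s)|_H\qquad\text{for all } t\ge s\ge0 .$$ In particular $|y(t)|_H<|y(s)|_H$ for all $t>s\ge0$ with $|y(s)|_H\ne0$. Consequently one may choose $M=\overline M(R,\mu,C_{\rm rc},C_{\mathcal N})$ and $\overline\lambda\ge\overline\Lambda(M,R,\mu,C_{\rm rc},C_{\mathcal N})$ with that $M$, so that both thresholds are nondecreasing functions of $R,\mu,C_{\rm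 rc},C_{\mathcal N}$ alone. -/

import Mathlib

open MeasureTheory Filter Topology Set
open scoped NNReal

noncomputable section

/-- The embedding of the pivot space `H` into `V' = StrongDual ℝ V`, for a Gelfand triple
`V ⊂ H ⊂ V'` whose inclusion `V ⊂ H` is `ι`: the element `h` acts as `z ↦ (h, z)_H`. -/
def pivot {H V : Type*} [NormedAddCommGroup H] [InnerProductSpace ℝ H]
    [NormedAddCommGroup V] [InnerProductSpace ℝ V] (ι : V →L[ℝ] H) (h : H) : StrongDual ℝ V :=
  (innerSL ℝ h).comp ι

/-- `B ∈ L(H, V')` and `G ∈ L(V, H)` decompose `T ∈ L(V, V')` as `T = B + G`. -/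
def IsSumDecomposition {H V : Type*} [NormedAddCommGroup H] [InnerProductSpace ℝ H]
    [NormedAddCommGroup V] [InnerProductSpace ℝ V] (ι : V →L[ℝ] H)
    (T : V →L[ℝ] StrongDual ℝ V) (B : H →L[ℝ] StrongDual ℝ V) (G : V →L[ℝ] H) : Prop :=
  ∀ z : V, T z = B (ι z) + pivot ι (G z)

/-- The norm of the sum space `L(H, V') + L(V, H)`: the infimum of
`(‖B‖² + ‖G‖²)^(1/2)` over the decompositions `T = B + G`.
(Only used for operators that have such a decomposition.) -/
def sumNorm {H V : Type*} [NormedAddCommGroup H] [InnerProductSpace ℝ H]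
    [NormedAddCommGroup V] [InnerProductSpace ℝ V] (ι : V →L[ℝ] H)
    (T : V →L[ℝ] StrongDual ℝ V) : ℝ :=
  sInf {r : ℝ | ∃ (B : H →L[ℝ] StrongDual ℝ V) (G : V →L[ℝ] H),
    IsSumDecomposition ι T B G ∧ r = Real.sqrt (‖B‖ ^ 2 + ‖G‖ ^ 2)}

/-- `A_rc ∈ L^∞((0,∞), L(H, V') + L(V, H))` with norm at most `C`. Measurability in time is
only asked pointwise (for `t ↦ A_rc(t) z ∈ V'`, each `z ∈ V`). -/
structure IsReactionConvection {H V : Type*} [NormedAddCommGroup H] [InnerProductSpace ℝ H]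
    [NormedAddCommGroup V] [InnerProductSpace ℝ V] (ι : V →L[ℝ] H) (C : ℝ≥0)
    (Arc : ℝ → V →L[ℝ] StrongDual ℝ V) : Prop where
  measurable : ∀ z : V, AEStronglyMeasurable (fun t => Arc t z) (volume.restrict (Ioi 0))
  mem_sum : ∀ᵐ t ∂(volume.restrict (Ioi (0 : ℝ))),
    ∃ (B : H →L[ℝ] StrongDual ℝ V) (G : V →L[ℝ] H), IsSumDecomposition ι (Arc t) B G
  bound : ∀ᵐ t ∂(volume.restrict (Ioi (0 : ℝ))), sumNorm ι (Arc t) ≤ C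

/-- The class `C_{b,ι}(X, Y)` of continuous maps `f` with `‖f x‖ ≤ 𝔦(‖x‖)` for a continuous
nondecreasing `𝔦 : [0,∞) → ℝ` vanishing at `0`. In particular `f 0 = 0`. -/
def IsBoundedContinuous {X Y : Type*} [NormedAddCommGroup X] [NormedAddCommGroup Y]
    (f : X → Y) : Prop :=
  Continuous f ∧ ∃ i : ℝ → ℝ, ContinuousOn i (Ici 0) ∧ MonotoneOn i (Ici 0) ∧ i 0 = 0 ∧
    ∀ x, ‖f x‖ ≤ i ‖x‖

/-- The exponents in the Lipschitz-type bound for the nonlinearity. -/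
structure NonlinearityExponents (n : ℕ) where
  ζ₁ : Fin n → ℝ
  ζ₂ : Fin n → ℝ
  δ₁ : Fin n → ℝ
  δ₂ : Fin n → ℝ
  ζ₁_nonneg : ∀ j, 0 ≤ ζ₁ j
  ζ₂_nonneg : ∀ j, 0 ≤ ζ₂ j
  δ₁_nonneg : ∀ j, 0 ≤ δ₁ j
  δ₂_nonneg : ∀ j, 0 ≤ δ₂ j
  ζ₂_add_δ₂_lt : ∀ j, ζ₂ j + δ₂ j < 1
  one_le_δ₁_add_δ₂ : ∀ j, 1 ≤ δ₁ j + δ₂ j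

/-- The structural assumption on a time-dependent nonlinearity `N(t, ·) : V → V'`, with
exponents `e` and constant `C`. -/
structure IsAdmissibleNonlinearity {H V : Type*} [NormedAddCommGroup H] [InnerProductSpace ℝ H]
    [NormedAddCommGroup V] [InnerProductSpace ℝ V] (ι : V →L[ℝ] H) {n : ℕ}
    (e : NonlinearityExponents n) (C : ℝ≥0) (N : ℝ → V → StrongDual ℝ V) : Prop where
  continuous_bounded : ∀ᵐ t ∂(volume.restrict (Ioi (0 : ℝ))), IsBoundedContinuous (N t)
  lipschitz_bound : ∀ t : ℝ, 0 < t → ∀ y₁ y₂ : V,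
    ‖N t y₁ - N t y₂‖ ≤ C * ∑ j : Fin n,
      (‖ι y₁‖ ^ e.ζ₁ j * ‖y₁‖ ^ e.ζ₂ j + ‖ι y₂‖ ^ e.ζ₁ j * ‖y₂‖ ^ e.ζ₂ j) *
        (‖ι (y₁ - y₂)‖ ^ e.δ₁ j * ‖y₁ - y₂‖ ^ e.δ₂ j)
  locallyIntegrable : ∀ y : V, LocallyIntegrableOn (fun t => N t y) (Ioi 0)

/-- The Poincaré-like constant: the infimum of `‖Θ‖_V² / ‖Θ‖_H²` over the nonzero
`Θ ∈ V ∩ Uᗮ`. -/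
def poincareConst {H V : Type*} [NormedAddCommGroup H] [InnerProductSpace ℝ H]
    [NormedAddCommGroup V] [InnerProductSpace ℝ V] (ι : V →L[ℝ] H) (U : Submodule ℝ H) : ℝ :=
  sInf {r : ℝ | ∃ Θ : V, ι Θ ∈ Uᗮ ∧ Θ ≠ 0 ∧ r = ‖Θ‖ ^ 2 / ‖ι Θ‖ ^ 2}

/-- The span `U_M` of the actuators `Φ_1, …, Φ_{σ(M)}`. -/
abbrev actuatorSpan {H : Type*} [NormedAddCommGroup H] [InnerProductSpace ℝ H]
    {σ : ℕ+ → ℕ+} (Φ : (M : ℕ+) → Fin (σ M) → H) (M : ℕ+) : Submodule ℝ H :=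
  Submodule.span ℝ (Set.range (Φ M))

instance actuatorSpan_hasOrthogonalProjection {H : Type*} [NormedAddCommGroup H]
    [InnerProductSpace ℝ H] {σ : ℕ+ → ℕ+} (Φ : (M : ℕ+) → Fin (σ M) → H) (M : ℕ+) :
    (actuatorSpan Φ M).HasOrthogonalProjection :=
  have : FiniteDimensional ℝ (actuatorSpan Φ M) :=
    FiniteDimensional.span_of_finite ℝ (Set.finite_range (Φ M))
  inferInstance

/-- The closed-loop input `(t, h) ↦ K(t, P_U h)`, with `P_U` the orthogonal projection
in `H` onto `U`. -/
def feedbackInput {H : Type*} [NormedAddCommGroup H] [InnerProductSpace ℝ H]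
    (U : Submodule ℝ H) [U.HasOrthogonalProjection] (K : ℝ → U → U) (t : ℝ) (h : H) : H :=
  (K t (U.orthogonalProjectionOnto h) : H)

/-- `K ⪯ -lam·1`: `(K(t, p), p)_H ≤ -lam ‖p‖_H²` for all `p ∈ U` and almost every `t > 0`. -/
def IsMonotoneFeedback {H : Type*} [NormedAddCommGroup H] [InnerProductSpace ℝ H]
    (U : Submodule ℝ H) (K : ℝ → U → U) (lam : ℝ≥0) : Prop :=
  ∀ᵐ t ∂(volume.restrict (Ioi (0 : ℝ))), ∀ p : U,
    inner ℝ (K t p : H) (p : H) ≤ -(lam : ℝ) * ‖(p : H)‖ ^ 2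

/-- The assumption on the feedback: `(t, y) ↦ K(t, P_U y) ∈ U ⊂ V'` satisfies the structural
assumption on nonlinearities (with constants and exponents of its own), and `K ⪯ -lam·1`. -/
structure IsAdmissibleFeedback {H V : Type*} [NormedAddCommGroup H] [InnerProductSpace ℝ H]
    [NormedAddCommGroup V] [InnerProductSpace ℝ V] (ι : V →L[ℝ] H)
    (U : Submodule ℝ H) [U.HasOrthogonalProjection] (lam : ℝ≥0) (K : ℝ → U → U) : Prop where
  nonlinearity : ∃ (m : ℕ) (e : NonlinearityExponents m) (C : ℝ≥0),
    IsAdmissibleNonlinearity ι e C (fun t z => pivot ι (feedbackInput U K t (ι z)))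
  monotone : IsMonotoneFeedback U K lam

/-- `w` is the distributional derivative of `u` on `(0,∞)`. -/
def IsDistribDeriv {X : Type*} [NormedAddCommGroup X] [NormedSpace ℝ X] (u w : ℝ → X) : Prop :=
  ∀ φ : ℝ → ℝ, ContDiff ℝ (⊤ : ℕ∞) φ → HasCompactSupport φ → tsupport φ ⊆ Ioi 0 →
    ∫ t in Ioi (0 : ℝ), deriv φ t • u t = -∫ t in Ioi (0 : ℝ), φ t • w t

/-- `y` is a (global) weak solution of
`ẏ + A y + A_rc(t) y + N(t, y) = K(t, P_U y)`, `y(0) = y₀`: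
on each `(0, T)`, `y` lies in `L²(V)` (through the representative `v`) and `ẏ` lies in `L²(V')`
(it is `w`), the equation holds in `V'` at almost every time, and `y`, taken as its
continuous `H`-valued representative, has the initial value `y₀`. -/
def IsWeakSolution {H V : Type*} [NormedAddCommGroup H] [InnerProductSpace ℝ H]
    [NormedAddCommGroup V] [InnerProductSpace ℝ V] (ι : V →L[ℝ] H)
    (A : V →L[ℝ] StrongDual ℝ V) (Arc : ℝ → V →L[ℝ] StrongDual ℝ V)
    (N : ℝ → V → StrongDual ℝ V) (U : Submodule ℝ H) [U.HasOrthogonalProjection]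
    (K : ℝ → U → U) (y₀ : H) (y : ℝ → H) : Prop :=
  ContinuousOn y (Ici 0) ∧ y 0 = y₀ ∧
  ∃ (v : ℝ → V) (w : ℝ → StrongDual ℝ V),
    (∀ᵐ t ∂(volume.restrict (Ioi (0 : ℝ))), y t = ι (v t)) ∧
    (∀ T : ℝ, 0 < T → MemLp v 2 (volume.restrict (Ioo 0 T))) ∧
    (∀ T : ℝ, 0 < T → MemLp w 2 (volume.restrict (Ioo 0 T))) ∧
    IsDistribDeriv (fun t => pivot ι (y t)) w ∧
    ∀ᵐ t ∂(volume.restrict (Ioi (0 : ℝ))),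
      w t + A (v t) + Arc t (v t) + N t (v t) = pivot ι (feedbackInput U K t (y t))

end

/-! The heart is an energy estimate. Testing the equation with `y` gives `½ d/dt |y|_H² = -|y|_V² -
⟨A_rc y, y⟩ - ⟨N(y), y⟩ + (K(P y), P y)_H`. As long as `|y|_H ≤ R`, Young's inequality bounds the
reaction–convection and nonlinear terms by `½|y|_V² + D₀|y|_H²`: the condition `ζ₂ + δ₂ < 1` makes
the nonlinearity subcritical in the `V`-norm, and `N(t, 0) = 0`. The defect, together with the
wanted rate `μ`, is then paid for by `D|y|_H² ≤ ½|y|_V² + c|P y|_H²`. For large `M` this follows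
from the Poincaré constant on `V ∩ U_Mᗮ` and from finite dimensionality of the complement of that
space in `V`; the term `c|P y|²` is swallowed by the feedback once `lam ≥ c`. See
`exists_norm_sq_le_add_projection` and `exists_dissipation_const`.

The estimate holds only inside the ball of radius `R`, but it makes the norm decrease there, so a
solution starting in the open ball never leaves it (`SolvesOn.norm_le_exp`).

Well-posedness rests on the linear problem `ẏ + A y = f`. Compactness of `ι` gives eigenvectors of
`ι* ι` spanning a dense subspace of `V`; along each of them the problem is a scalar ODE. The a
priori estimate `norm_le_evolutionData` shows that the data map has closed range on the closure of
the smooth triples, and density of the eigenvector data makes it onto. The energy identity is a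
closed condition, hence passes from smooth triples to their limits, and then to every triple by
linear uniqueness (`IsEvolutionTriple.norm_sq_eq`). The lower-order terms are treated by a
contraction on intervals whose length depends on the initial value only through `R`; the decay lets
these intervals be chained for all time. Uniqueness is a Grönwall argument.

A du Bois-Reymond argument turns distributional derivatives into integral equations and so
identifies weak solutions with the triples above. Monotone thresholds are obtained by rounding the
four parameters up to one natural number `k` and taking majorants over `k` and `M`. -/

noncomputable section

/-! ### Eigenvectors of `ι* ι` and evolution triples -/

section EvolutionTriple

variable {H V : Type*} [NormedAddCommGroup H] [InnerProductSpace ℝ H]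
  [NormedAddCommGroup V] [InnerProductSpace ℝ V]

@[simp] theorem pivot_apply (ι : V →L[ℝ] H) (h : H) (z : V) :
    pivot ι h z = inner ℝ h (ι z) := rfl

/-- `pivot` as a continuous linear map. -/
def pivotCLM (ι : V →L[ℝ] H) : H →L[ℝ] StrongDual ℝ V :=
  ((ContinuousLinearMap.compL ℝ V H ℝ).flip ι).comp (innerSL ℝ)

@[simp] theorem pivotCLM_apply (ι : V →L[ℝ] H) (h : H) : pivotCLM ι h = pivot ι h := rfl

/-- `e` is an eigenvector, for a positive eigenvalue, of the operator `ι* ι` on `V`. -/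
def IsPivotEigenvector (ι : V →L[ℝ] H) (e : V) : Prop :=
  ∃ κ : ℝ, 0 < κ ∧ ∀ z : V, inner ℝ (ι e) (ι z) = κ * inner ℝ e z

/-- The spectral theorem applies to the compact self-adjoint operator `ι* ι`. Its eigenvalues are
positive because `⟨ι* ι e, e⟩ = |ι e|²` and `ι` is injective. -/
theorem dense_span_isPivotEigenvector [CompleteSpace H] [CompleteSpace V] {ι : V →L[ℝ] H}
    (hinj : Function.Injective ι) (hc : IsCompactOperator ι) :
    Dense (Submodule.span ℝ {e : V | IsPivotEigenvector ι e} : Set V) := by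
  set T : V →L[ℝ] V := (ContinuousLinearMap.adjoint ι).comp ι with hT
  have hTi : ∀ x z, inner ℝ (T x) z = inner ℝ (ι x) (ι z) := fun x z => by
    simp [hT, ContinuousLinearMap.adjoint_inner_left]
  have hcomp : IsCompactOperator T := hc.clm_comp (ContinuousLinearMap.adjoint ι)
  have hsymm : (T : V →ₗ[ℝ] V).IsSymmetric := fun x z => by
    change inner ℝ (T x) z = inner ℝ x (T z)
    rw [real_inner_comm (T z) x]
    rw [hTi, hTi, real_inner_comm]
  have hbot := ContinuousLinearMap.orthogonalComplement_iSup_eigenspaces_eq_bot hcomp hsymm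
  rw [← Submodule.topologicalClosure_eq_top_iff] at hbot
  rw [Submodule.dense_iff_topologicalClosure_eq_top, eq_top_iff, ← hbot]
  refine Submodule.topologicalClosure_mono (iSup_le fun κ e he => ?_)
  rw [Module.End.mem_eigenspace_iff] at he
  by_cases he0 : e = 0
  · simp [he0]
  refine Submodule.subset_span ⟨κ, ?_, fun z => ?_⟩
  · have h1 : inner ℝ (ι e) (ι e) = κ * inner ℝ e e := by
      rw [← hTi]; change inner ℝ ((T : V →ₗ[ℝ] V) e) e = _
      rw [he, real_inner_smul_left]
    rw [real_inner_self_eq_norm_sq, real_inner_self_eq_norm_sq] at h1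
    have h2 : 0 < ‖ι e‖ := norm_pos_iff.2 fun h => he0 (hinj (by simpa using h))
    have h3 : 0 < ‖e‖ := norm_pos_iff.2 he0
    by_contra hκ
    nlinarith [sq_pos_of_pos h2, sq_pos_of_pos h3]
  · rw [← hTi]; change inner ℝ ((T : V →ₗ[ℝ] V) e) z = _
    rw [he, real_inner_smul_left]

/-- `y ∈ C([a,b], H)`, `v ∈ L²((a,b), V)`, `w ∈ L²((a,b), V')` with `y = ι v` and `ẏ = w`. -/
structure IsEvolutionTriple (ι : V →L[ℝ] H) (a b : ℝ) (y : ℝ → H) (v : ℝ → V)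
    (w : ℝ → StrongDual ℝ V) : Prop where
  continuousOn : ContinuousOn y (Icc a b)
  coupling : ∀ᵐ t ∂(volume.restrict (Ioc a b)), y t = ι (v t)
  memLp_fst : MemLp v 2 (volume.restrict (Ioc a b))
  memLp_snd : MemLp w 2 (volume.restrict (Ioc a b))
  integral_eq : ∀ t ∈ Icc a b, pivot ι (y t) = pivot ι (y a) + ∫ s in a..t, w s

end EvolutionTriple

/-! ### Integration tools in `L²` -/

/-- By Hölder, the pairing `L² × L² → L¹` is continuous, and so is integration over a set. This
allows limits in the energy identity. -/
theorem continuous_setIntegral_bilinear {α E F G : Type*} {m : MeasurableSpace α} (μ : Measure α)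
    [NormedAddCommGroup E] [NormedSpace ℝ E] [NormedAddCommGroup F] [NormedSpace ℝ F]
    [NormedAddCommGroup G] [NormedSpace ℝ G] (B : E →L[ℝ] F →L[ℝ] G) (s : Set α) :
    Continuous fun p : Lp E 2 μ × Lp F 2 μ => ∫ t in s, B (p.1 t) (p.2 t) ∂μ := by
  have hcont : Continuous fun p : Lp E 2 μ × Lp F 2 μ => B.holderL μ 2 2 1 p.1 p.2 := by
    fun_prop
  refine ((continuous_setIntegral s).comp hcont).congr fun p => ?_
  refine integral_congr_ae (ae_restrict_of_ae ?_)
  exact B.coeFn_holder p.1 p.2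

theorem MeasureTheory.MemLp.norm_toLp_sq {α E : Type*} {m : MeasurableSpace α} {μ : Measure α}
    [NormedAddCommGroup E] {f : α → E} (hf : MemLp f 2 μ) :
    ‖hf.toLp f‖ ^ 2 = ∫ t, ‖f t‖ ^ 2 ∂μ := by
  have h0 : 0 ≤ ∫ t, ‖f t‖ ^ 2 ∂μ := integral_nonneg fun t => by positivity
  rw [Lp.norm_toLp, hf.eLpNorm_eq_integral_rpow_norm (by simp) (by simp),
    ENNReal.toReal_ofReal (by positivity)]
  simp only [ENNReal.toReal_ofNat, Real.rpow_ofNat]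
  rw [← Real.rpow_natCast, ← Real.rpow_mul h0]
  norm_num

theorem MeasureTheory.Lp.norm_sq_eq_integral {α E : Type*} {m : MeasurableSpace α} {μ : Measure α}
    [NormedAddCommGroup E] (f : Lp E 2 μ) : ‖f‖ ^ 2 = ∫ t, ‖f t‖ ^ 2 ∂μ := by
  conv_lhs => rw [← Lp.toLp_coeFn f (Lp.memLp f)]
  exact (Lp.memLp f).norm_toLp_sq

theorem Continuous.memLp_restrict_Ioc {E : Type*} [NormedAddCommGroup E] {f : ℝ → E}
    (hf : Continuous f) (p : ENNReal) (a b : ℝ) : MemLp f p (volume.restrict (Ioc a b)) := by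
  obtain ⟨C, hC⟩ := isCompact_Icc.exists_bound_of_continuousOn (s := Icc a b) hf.continuousOn
  refine MemLp.of_bound hf.aestronglyMeasurable C ?_
  exact (ae_restrict_mem measurableSet_Ioc).mono fun t ht => hC t (Ioc_subset_Icc_self ht)

theorem MeasureTheory.MemLp.integrable_dual_apply {α V : Type*} {m : MeasurableSpace α}
    {μ : Measure α} [NormedAddCommGroup V] [NormedSpace ℝ V] {w : α → StrongDual ℝ V} {v : α → V}
    (hw : MemLp w 2 μ) (hv : MemLp v 2 μ) : Integrable (fun t => w t (v t)) μ :=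
  memLp_one_iff_integrable.1
    (ContinuousLinearMap.memLp_of_bilin 1 (ContinuousLinearMap.id ℝ (StrongDual ℝ V)) hw hv)

theorem MeasureTheory.MemLp.integrable_norm_sq {α E : Type*} {m : MeasurableSpace α}
    {μ : Measure α} [NormedAddCommGroup E] {f : α → E} (hf : MemLp f 2 μ) :
    Integrable (fun t => ‖f t‖ ^ 2) μ :=
  (memLp_two_iff_integrable_sq_norm hf.1).1 hf

/-! ### The linear problem: closedness and smooth triples -/

section LinearTheory

variable {H V : Type*} [NormedAddCommGroup H] [InnerProductSpace ℝ H]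
  [NormedAddCommGroup V] [InnerProductSpace ℝ V]

/-- The Riesz map of `V`. -/
def rieszCLM (V : Type*) [NormedAddCommGroup V] [InnerProductSpace ℝ V] :
    V →L[ℝ] StrongDual ℝ V := pivotCLM (ContinuousLinearMap.id ℝ V)

@[simp] theorem rieszCLM_apply (v z : V) : rieszCLM V v z = inner ℝ v z := rfl

@[simp] theorem norm_rieszCLM_apply (v : V) : ‖rieszCLM V v‖ = ‖v‖ :=
  innerSL_apply_norm ℝ v

theorem norm_rieszCLM_le : ‖rieszCLM V‖ ≤ 1 :=
  ContinuousLinearMap.opNorm_le_bound _ zero_le_one fun v => by simp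

variable {a b : ℝ}

/-- A sequence converging in `L²` has an almost everywhere convergent subsequence, while uniform
convergence controls every time. -/
theorem isClosed_coupling (ι : V →L[ℝ] H) (hab : a ≤ b) :
    IsClosed {p : C(Icc a b, H) × Lp V 2 (volume.restrict (Ioc a b)) |
      ∀ᵐ t ∂(volume.restrict (Ioc a b)), IccExtend hab p.1 t = ι (p.2 t)} := by
  refine IsSeqClosed.isClosed fun x p hx hp => ?_
  obtain ⟨ns, hns, hae⟩ := (tendstoInMeasure_of_tendsto_Lp
    ((continuous_snd.tendsto p).comp hp)).exists_seq_tendsto_ae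
  have hall : ∀ᵐ t ∂(volume.restrict (Ioc a b)), ∀ n, IccExtend hab (x n).1 t = ι ((x n).2 t) :=
    ae_all_iff.2 hx
  filter_upwards [hae, hall] with t ht1 ht2
  have h1 : Tendsto (fun n => (x (ns n)).1 (projIcc a b hab t)) atTop
      (𝓝 (p.1 (projIcc a b hab t))) :=
    (((continuous_eval_const (projIcc a b hab t)).comp continuous_fst).tendsto p).comp
      (hp.comp hns.tendsto_atTop)
  have h2 : Tendsto (fun n => ι ((x (ns n)).2 t)) atTop (𝓝 (ι (p.2 t))) :=
    (ι.continuous.tendsto _).comp ht1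
  refine tendsto_nhds_unique h1 (h2.congr fun n => (ht2 (ns n)).symm)

/-- The Banach space in which the triples `(y, v, w)` live. -/
abbrev TripleSpace (H V : Type*) [NormedAddCommGroup H] [InnerProductSpace ℝ H]
    [NormedAddCommGroup V] [InnerProductSpace ℝ V] (a b : ℝ) : Type _ :=
  C(Icc a b, H) × Lp V 2 (volume.restrict (Ioc a b)) ×
    Lp (StrongDual ℝ V) 2 (volume.restrict (Ioc a b))

/-- The triples with `y = ι v` and `ẏ = w` which satisfy the energy identity. -/
def regularTriples (ι : V →L[ℝ] H) (hab : a ≤ b) : Set (TripleSpace H V a b) :=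
  {x | (∀ᵐ t ∂(volume.restrict (Ioc a b)), IccExtend hab x.1 t = ι (x.2.1 t)) ∧
    (∀ t : Icc a b, pivot ι (x.1 t) = pivot ι (x.1 ⟨a, left_mem_Icc.2 hab⟩) +
      ∫ s in Ioc a t, x.2.2 s ∂(volume.restrict (Ioc a b))) ∧
    ∀ t : Icc a b, ‖x.1 t‖ ^ 2 = ‖x.1 ⟨a, left_mem_Icc.2 hab⟩‖ ^ 2 +
      2 * ∫ s in Ioc a t, x.2.2 s (x.2.1 s) ∂(volume.restrict (Ioc a b))}

theorem isClosed_regularTriples (ι : V →L[ℝ] H) (hab : a ≤ b) :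
    IsClosed (regularTriples ι hab) := by
  simp only [regularTriples, Set.ofPred_and, Set.ofPred_forall]
  refine IsClosed.inter ?_ (IsClosed.inter ?_ ?_)
  · exact (isClosed_coupling ι hab).preimage
      (f := fun x : TripleSpace H V a b => (x.1, x.2.1)) (by fun_prop)
  · refine isClosed_iInter fun t => isClosed_eq ?_ (Continuous.add ?_ ?_)
    · exact (pivotCLM ι).continuous.comp ((continuous_eval_const t).comp continuous_fst)
    · exact (pivotCLM ι).continuous.comp ((continuous_eval_const _).comp continuous_fst)
    -- The linear integral of `w` is written as the bilinear one with the constant function `1`,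
    -- which lies in `L²` since the interval is bounded.
    · have h := continuous_setIntegral_bilinear (volume.restrict (Ioc a b))
        (ContinuousLinearMap.lsmul ℝ ℝ (E := StrongDual ℝ V)) (Ioc a t)
      have h2 : Continuous fun x : TripleSpace H V a b =>
          ((Lp.const 2 (volume.restrict (Ioc a b)) (1 : ℝ), x.2.2) :
            Lp ℝ 2 (volume.restrict (Ioc a b)) × _) := by fun_prop
      refine (h.comp h2).congr fun x => integral_congr_ae (ae_restrict_of_ae ?_)
      filter_upwards [Lp.coeFn_const 2 (volume.restrict (Ioc a b)) (1 : ℝ)] with s hs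
      change (Lp.const 2 (volume.restrict (Ioc a b)) (1 : ℝ) : ℝ → ℝ) s • x.2.2 s = x.2.2 s
      rw [hs, Function.const_apply, one_smul]
  · refine isClosed_iInter fun t => isClosed_eq ?_ (Continuous.add ?_ (Continuous.const_mul ?_ _))
    · exact (((continuous_eval_const t).comp continuous_fst).norm).pow 2
    · exact (((continuous_eval_const _).comp continuous_fst).norm).pow 2
    · have h := continuous_setIntegral_bilinear (volume.restrict (Ioc a b))
        (ContinuousLinearMap.id ℝ (StrongDual ℝ V)) (Ioc a t)
      have h2 : Continuous fun x : TripleSpace H V a b => (x.2.2, x.2.1) := by fun_prop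
      exact h.comp h2

/-- The triples that come from `C¹` functions with values in `V`. -/
def smoothTriples (ι : V →L[ℝ] H) (a b : ℝ) : Submodule ℝ (TripleSpace H V a b) where
  carrier := {x | ∃ u : ℝ → V, ContDiff ℝ 1 u ∧ (∀ t : Icc a b, x.1 t = ι (u t)) ∧
    x.2.1 =ᵐ[volume.restrict (Ioc a b)] u ∧
    x.2.2 =ᵐ[volume.restrict (Ioc a b)] fun t => pivotCLM ι (ι (deriv u t))}
  add_mem' := by
    rintro x x' ⟨u, hu, h1, h2, h3⟩ ⟨u', hu', h1', h2', h3'⟩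
    refine ⟨u + u', hu.add hu', fun t => by simp [h1, h1'], ?_, ?_⟩
    · exact (Lp.coeFn_add _ _).trans (h2.add h2')
    · refine (Lp.coeFn_add _ _).trans ((h3.add h3').trans (.of_forall fun t => ?_))
      have := deriv_add (hu.differentiable one_ne_zero t) (hu'.differentiable one_ne_zero t)
      simp only [this, Pi.add_apply, map_add]
  zero_mem' := by
    refine ⟨0, contDiff_const, fun t => by simp, Lp.coeFn_zero _ _ _, ?_⟩
    refine (Lp.coeFn_zero _ _ _).trans (.of_forall fun t => ?_)
    have : deriv (0 : ℝ → V) t = 0 := deriv_const t 0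
    simp only [this, map_zero, Pi.zero_apply]
  smul_mem' := by
    rintro c x ⟨u, hu, h1, h2, h3⟩
    refine ⟨c • u, contDiff_const.smul hu, fun t => by simp [h1], ?_, ?_⟩
    · exact (Lp.coeFn_smul _ _).trans (h2.const_smul c)
    · refine (Lp.coeFn_smul _ _).trans ((h3.const_smul c).trans (.of_forall fun t => ?_))
      have := deriv_const_smul c (hu.differentiable one_ne_zero t)
      simp only [this, Pi.smul_apply, map_smul]

theorem exists_mem_smoothTriples (ι : V →L[ℝ] H) (a b : ℝ) {u : ℝ → V} (hu : ContDiff ℝ 1 u) :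
    ∃ x ∈ smoothTriples ι a b, (∀ t : Icc a b, x.1 t = ι (u t)) ∧
      x.2.1 =ᵐ[volume.restrict (Ioc a b)] u ∧
      x.2.2 =ᵐ[volume.restrict (Ioc a b)] fun t => pivotCLM ι (ι (deriv u t)) := by
  have hc : Continuous fun t => pivotCLM ι (ι (deriv u t)) :=
    (pivotCLM ι).continuous.comp (ι.continuous.comp (hu.continuous_deriv le_rfl))
  have h : ∀ t : Icc a b, (⟨fun t : Icc a b => ι (u t),
      ι.continuous.comp (hu.continuous.comp continuous_subtype_val)⟩ : C(Icc a b, H)) t = ι (u t) :=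
    fun _ => rfl
  have h2 := (hu.continuous.memLp_restrict_Ioc 2 a b).coeFn_toLp
  have h3 := (hc.memLp_restrict_Ioc 2 a b).coeFn_toLp
  exact ⟨(_, _, _), ⟨u, hu, h, h2, h3⟩, h, h2, h3⟩

/-- For `C¹` functions both integral identities are the fundamental theorem of calculus, applied to
`ι u` in `V'` and to `|ι u|²`. -/
theorem smoothTriples_subset_regularTriples (ι : V →L[ℝ] H) (hab : a ≤ b) :
    (smoothTriples ι a b : Set (TripleSpace H V a b)) ⊆ regularTriples ι hab := by
  rintro x ⟨u, hu, h1, h2, h3⟩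
  have hd : ∀ t, HasDerivAt u (deriv u t) t := fun t =>
    (hu.differentiable one_ne_zero t).hasDerivAt
  have hcd := hu.continuous_deriv le_rfl
  have hsub : ∀ t : Icc a b, (volume.restrict (Ioc a b)).restrict (Ioc a (t : ℝ)) =
      volume.restrict (Ioc a (t : ℝ)) := fun t => by
    rw [Measure.restrict_restrict measurableSet_Ioc, inter_eq_left.2 (Ioc_subset_Ioc_right t.2.2)]
  refine ⟨?_, fun t => ?_, fun t => ?_⟩
  · filter_upwards [h2, ae_restrict_mem measurableSet_Ioc] with t ht htm
    rw [IccExtend_of_mem hab _ (Ioc_subset_Icc_self htm), h1, ht]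
  · have hI : ∫ s in a..(t : ℝ), pivotCLM ι (ι (deriv u s)) =
        pivotCLM ι (ι (u t)) - pivotCLM ι (ι (u a)) := by
      refine intervalIntegral.integral_eq_sub_of_hasDerivAt
        (f := fun s => pivotCLM ι (ι (u s))) (fun s _ => ?_) ?_
      · exact (pivotCLM ι).hasFDerivAt.comp_hasDerivAt s (ι.hasFDerivAt.comp_hasDerivAt s (hd s))
      · exact ((pivotCLM ι).continuous.comp (ι.continuous.comp hcd)).intervalIntegrable _ _
    rw [integral_congr_ae (ae_restrict_of_ae h3), hsub, ← intervalIntegral.integral_of_le t.2.1,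
      hI, h1, h1]
    simp
  · have hI : ∫ s in a..(t : ℝ), 2 * inner ℝ (ι (u s)) (ι (deriv u s)) =
        ‖ι (u t)‖ ^ 2 - ‖ι (u a)‖ ^ 2 := by
      refine intervalIntegral.integral_eq_sub_of_hasDerivAt
        (f := fun s => ‖ι (u s)‖ ^ 2) (fun s _ => ?_) ?_
      · exact (ι.hasFDerivAt.comp_hasDerivAt s (hd s)).norm_sq
      · refine Continuous.intervalIntegrable ?_ _ _
        have := hu.continuous
        fun_prop
    have h4 : ∀ᵐ s ∂(volume.restrict (Ioc a b)), x.2.2 s (x.2.1 s) =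
        inner ℝ (ι (u s)) (ι (deriv u s)) := by
      filter_upwards [h2, h3] with s hs2 hs3
      rw [hs2, hs3, pivotCLM_apply, pivot_apply, real_inner_comm]
    rw [integral_congr_ae (ae_restrict_of_ae h4), hsub, ← intervalIntegral.integral_of_le t.2.1,
      ← intervalIntegral.integral_const_mul, hI, h1, h1]
    simp

end LinearTheory

/-- Variation of constants. If `e` is an eigenvector of `ι* ι` with eigenvalue `κ`, then `ẏ + A y =
g · A e` with `y = c e` is exactly this equation for `c`. -/
theorem exists_contDiff_linear_ode {κ : ℝ} (hκ : 0 < κ) (a c₀ : ℝ) {g : ℝ → ℝ}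
    (hg : Continuous g) :
    ∃ c : ℝ → ℝ, ContDiff ℝ 1 c ∧ c a = c₀ ∧ ∀ t, κ * deriv c t + c t = g t := by
  set p : ℝ → ℝ := fun s => Real.exp ((s - a) / κ) * g s / κ with hp
  have hpc : Continuous p := by fun_prop
  set c : ℝ → ℝ := fun t => Real.exp (-((t - a) / κ)) * (c₀ + ∫ s in a..t, p s) with hc
  have hd : ∀ t, HasDerivAt c ((g t - c t) / κ) t := fun t => by
    have h1 : HasDerivAt (fun t => ∫ s in a..t, p s) (p t) t :=
      intervalIntegral.integral_hasDerivAt_right (hpc.intervalIntegrable _ _)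
        (hpc.stronglyMeasurableAtFilter _ _) hpc.continuousAt
    have h2 : HasDerivAt (fun t : ℝ => Real.exp (-((t - a) / κ)))
        (Real.exp (-((t - a) / κ)) * -(1 / κ)) t :=
      ((((hasDerivAt_id t).sub_const a).div_const κ).fun_neg).exp
    convert! h2.mul (h1.const_add c₀) using 1
    have h3 : Real.exp (-((t - a) / κ)) * Real.exp ((t - a) / κ) = 1 := by
      rw [← Real.exp_add]; simp
    simp only [hc, hp]
    linear_combination (-(g t / κ)) * h3
  have hdiff : Differentiable ℝ c := fun t => (hd t).differentiableAt
  have hderiv : deriv c = fun t => (g t - c t) / κ := funext fun t => (hd t).deriv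
  refine ⟨c, contDiff_one_iff_deriv.2 ⟨hdiff, ?_⟩, by simp [hc], fun t => ?_⟩
  · rw [hderiv]
    exact (hg.sub hdiff.continuous).div_const κ
  · rw [hderiv]; field_simp; ring

/-! ### The linear problem: a priori estimate and solvability -/

section LinearTheory

variable {H V : Type*} [NormedAddCommGroup H] [InnerProductSpace ℝ H]
  [NormedAddCommGroup V] [InnerProductSpace ℝ V] {a b : ℝ}

/-- The data `(y(a), ẏ + A y)` of a triple. -/
def evolutionData (hab : a ≤ b) :
    TripleSpace H V a b →L[ℝ] H × Lp (StrongDual ℝ V) 2 (volume.restrict (Ioc a b)) :=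
  ((ContinuousMap.evalCLM ℝ (⟨a, left_mem_Icc.2 hab⟩ : Icc a b)).comp
    (ContinuousLinearMap.fst ℝ _ _)).prod
  ((ContinuousLinearMap.snd ℝ _ _).comp (ContinuousLinearMap.snd ℝ _ _) +
    ((rieszCLM V).compLpL 2 (volume.restrict (Ioc a b))).comp
      ((ContinuousLinearMap.fst ℝ _ _).comp (ContinuousLinearMap.snd ℝ _ _)))

theorem evolutionData_fst (hab : a ≤ b) (x : TripleSpace H V a b) :
    (evolutionData hab x).1 = x.1 ⟨a, left_mem_Icc.2 hab⟩ := rfl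

theorem evolutionData_snd (hab : a ≤ b) (x : TripleSpace H V a b) :
    (evolutionData hab x).2 = x.2.2 + (rieszCLM V).compLpL 2 (volume.restrict (Ioc a b)) x.2.1 :=
  rfl

theorem coeFn_evolutionData_snd (hab : a ≤ b) (x : TripleSpace H V a b) :
    (evolutionData hab x).2 =ᵐ[volume.restrict (Ioc a b)]
      fun t => x.2.2 t + rieszCLM V (x.2.1 t) := by
  rw [evolutionData_snd]
  filter_upwards [Lp.coeFn_add x.2.2 ((rieszCLM V).compLpL 2 (volume.restrict (Ioc a b)) x.2.1),
    (rieszCLM V).coeFn_compLpL (p := 2) x.2.1] with t h1 h2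
  rw [h1, Pi.add_apply, h2]

/-- With `f = w + A v`, the energy identity and `2⟨w, v⟩ = 2⟨f, v⟩ - 2|v|² ≤ |f|² - |v|²` bound `y`
and `v`; then `w = f - A v` is bounded too. The constants are generous. -/
theorem norm_le_evolutionData {ι : V →L[ℝ] H} (hab : a ≤ b) {x : TripleSpace H V a b}
    (hx : x ∈ regularTriples ι hab) : ‖x‖ ≤ 4 * ‖evolutionData hab x‖ := by
  obtain ⟨-, -, hen⟩ := hx
  set f := (evolutionData hab x).2 with hf
  set D := ‖evolutionData hab x‖ with hD
  have hD0 : 0 ≤ D := norm_nonneg _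
  have hfD : ‖f‖ ≤ D := norm_snd_le _
  have haD : ‖x.1 ⟨a, left_mem_Icc.2 hab⟩‖ ≤ D := norm_fst_le (evolutionData hab x)
  have hv2 := (Lp.memLp x.2.1).integrable_norm_sq
  have hf2 := (Lp.memLp f).integrable_norm_sq
  have hwv := (Lp.memLp x.2.2).integrable_dual_apply (Lp.memLp x.2.1)
  have hpt : ∀ᵐ s ∂(volume.restrict (Ioc a b)),
      2 * x.2.2 s (x.2.1 s) ≤ ‖f s‖ ^ 2 - ‖x.2.1 s‖ ^ 2 := by
    filter_upwards [coeFn_evolutionData_snd hab x] with s hs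
    have h1 : f s (x.2.1 s) = x.2.2 s (x.2.1 s) + ‖x.2.1 s‖ ^ 2 := by
      rw [hf, hs, add_apply, rieszCLM_apply, real_inner_self_eq_norm_sq]
    have h2 := (le_abs_self _).trans ((f s).le_opNorm (x.2.1 s))
    nlinarith [sq_nonneg (‖f s‖ - ‖x.2.1 s‖)]
  have hest : ∀ t : Icc a b, ‖x.1 t‖ ^ 2 +
      ∫ s in Ioc a t, ‖x.2.1 s‖ ^ 2 ∂(volume.restrict (Ioc a b)) ≤ 2 * D ^ 2 := fun t => by
    have h1 : 2 * ∫ s in Ioc a (t : ℝ), x.2.2 s (x.2.1 s) ∂(volume.restrict (Ioc a b)) ≤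
        (∫ s in Ioc a (t : ℝ), ‖f s‖ ^ 2 ∂(volume.restrict (Ioc a b))) -
          ∫ s in Ioc a (t : ℝ), ‖x.2.1 s‖ ^ 2 ∂(volume.restrict (Ioc a b)) := by
      rw [← integral_const_mul, ← integral_sub hf2.restrict hv2.restrict]
      exact integral_mono_ae (hwv.restrict.const_mul 2) (hf2.restrict.sub hv2.restrict)
        (ae_restrict_of_ae hpt)
    have h2 : ∫ s in Ioc a (t : ℝ), ‖f s‖ ^ 2 ∂(volume.restrict (Ioc a b)) ≤ ‖f‖ ^ 2 := by
      rw [Lp.norm_sq_eq_integral]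
      exact setIntegral_le_integral hf2 (.of_forall fun s => by positivity)
    have h3 := hen t
    have h4 : ‖f‖ ^ 2 ≤ D ^ 2 := by gcongr
    have h5 : ‖x.1 ⟨a, left_mem_Icc.2 hab⟩‖ ^ 2 ≤ D ^ 2 := by gcongr
    linarith
  have hy : ‖x.1‖ ≤ 2 * D := by
    refine (ContinuousMap.norm_le _ (by positivity)).2 fun t => ?_
    have h0 : 0 ≤ ∫ s in Ioc a (t : ℝ), ‖x.2.1 s‖ ^ 2 ∂(volume.restrict (Ioc a b)) :=
      integral_nonneg fun s => by positivity
    refine abs_le_of_sq_le_sq' ?_ (by positivity) |>.2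
    nlinarith [hest t]
  have hv : ‖x.2.1‖ ≤ 2 * D := by
    have h1 := hest ⟨b, right_mem_Icc.2 hab⟩
    rw [Measure.restrict_restrict measurableSet_Ioc, inter_self, ← Lp.norm_sq_eq_integral] at h1
    refine abs_le_of_sq_le_sq' ?_ (by positivity) |>.2
    nlinarith [sq_nonneg ‖x.1 ⟨b, right_mem_Icc.2 hab⟩‖]
  have hw : ‖x.2.2‖ ≤ 3 * D := by
    have h1 : x.2.2 = f - (rieszCLM V).compLpL 2 (volume.restrict (Ioc a b)) x.2.1 := by
      rw [hf, evolutionData_snd, add_sub_cancel_right]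
    have h2 : ‖(rieszCLM V).compLpL 2 (volume.restrict (Ioc a b)) x.2.1‖ ≤ ‖x.2.1‖ := by
      refine ((rieszCLM V).norm_compLp_le x.2.1).trans ?_
      exact mul_le_of_le_one_left (norm_nonneg _) norm_rieszCLM_le
    rw [h1]
    exact (norm_sub_le _ _).trans (by linarith)
  refine norm_prod_le_iff.2 ⟨by linarith, norm_prod_le_iff.2 ⟨by linarith, by linarith⟩⟩

/-- Eigenvector data is attained by smooth triples. -/
theorem exists_smoothTriples_evolutionData {ι : V →L[ℝ] H} (hab : a ≤ b) {e : V}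
    (he : IsPivotEigenvector ι e) (c₀ : ℝ) {g : ℝ → ℝ} (hg : Continuous g) :
    ∃ x ∈ smoothTriples ι a b, (evolutionData hab x).1 = c₀ • ι e ∧
      (evolutionData hab x).2 =ᵐ[volume.restrict (Ioc a b)] fun t => g t • rieszCLM V e := by
  obtain ⟨κ, hκ, hκe⟩ := he
  obtain ⟨c, hc, hca, hode⟩ := exists_contDiff_linear_ode hκ a c₀ hg
  obtain ⟨x, hx, h1, h2, h3⟩ := exists_mem_smoothTriples ι a b (u := fun t => c t • e)
    (hc.smul contDiff_const)
  refine ⟨x, hx, by rw [evolutionData_fst, h1, hca, map_smul], ?_⟩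
  filter_upwards [coeFn_evolutionData_snd hab x, h2, h3] with t ht1 ht2 ht3
  -- As elements of `V'`, `e` and `A e` are proportional, so `ẏ` and `A y` stay on a single line.
  have hpe : pivotCLM ι (ι e) = κ • rieszCLM V e := by
    ext z; simp [hκe]
  have hder : deriv (fun t => c t • e) t = deriv c t • e :=
    ((hc.differentiable one_ne_zero t).hasDerivAt.smul_const e).deriv
  rw [ht1, ht2, ht3, hder, map_smul, map_smul, map_smul, hpe, smul_smul, ← add_smul, ← hode t]
  ring_nf

/-- The closure `Q` is a closed subspace, so the two components of the data can be treated
separately. It contains `(ι e, 0)` and `(0, g · A e)` for eigenvectors `e`. Density of their span in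
`V` and of `ι V` in `H` gives all initial values; density of continuous functions in `L²`, followed
by that of the span and of simple functions, gives all right-hand sides. -/
theorem dense_evolutionData_smoothTriples [CompleteSpace H] [CompleteSpace V] {ι : V →L[ℝ] H}
    (hinj : Function.Injective ι) (hd : DenseRange ι) (hc : IsCompactOperator ι) (hab : a ≤ b) :
    ((smoothTriples ι a b).map (evolutionData hab).toLinearMap).topologicalClosure = ⊤ := by
  set μ := volume.restrict (Ioc a b) with hμ
  set Q := ((smoothTriples ι a b).map (evolutionData hab).toLinearMap).topologicalClosure with hQ
  have hQc : IsClosed (Q : Set (H × Lp (StrongDual ℝ V) 2 μ)) :=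
    Submodule.isClosed_topologicalClosure _
  have hspan := dense_span_isPivotEigenvector hinj hc
  have hmem : ∀ (e : V), IsPivotEigenvector ι e → ∀ (c₀ : ℝ) (g : ℝ → ℝ), Continuous g →
      ∀ f : Lp (StrongDual ℝ V) 2 μ, f =ᵐ[μ] (fun t => g t • rieszCLM V e) →
      (c₀ • ι e, f) ∈ Q := fun e he c₀ g hg f hf => by
    obtain ⟨x, hx, h1, h2⟩ := exists_smoothTriples_evolutionData hab he c₀ hg
    refine Submodule.le_topologicalClosure _ ⟨x, hx, Prod.ext h1 (Lp.ext (h2.trans hf.symm))⟩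
  have hfst : ∀ h : H, (h, (0 : Lp (StrongDual ℝ V) 2 μ)) ∈ Q := by
    have h1 : ∀ v : V, (ι v, (0 : Lp (StrongDual ℝ V) 2 μ)) ∈ Q := fun v => by
      refine hspan.induction (P := fun v => (ι v, (0 : Lp (StrongDual ℝ V) 2 μ)) ∈ Q)
        (fun v hv => ?_) ?_ v
      · have : Submodule.span ℝ {e : V | IsPivotEigenvector ι e} ≤ Q.comap
            ((LinearMap.inl ℝ H (Lp (StrongDual ℝ V) 2 μ)).comp ι.toLinearMap) := by
          refine Submodule.span_le.2 fun e he => ?_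
          have := hmem e he 1 0 continuous_const 0
            ((Lp.coeFn_zero _ _ _).trans (.of_forall fun t => by simp))
          simpa using this
        exact this hv
      · exact hQc.preimage (ι.continuous.prodMk continuous_const)
    intro h
    exact hd.induction_on (p := fun h => (h, (0 : Lp (StrongDual ℝ V) 2 μ)) ∈ Q) h
      (hQc.preimage (continuous_id.prodMk continuous_const)) h1
  have hsnd : ∀ f : Lp (StrongDual ℝ V) 2 μ, ((0 : H), f) ∈ Q := by
    have hcl : IsClosed {f : Lp (StrongDual ℝ V) 2 μ | ((0 : H), f) ∈ Q} :=
      hQc.preimage (continuous_const.prodMk continuous_id)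
    have h1 : ∀ (e : V), IsPivotEigenvector ι e → ∀ g : Lp ℝ 2 μ,
        ((0 : H), (ContinuousLinearMap.toSpanSingleton ℝ (rieszCLM V e)).compLpL 2 μ g) ∈ Q := by
      intro e he g
      refine (BoundedContinuousFunction.toLp_denseRange ℝ μ ℝ
        (p := 2) (by simp)).induction_on (p := fun g => ((0 : H),
        (ContinuousLinearMap.toSpanSingleton ℝ (rieszCLM V e)).compLpL 2 μ g) ∈ Q) g ?_ ?_
      · exact hQc.preimage (continuous_const.prodMk (ContinuousLinearMap.continuous _))
      · intro g
        have := hmem e he 0 g g.continuous _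
          (((ContinuousLinearMap.toSpanSingleton ℝ (rieszCLM V e)).coeFn_compLpL (p := 2) (μ := μ)
            (BoundedContinuousFunction.toLp 2 μ ℝ g)).trans ?_)
        · simpa using this
        · filter_upwards [BoundedContinuousFunction.coeFn_toLp 2 μ ℝ g] with t ht
          rw [ht]; rfl
    have h2 : ∀ {s : Set ℝ} (hs : MeasurableSet s) (hμs : μ s ≠ ⊤) (v : V),
        ((0 : H), indicatorConstLp 2 hs hμs (rieszCLM V v)) ∈ Q := by
      intro s hs hμs v
      -- Writing `1_s · z` as a continuous linear function of `z` lets membership in `Q` pass from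
      -- eigenvectors to their span and its closure.
      have hlin : ∀ z : StrongDual ℝ V, indicatorConstLp 2 hs hμs z =
          (ContinuousLinearMap.compLpL₂ 2 μ (ContinuousLinearMap.lsmul ℝ ℝ).flip z
            (indicatorConstLp 2 hs hμs (1 : ℝ))) := fun z => by
        refine Lp.ext ?_
        filter_upwards [indicatorConstLp_coeFn (p := 2) (hs := hs) (hμs := hμs) (c := z),
          indicatorConstLp_coeFn (p := 2) (hs := hs) (hμs := hμs) (c := (1 : ℝ)),
          ((ContinuousLinearMap.lsmul ℝ ℝ).flip z).coeFn_compLp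
            (indicatorConstLp 2 hs hμs (1 : ℝ))] with t h1 h2 h3
        rw [h1, ContinuousLinearMap.compLpL₂_apply_apply, h3, h2]
        by_cases hts : t ∈ s <;> simp [hts]
      refine hspan.induction (P := fun v => ((0 : H), indicatorConstLp 2 hs hμs (rieszCLM V v)) ∈ Q)
        (fun v hv => ?_) ?_ v
      · have : Submodule.span ℝ {e : V | IsPivotEigenvector ι e} ≤ Q.comap
            ((LinearMap.inr ℝ H (Lp (StrongDual ℝ V) 2 μ)).comp
              (((ContinuousLinearMap.compLpL₂ 2 μ
                (ContinuousLinearMap.lsmul ℝ ℝ (E := StrongDual ℝ V)).flip).flip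
              (indicatorConstLp 2 hs hμs (1 : ℝ))).comp (rieszCLM V)).toLinearMap) := by
          refine Submodule.span_le.2 fun e he => ?_
          exact h1 e he _
        have h3 := this hv
        rw [hlin]
        exact h3
      · simp only [hlin]
        exact hQc.preimage (continuous_const.prodMk (by fun_prop))
    intro f
    refine Lp.induction (p := 2) (by simp) (fun f => ((0 : H), f) ∈ Q) ?_ ?_ hcl f
    · intro z s hs hμs
      obtain ⟨v, rfl⟩ := (InnerProductSpace.toDual ℝ V).surjective z
      exact h2 hs hμs.ne v
    · intro f g hf hg _ h3 h4
      have := Q.add_mem h3 h4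
      rwa [Prod.mk_add_mk, add_zero] at this
  rw [eq_top_iff]
  rintro ⟨h, f⟩ -
  have := Q.add_mem (hfst h) (hsnd f)
  rwa [Prod.mk_add_mk, add_zero, zero_add] at this

/-- The linear problem `ẏ + A y = f`, `y(a) = h` has a solution satisfying the energy identity. -/
theorem exists_regularTriples_evolutionData [CompleteSpace H] [CompleteSpace V] {ι : V →L[ℝ] H}
    (hinj : Function.Injective ι) (hd : DenseRange ι) (hc : IsCompactOperator ι) (hab : a ≤ b)
    (h : H) (f : Lp (StrongDual ℝ V) 2 (volume.restrict (Ioc a b))) :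
    ∃ x ∈ regularTriples ι hab, evolutionData hab x = (h, f) := by
  set S := (smoothTriples ι a b).topologicalClosure with hS
  have hSr : (S : Set (TripleSpace H V a b)) ⊆ regularTriples ι hab :=
    closure_minimal (smoothTriples_subset_regularTriples ι hab) (isClosed_regularTriples ι hab)
  have hScomplete : CompleteSpace S :=
    (Submodule.isClosed_topologicalClosure _).completeSpace_coe
  -- A map bounded below on a complete space has closed range; as the range also contains the dense
  -- set of smooth data, it is everything.
  have hanti : AntilipschitzWith 4 ((evolutionData hab).comp S.subtypeL) :=
    ContinuousLinearMap.antilipschitz_of_bound _ fun x => norm_le_evolutionData hab (hSr x.2)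
  have hcl : IsClosed (Set.range ((evolutionData hab).comp S.subtypeL)) :=
    (hanti.isComplete_range ((evolutionData hab).comp S.subtypeL).uniformContinuous).isClosed
  have hmem : (h, f) ∈ Set.range ((evolutionData hab).comp S.subtypeL) := by
    have h1 : (h, f) ∈ ((smoothTriples ι a b).map
        (evolutionData hab).toLinearMap).topologicalClosure := by
      rw [dense_evolutionData_smoothTriples hinj hd hc hab]; trivial
    refine closure_minimal ?_ hcl h1
    rintro _ ⟨x, hx, rfl⟩
    exact ⟨⟨x, Submodule.le_topologicalClosure _ hx⟩, rfl⟩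
  obtain ⟨x, hx⟩ := hmem
  exact ⟨x, hSr x.2, hx⟩

end LinearTheory

/-- A Grönwall lemma with an integrable coefficient. -/
theorem eq_zero_of_le_add_integral_mul {u ρ : ℝ → ℝ} {a b : ℝ} (hu : ContinuousOn u (Icc a b))
    (hu0 : ∀ t ∈ Icc a b, 0 ≤ u t) (hρ0 : ∀ t, 0 ≤ ρ t) (hρ : IntegrableOn ρ (Ioc a b))
    (h : ∀ s t, a ≤ s → s ≤ t → t ≤ b → u t ≤ u s + ∫ r in s..t, ρ r * u r) (ha : u a = 0) :
    ∀ t ∈ Icc a b, u t = 0 := by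
  refine IsClosed.Icc_subset_of_forall_exists_gt (s := {t | u t = 0}) ?_ ha ?_
  · have := hu.preimage_isClosed_of_isClosed isClosed_Icc (isClosed_singleton (x := (0 : ℝ)))
    rwa [inter_comm] at this
  rintro x ⟨hx0, hx⟩ y hy
  have hcont : ContinuousOn (fun t => ∫ r in x..t, ρ r) (Icc x b) := by
    rw [← uIcc_of_le hx.2.le]
    refine intervalIntegral.continuousOn_primitive_interval ?_
    rw [uIcc_of_le hx.2.le, integrableOn_Icc_iff_integrableOn_Ioc]
    exact hρ.mono_set (Ioc_subset_Ioc_left hx.1)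
  -- Just to the right of a zero `x` the integral of `ρ` is below `1/2`, so the maximum of `u` over
  -- `[x, z]` is at most half of itself.
  obtain ⟨z, hz1, hz2, hzI⟩ : ∃ z, z ∈ Ioc x (min y b) ∧ z ≤ b ∧ ∫ r in x..z, ρ r < 1 / 2 := by
    have hc := (hcont x (left_mem_Icc.2 hx.2.le)).mono (Ioc_subset_Icc_self (a := x) (b := b))
    have h1 : ∀ᶠ t in 𝓝[Ioc x b] x, ∫ r in x..t, ρ r < 1 / 2 :=
      hc.eventually (gt_mem_nhds (by simp))
    rw [nhdsWithin_Ioc_eq_nhdsGT hx.2] at h1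
    have h2 : ∀ᶠ t in 𝓝[>] x, t ∈ Ioc x (min y b) := Ioc_mem_nhdsGT (lt_min hy hx.2)
    obtain ⟨z, hz⟩ := (h1.and h2).exists
    exact ⟨z, hz.2, hz.2.2.trans (min_le_right _ _), hz.1⟩
  refine ⟨z, ?_, hz1.1, hz1.2.trans (min_le_left _ _)⟩
  have hsub : Icc x z ⊆ Icc a b := Icc_subset_Icc hx.1 hz2
  obtain ⟨m, hm, hmax⟩ := isCompact_Icc.exists_isMaxOn (nonempty_Icc.2 hz1.1.le) (hu.mono hsub)
  have hI : ∫ r in x..m, ρ r * u r ≤ 1 / 2 * u m := by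
    have hρx : IntervalIntegrable ρ volume x z :=
      (intervalIntegrable_iff_integrableOn_Ioc_of_le hz1.1.le).2
        (hρ.mono_set (Ioc_subset_Ioc hx.1 hz2))
    have hρm : IntervalIntegrable ρ volume x m :=
      (intervalIntegrable_iff_integrableOn_Ioc_of_le hm.1).2
        (hρ.mono_set (Ioc_subset_Ioc hx.1 (hm.2.trans hz2)))
    calc ∫ r in x..m, ρ r * u r ≤ ∫ r in x..m, ρ r * u m := by
          refine intervalIntegral.integral_mono_on hm.1 ?_ (hρm.mul_const _) fun r hr => ?_
          · refine hρm.mul_continuousOn (hu.mono ?_)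
            rw [uIcc_of_le hm.1]
            exact (Icc_subset_Icc_right hm.2).trans hsub
          · exact mul_le_mul_of_nonneg_left (hmax ⟨hr.1, hr.2.trans hm.2⟩) (hρ0 r)
      _ = (∫ r in x..m, ρ r) * u m := intervalIntegral.integral_mul_const _ _
      _ ≤ 1 / 2 * u m := by
          refine mul_le_mul_of_nonneg_right (le_trans ?_ hzI.le) (hu0 m (hsub hm))
          exact intervalIntegral.integral_mono_interval le_rfl hm.1 hm.2
            (.of_forall hρ0) hρx
  have hm1 := h x m hx.1 hm.1 (hm.2.trans hz2)
  rw [show u x = 0 from hx0] at hm1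
  have hm0 := hu0 m (hsub hm)
  have hz := hmax (right_mem_Icc.2 hz1.1.le)
  have hz0 := hu0 z (hsub (right_mem_Icc.2 hz1.1.le))
  simp only [mem_ofPred_eq] at hz ⊢
  linarith

theorem MeasureTheory.MemLp.add_group {α E : Type*} {m : MeasurableSpace α} {μ : Measure α}
    {p : ENNReal} [NormedAddCommGroup E] {f g : α → E} (hf : MemLp f p μ) (hg : MemLp g p μ) :
    MemLp (fun r => f r + g r) p μ := hf.add hg

/-! ### Uniqueness and the energy identity for arbitrary triples -/

section LinearTheory

variable {H V : Type*} [NormedAddCommGroup H] [InnerProductSpace ℝ H]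
  [NormedAddCommGroup V] [InnerProductSpace ℝ V] {a b : ℝ} {ι : V →L[ℝ] H}

namespace IsEvolutionTriple

variable {y y' : ℝ → H} {v v' : ℝ → V} {w w' : ℝ → StrongDual ℝ V}

theorem intervalIntegrable (h : IsEvolutionTriple ι a b y v w) {s t : ℝ} (has : a ≤ s)
    (hst : s ≤ t) (htb : t ≤ b) : IntervalIntegrable w volume s t :=
  (intervalIntegrable_iff_integrableOn_Ioc_of_le hst).2
    (IntegrableOn.mono_set (h.memLp_snd.integrable one_le_two) (Ioc_subset_Ioc has htb))

theorem pivot_eq_add_integral (h : IsEvolutionTriple ι a b y v w) {s t : ℝ} (has : a ≤ s)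
    (hst : s ≤ t) (htb : t ≤ b) : pivot ι (y t) = pivot ι (y s) + ∫ r in s..t, w r := by
  rw [h.integral_eq t ⟨has.trans hst, htb⟩, h.integral_eq s ⟨has, hst.trans htb⟩, add_assoc,
    intervalIntegral.integral_add_adjacent_intervals (h.intervalIntegrable le_rfl has
      (hst.trans htb)) (h.intervalIntegrable has hst htb)]

theorem mono (h : IsEvolutionTriple ι a b y v w) {a' b' : ℝ} (ha : a ≤ a') (hb : b' ≤ b) :
    IsEvolutionTriple ι a' b' y v w where
  continuousOn := h.continuousOn.mono (Icc_subset_Icc ha hb)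
  coupling := ae_restrict_of_ae_restrict_of_subset (Ioc_subset_Ioc ha hb) h.coupling
  memLp_fst := h.memLp_fst.mono_measure (Measure.restrict_mono_set _ (Ioc_subset_Ioc ha hb))
  memLp_snd := h.memLp_snd.mono_measure (Measure.restrict_mono_set _ (Ioc_subset_Ioc ha hb))
  integral_eq _ ht := h.pivot_eq_add_integral ha ht.1 (ht.2.trans hb)

theorem sub (h : IsEvolutionTriple ι a b y v w) (h' : IsEvolutionTriple ι a b y' v' w') :
    IsEvolutionTriple ι a b (y - y') (v - v') (w - w') where
  continuousOn := h.continuousOn.sub h'.continuousOn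
  coupling := by
    filter_upwards [h.coupling, h'.coupling] with t h1 h2
    simp [h1, h2]
  memLp_fst := h.memLp_fst.sub h'.memLp_fst
  memLp_snd := h.memLp_snd.sub h'.memLp_snd
  integral_eq t ht := by
    have h1 := h.integral_eq t ht
    have h2 := h'.integral_eq t ht
    simp only [← pivotCLM_apply, Pi.sub_apply, map_sub] at h1 h2 ⊢
    rw [h1, h2, intervalIntegral.integral_sub (h.intervalIntegrable le_rfl ht.1 ht.2)
      (h'.intervalIntegrable le_rfl ht.1 ht.2)]
    abel

theorem congr (h : IsEvolutionTriple ι a b y v w) (hab : a ≤ b) (hy : EqOn y' y (Icc a b))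
    (hv : v' =ᵐ[volume.restrict (Ioc a b)] v) (hw : w' =ᵐ[volume.restrict (Ioc a b)] w) :
    IsEvolutionTriple ι a b y' v' w' where
  continuousOn := h.continuousOn.congr hy
  coupling := by
    filter_upwards [h.coupling, hv, ae_restrict_mem measurableSet_Ioc] with t h1 h2 ht
    rw [hy (Ioc_subset_Icc_self ht), h1, h2]
  memLp_fst := (memLp_congr_ae hv).2 h.memLp_fst
  memLp_snd := (memLp_congr_ae hw).2 h.memLp_snd
  integral_eq t ht := by
    rw [hy ht, hy (left_mem_Icc.2 hab), h.integral_eq t ht]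
    congr 1
    refine intervalIntegral.integral_congr_ae_restrict ?_
    rw [uIoc_of_le ht.1]
    exact EventuallyEq.symm
      (ae_restrict_of_ae_restrict_of_subset (Ioc_subset_Ioc_right ht.2) hw)

theorem of_mem_regularTriples {hab : a ≤ b} {x : TripleSpace H V a b}
    (hx : x ∈ regularTriples ι hab) :
    IsEvolutionTriple ι a b (IccExtend hab x.1) x.2.1 x.2.2 where
  continuousOn := x.1.continuous.Icc_extend'.continuousOn
  coupling := hx.1
  memLp_fst := Lp.memLp _
  memLp_snd := Lp.memLp _
  integral_eq t ht := by
    have := hx.2.1 ⟨t, ht⟩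
    rw [Measure.restrict_restrict measurableSet_Ioc,
      inter_eq_left.2 (Ioc_subset_Ioc_right ht.2)] at this
    rw [IccExtend_of_mem hab _ ht, IccExtend_of_mem hab _ (left_mem_Icc.2 hab), this,
      intervalIntegral.integral_of_le ht.1]

/-- Uniqueness for the linear problem `ẏ + A y = 0`, `y(a) = 0`. -/
theorem eq_zero_of_add_riesz_eq_zero [CompleteSpace H] [CompleteSpace V]
    (hinj : Function.Injective ι) (hd : DenseRange ι) (hc : IsCompactOperator ι)
    (h : IsEvolutionTriple ι a b y v w) (hya : y a = 0)
    (heq : ∀ᵐ t ∂(volume.restrict (Ioc a b)), w t + rieszCLM V (v t) = 0) :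
    ∀ t ∈ Icc a b, y t = 0 := by
  -- The energy identity is not yet available for arbitrary triples. Testing with an eigenvector
  -- avoids it: the coefficient `f = (y, ι e)` satisfies `f' = -κ⁻¹ f` in integrated form and starts
  -- at zero.
  have heig : ∀ e : V, IsPivotEigenvector ι e → ∀ t ∈ Icc a b, inner ℝ (y t) (ι e) = 0 := by
    rintro e ⟨κ, hκ, he⟩ t ht
    have hcont : ContinuousOn (fun t => inner ℝ (y t) (ι e)) (Icc a b) :=
      h.continuousOn.inner continuousOn_const
    rw [← abs_eq_zero]
    refine eq_zero_of_le_add_integral_mul (u := fun t => |inner ℝ (y t) (ι e)|)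
      (ρ := fun _ => κ⁻¹) hcont.abs (fun _ _ => abs_nonneg _)
      (fun _ => by positivity) (integrableOn_const (by simp)) ?_ (by simp [hya]) t ht
    intro s t has hst htb
    have h1 : inner ℝ (y t) (ι e) = inner ℝ (y s) (ι e) + ∫ r in s..t, w r e := by
      have := DFunLike.congr_fun (h.pivot_eq_add_integral has hst htb) e
      rw [add_apply, ContinuousLinearMap.intervalIntegral_apply
        (h.intervalIntegrable has hst htb)] at this
      simpa using this
    have h2 : ∫ r in s..t, w r e = ∫ r in s..t, -(κ⁻¹ * inner ℝ (y r) (ι e)) := by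
      refine intervalIntegral.integral_congr_ae_restrict ?_
      rw [uIoc_of_le hst]
      filter_upwards [ae_restrict_of_ae_restrict_of_subset (Ioc_subset_Ioc has htb) heq,
        ae_restrict_of_ae_restrict_of_subset (Ioc_subset_Ioc has htb) h.coupling] with r h3 h4
      rw [h4, real_inner_comm, he, eq_neg_of_add_eq_zero_left h3]
      simp only [neg_apply, rieszCLM_apply, real_inner_comm e]
      field_simp
    rw [h1, h2]
    refine (abs_add_le _ _).trans (add_le_add le_rfl ?_)
    refine (intervalIntegral.abs_integral_le_integral_abs hst).trans (le_of_eq ?_)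
    refine intervalIntegral.integral_congr fun r _ => ?_
    simp only [abs_neg, abs_mul, abs_of_pos (inv_pos.2 hκ)]
  intro t ht
  refine hd.eq_zero_of_inner_left ℝ fun z => ?_
  refine (dense_span_isPivotEigenvector hinj hc).induction
    (P := fun z => inner ℝ (y t) (ι z) = 0) (fun z hz => ?_) ?_ z
  · have : Submodule.span ℝ {e : V | IsPivotEigenvector ι e} ≤ LinearMap.ker
        (pivot ι (y t)).toLinearMap :=
      Submodule.span_le.2 fun e he => heig e he t ht
    exact this hz
  · exact isClosed_eq (by fun_prop) continuous_const

/-- Existence for the linear problem `ẏ + A y = f`, `y(a) = h`, with the energy identity. -/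
theorem exists_linear [CompleteSpace H] [CompleteSpace V]
    (hinj : Function.Injective ι) (hd : DenseRange ι) (hc : IsCompactOperator ι) (hab : a ≤ b)
    (h : H) {f : ℝ → StrongDual ℝ V} (hf : MemLp f 2 (volume.restrict (Ioc a b))) :
    ∃ x ∈ regularTriples ι hab, IccExtend hab x.1 a = h ∧
      ∀ᵐ t ∂(volume.restrict (Ioc a b)), x.2.2 t + rieszCLM V (x.2.1 t) = f t := by
  obtain ⟨x, hx, hdata⟩ := exists_regularTriples_evolutionData hinj hd hc hab h (hf.toLp f)
  refine ⟨x, hx, ?_, ?_⟩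
  · rw [IccExtend_of_mem hab _ (left_mem_Icc.2 hab), ← evolutionData_fst hab, hdata]
  · filter_upwards [coeFn_evolutionData_snd hab x, hf.coeFn_toLp] with t h1 h2
    rw [← h1, hdata, h2]

/-- The energy identity. -/
theorem norm_sq_eq [CompleteSpace H] [CompleteSpace V]
    (hinj : Function.Injective ι) (hd : DenseRange ι) (hc : IsCompactOperator ι)
    (h : IsEvolutionTriple ι a b y v w) {s t : ℝ} (has : a ≤ s) (hst : s ≤ t) (htb : t ≤ b) :
    ‖y t‖ ^ 2 = ‖y s‖ ^ 2 + 2 * ∫ r in s..t, w r (v r) := by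
  replace h := h.mono has htb
  have hrv : MemLp (fun r => rieszCLM V (v r)) 2 (volume.restrict (Ioc s t)) :=
    (rieszCLM V).comp_memLp' h.memLp_fst
  have hf : MemLp (fun r => w r + rieszCLM V (v r)) 2 (volume.restrict (Ioc s t)) :=
    h.memLp_snd.add_group hrv
  -- A regular triple with the same initial value and the same `w + A v` exists; linear uniqueness
  -- makes it equal to the given one, which inherits its energy identity.
  obtain ⟨x, hx, hxa, hxf⟩ := exists_linear hinj hd hc hst (y s) hf
  have hx' := of_mem_regularTriples hx
  have hsub := h.sub hx'
  have hfsub : ∀ᵐ r ∂(volume.restrict (Ioc s t)),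
      (w - x.2.2) r + rieszCLM V ((v - x.2.1) r) = 0 := by
    filter_upwards [hxf] with r hr
    simp only [Pi.sub_apply, map_sub]
    rw [sub_add_sub_comm, hr, sub_self]
  have hzero := hsub.eq_zero_of_add_riesz_eq_zero hinj hd hc
    (by rw [Pi.sub_apply, hxa, sub_self]) hfsub
  have hy : ∀ r ∈ Icc s t, y r = IccExtend hst x.1 r := fun r hr => sub_eq_zero.1 (hzero r hr)
  have hen := hx.2.2 ⟨t, right_mem_Icc.2 hst⟩
  have hyt := hy t (right_mem_Icc.2 hst)
  have hys := hy s (left_mem_Icc.2 hst)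
  rw [IccExtend_of_mem hst _ (right_mem_Icc.2 hst)] at hyt
  rw [IccExtend_of_mem hst _ (left_mem_Icc.2 hst)] at hys
  have hI : ∫ r in Ioc s t, x.2.2 r (x.2.1 r) = ∫ r in Ioc s t, w r (v r) := by
    refine integral_congr_ae ?_
    filter_upwards [hsub.coupling, hfsub, ae_restrict_mem measurableSet_Ioc] with r h1 h2 hr
    have h3 : (v - x.2.1) r = 0 :=
      hinj (by rw [← h1, hzero r (Ioc_subset_Icc_self hr), map_zero])
    rw [h3, map_zero, add_zero] at h2
    have h4 : v r = x.2.1 r := sub_eq_zero.1 h3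
    have h5 : w r = x.2.2 r := sub_eq_zero.1 h2
    simp only [h4, h5]
  rw [hyt, hys, hen, intervalIntegral.integral_of_le hst,
    Measure.restrict_restrict measurableSet_Ioc, inter_self, hI]

end IsEvolutionTriple

end LinearTheory

/-! ### Lower-order perturbations and uniqueness -/

/-- For simple `v` the composition is a finite sum of indicators; continuity in the second variable
passes to the limit of simple approximations. -/
theorem aestronglyMeasurable_comp_of_caratheodory {α X Y : Type*} {m : MeasurableSpace α}
    {μ : Measure α} [TopologicalSpace X] [NormedAddCommGroup Y] {F : α → X → Y}
    (hm : ∀ x, AEStronglyMeasurable (fun t => F t x) μ) (hc : ∀ᵐ t ∂μ, Continuous (F t))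
    {v : α → X} (hv : AEStronglyMeasurable v μ) :
    AEStronglyMeasurable (fun t => F t (v t)) μ := by
  have hsimple : ∀ s : SimpleFunc α X, AEStronglyMeasurable (fun t => F t (s t)) μ := fun s => by
    classical
    have hsum : (fun t => F t (s t)) =
        ∑ x ∈ s.range, (s ⁻¹' {x}).indicator (fun t => F t x) := by
      ext t
      rw [Finset.sum_apply, Finset.sum_eq_single (s t)]
      · simp
      · intro x _ hx
        exact indicator_of_notMem (fun h => hx h.symm) _
      · intro h
        exact absurd (s.mem_range_self t) h
    rw [hsum]
    exact Finset.aestronglyMeasurable_sum _ fun x _ => (hm x).indicator (s.measurableSet_fiber x)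
  obtain ⟨v', hv', hvv'⟩ := hv
  refine aestronglyMeasurable_of_tendsto_ae (u := atTop)
    (f := fun n t => F t (hv'.approx n t)) (fun n => hsimple _) ?_
  filter_upwards [hc, hvv'] with t ht htv
  rw [htv]
  exact (ht.tendsto _).comp (hv'.tendsto_approx t)

section Perturbation

variable {H V : Type*} [NormedAddCommGroup H] [InnerProductSpace ℝ H]
  [NormedAddCommGroup V] [InnerProductSpace ℝ V]

/-- A time-dependent lower-order perturbation of `A`. -/
structure IsPerturbation (ι : V →L[ℝ] H) (C : ℝ) (F : ℝ → V → StrongDual ℝ V) : Prop where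
  measurable : ∀ z : V, AEStronglyMeasurable (fun t => F t z) (volume.restrict (Ioi 0))
  continuous : ∀ᵐ t ∂(volume.restrict (Ioi (0 : ℝ))), Continuous (F t)
  map_zero : ∀ᵐ t ∂(volume.restrict (Ioi (0 : ℝ))), F t 0 = 0
  nonneg : 0 ≤ C
  -- The coefficient `C` of the convection-type term cannot be made small, but there the test
  -- function enters only through its `H`-norm. In the remaining terms every `V`-norm of an argument
  -- carries the arbitrarily small factor `ε`.
  lipschitz : ∀ ρ ε : ℝ, 0 < ρ → 0 < ε → ∃ K : ℝ, 0 ≤ K ∧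
    ∀ᵐ t ∂(volume.restrict (Ioi (0 : ℝ))), ∀ z₁ z₂ φ : V, ‖ι z₁‖ ≤ ρ → ‖ι z₂‖ ≤ ρ →
      |(F t z₁ - F t z₂) φ| ≤ C * ‖z₁ - z₂‖ * ‖ι φ‖ +
        (ε * ‖z₁ - z₂‖ + (ε * (‖z₁‖ + ‖z₂‖) + K) * ‖ι (z₁ - z₂)‖) * ‖φ‖

/-- `(y, v, w)` solves `ẏ + A y + F(t, y) = 0` on `[a, b]`. -/
structure SolvesOn (ι : V →L[ℝ] H) (F : ℝ → V → StrongDual ℝ V) (a b : ℝ) (y : ℝ → H)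
    (v : ℝ → V) (w : ℝ → StrongDual ℝ V) : Prop where
  triple : IsEvolutionTriple ι a b y v w
  equation : ∀ᵐ t ∂(volume.restrict (Ioc a b)), w t + rieszCLM V (v t) + F t (v t) = 0

variable {ι : V →L[ℝ] H} {C : ℝ} {F : ℝ → V → StrongDual ℝ V} {a b : ℝ}

theorem Ioc_subset_Ioi_zero (ha : 0 ≤ a) : Ioc a b ⊆ Ioi 0 :=
  fun _ ht => ha.trans_lt ht.1

/-- Comparison with `F(t, 0) = 0` gives linear growth in the `V`-norm as long as the `H`-norm is
bounded. -/
theorem IsPerturbation.memLp_comp (hF : IsPerturbation ι C F) (ha : 0 ≤ a) {v : ℝ → V}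
    (hv : MemLp v 2 (volume.restrict (Ioc a b))) {ρ : ℝ} (hρ : 0 < ρ)
    (hvρ : ∀ᵐ t ∂(volume.restrict (Ioc a b)), ‖ι (v t)‖ ≤ ρ) :
    MemLp (fun t => F t (v t)) 2 (volume.restrict (Ioc a b)) := by
  have hsub := Ioc_subset_Ioi_zero (b := b) ha
  obtain ⟨K, hK0, hK⟩ := hF.lipschitz ρ 1 hρ one_pos
  have hg : MemLp (fun t => (C * ‖ι‖ + 1 + ρ) * ‖v t‖ + K * ρ) 2 (volume.restrict (Ioc a b)) :=
    (hv.norm.const_mul _).add (memLp_const _)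
  refine hg.of_le ?_ ?_
  · exact aestronglyMeasurable_comp_of_caratheodory
      (fun z => (hF.measurable z).mono_set hsub)
      (ae_restrict_of_ae_restrict_of_subset hsub hF.continuous) hv.1
  · filter_upwards [hvρ, ae_restrict_of_ae_restrict_of_subset hsub hK,
      ae_restrict_of_ae_restrict_of_subset hsub hF.map_zero] with t h1 h2 h3
    have hC := hF.nonneg
    rw [Real.norm_of_nonneg (by positivity)]
    refine ContinuousLinearMap.opNorm_le_bound _ (by positivity) fun φ => ?_
    have h4 := h2 (v t) 0 φ h1 (by simpa using hρ.le)
    rw [h3] at h4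
    simp only [sub_zero, norm_zero, add_zero, one_mul] at h4
    rw [Real.norm_eq_abs]
    refine h4.trans ?_
    have h5 : C * ‖v t‖ * ‖ι φ‖ ≤ C * ‖v t‖ * (‖ι‖ * ‖φ‖) := by
      gcongr; exact ι.le_opNorm φ
    have h6 : (‖v t‖ + (‖v t‖ + K) * ‖ι (v t)‖) * ‖φ‖ ≤ (‖v t‖ + (‖v t‖ + K) * ρ) * ‖φ‖ := by
      gcongr
    linarith

theorem SolvesOn.mono {y : ℝ → H} {v : ℝ → V} {w : ℝ → StrongDual ℝ V}
    (h : SolvesOn ι F a b y v w) {a' b' : ℝ} (ha : a ≤ a') (hb : b' ≤ b) :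
    SolvesOn ι F a' b' y v w :=
  ⟨h.triple.mono ha hb, ae_restrict_of_ae_restrict_of_subset (Ioc_subset_Ioc ha hb) h.equation⟩

/-- The energy identity for the difference, with its `V`-norm absorbed, gives `d/dt |y - y'|² ≤
2g²|y - y'|²`. Since `v` and `v'` are in `L²(V)`, the coefficient `g²` is integrable, which is what
the Grönwall lemma requires. -/
theorem SolvesOn.eqOn [CompleteSpace H] [CompleteSpace V]
    (hinj : Function.Injective ι) (hd : DenseRange ι) (hc : IsCompactOperator ι)
    (hF : IsPerturbation ι C F) (ha : 0 ≤ a) {y y' : ℝ → H} {v v' : ℝ → V}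
    {w w' : ℝ → StrongDual ℝ V} (h : SolvesOn ι F a b y v w) (h' : SolvesOn ι F a b y' v' w')
    (hya : y a = y' a) : EqOn y y' (Icc a b) := by
  have hsub := Ioc_subset_Ioi_zero (b := b) ha
  obtain ⟨ρ₁, hρ₁⟩ := isCompact_Icc.exists_bound_of_continuousOn h.triple.continuousOn
  obtain ⟨ρ₂, hρ₂⟩ := isCompact_Icc.exists_bound_of_continuousOn h'.triple.continuousOn
  set ρ := max (max ρ₁ ρ₂) 1
  obtain ⟨K, hK0, hK⟩ := hF.lipschitz ρ (1 / 4) (by positivity) (by norm_num)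
  set g : ℝ → ℝ := fun t => C + K + (‖v t‖ + ‖v' t‖) / 4 with hg
  have hgL : MemLp g 2 (volume.restrict (Ioc a b)) := by
    have := (h.triple.memLp_fst.norm.add h'.triple.memLp_fst.norm).const_mul (1 / 4)
    refine (memLp_congr_ae (.of_forall fun t => ?_)).1 ((memLp_const (C + K)).add this)
    simp only [hg, Pi.add_apply]; ring
  have htr := h.triple.sub h'.triple
  have hpt : ∀ᵐ t ∂(volume.restrict (Ioc a b)),
      2 * (w - w') t ((v - v') t) ≤ 2 * g t ^ 2 * ‖(y - y') t‖ ^ 2 := by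
    filter_upwards [h.equation, h'.equation, h.triple.coupling, h'.triple.coupling, htr.coupling,
      ae_restrict_of_ae_restrict_of_subset hsub hK, ae_restrict_mem measurableSet_Ioc]
      with t h1 h2 h3 h4 h5 h6 ht
    have hmem := Ioc_subset_Icc_self ht
    have h7 := h6 (v t) (v' t) (v t - v' t)
      (by rw [← h3]; exact (hρ₁ t hmem).trans ((le_max_left _ _).trans (le_max_left _ _)))
      (by rw [← h4]; exact (hρ₂ t hmem).trans ((le_max_right _ _).trans (le_max_left _ _)))
    have h8 : w t - w' t = -rieszCLM V (v t - v' t) - (F t (v t) - F t (v' t)) := by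
      rw [map_sub, ← sub_eq_zero, ← sub_self (0 : StrongDual ℝ V)]
      nth_rw 1 [← h1]
      rw [← h2]; abel
    simp only [Pi.sub_apply] at h5 ⊢
    rw [h5, h8]
    simp only [sub_apply (-rieszCLM V (v t - v' t)), neg_apply, rieszCLM_apply,
      real_inner_self_eq_norm_sq]
    set Z := ‖v t - v' t‖
    set z := ‖ι (v t - v' t)‖
    have h9 : -((F t (v t) - F t (v' t)) (v t - v' t)) ≤ 1 / 4 * Z ^ 2 + g t * z * Z := by
      refine (neg_le_abs _).trans (h7.trans (le_of_eq ?_))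
      simp only [hg]; ring
    nlinarith [sq_nonneg (g t * z - 1 / 2 * Z), sq_nonneg Z]
  have hzero := eq_zero_of_le_add_integral_mul (u := fun t => ‖(y - y') t‖ ^ 2)
    (ρ := fun t => 2 * g t ^ 2) (htr.continuousOn.norm.pow 2) (fun _ _ => by positivity)
    (fun _ => by positivity) (hgL.integrable_sq.const_mul 2) ?_ (by simp [hya])
  · intro t ht
    have := hzero t ht
    simp only [Pi.sub_apply] at this
    exact sub_eq_zero.1 (norm_eq_zero.1 (pow_eq_zero_iff two_ne_zero |>.1 this))
  · intro s t has hst htb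
    rw [htr.norm_sq_eq hinj hd hc has hst htb, ← intervalIntegral.integral_const_mul]
    refine add_le_add le_rfl ?_
    have hsub' : Ioc s t ⊆ Ioc a b := Ioc_subset_Ioc has htb
    refine intervalIntegral.integral_mono_ae_restrict hst ?_ ?_ ?_
    · refine (intervalIntegrable_iff_integrableOn_Ioc_of_le hst).2 ?_
      exact IntegrableOn.mono_set
        ((htr.memLp_snd.integrable_dual_apply htr.memLp_fst).const_mul 2) hsub'
    · have hgI : IntervalIntegrable (fun r => 2 * g r ^ 2) volume s t :=
        (intervalIntegrable_iff_integrableOn_Ioc_of_le hst).2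
          (IntegrableOn.mono_set (hgL.integrable_sq.const_mul 2) hsub')
      refine hgI.mul_continuousOn ((htr.continuousOn.norm.pow 2).mono ?_)
      rw [uIcc_of_le hst]
      exact Icc_subset_Icc has htb
    · rw [← Measure.restrict_congr_set Ioc_ae_eq_Icc]
      exact ae_restrict_of_ae_restrict_of_subset hsub' hpt

end Perturbation

/-! ### Local existence by contraction -/

/-- Pointwise form of the contraction estimate. `X`, `s` are the `V`- and `H`-norms of the solution
difference, `Z`, `z` those of the input difference, and `p`, `q` the `V`-norms of the inputs. The
part `½X²` is absorbed by `A`; the rest has a small integral over a short interval. -/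
theorem young_contraction {C ε K X s S Z z D p q : ℝ} (hC : 0 ≤ C) (hε : 0 ≤ ε) (hK : 0 ≤ K)
    (hX : 0 ≤ X) (hs : s ≤ S) (hZ : 0 ≤ Z) (hz : z ≤ D) (hp : 0 ≤ p) (hq : 0 ≤ q) :
    C * Z * s + (ε * Z + (ε * (p + q) + K) * z) * X ≤ 1 / 2 * X ^ 2 +
      ((1 / 256 + ε ^ 2) * Z ^ 2 + 4 * ε ^ 2 * D ^ 2 * (p ^ 2 + q ^ 2) +
        (64 * C ^ 2 * S ^ 2 + 2 * K ^ 2 * D ^ 2)) := by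
  have h1 : C * Z * s ≤ 1 / 256 * Z ^ 2 + 64 * C ^ 2 * S ^ 2 := by
    have := mul_le_mul_of_nonneg_left hs (mul_nonneg hC hZ)
    nlinarith [sq_nonneg (1 / 16 * Z - 8 * (C * S))]
  have h2 : ε * Z * X ≤ 1 / 4 * X ^ 2 + ε ^ 2 * Z ^ 2 := by
    nlinarith [sq_nonneg (1 / 2 * X - ε * Z)]
  have h3 : (ε * (p + q) + K) * z * X ≤ (ε * (p + q) + K) * D * X := by gcongr
  have h4 : (ε * (p + q) + K) * D * X ≤ 1 / 4 * X ^ 2 + (ε * (p + q) + K) ^ 2 * D ^ 2 := by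
    nlinarith [sq_nonneg (1 / 2 * X - (ε * (p + q) + K) * D)]
  have h5 : (ε * (p + q) + K) ^ 2 ≤ 4 * ε ^ 2 * (p ^ 2 + q ^ 2) + 2 * K ^ 2 := by
    nlinarith [sq_nonneg (ε * (p + q) - K), mul_nonneg (sq_nonneg ε) (sq_nonneg (p - q))]
  have h6 := mul_le_mul_of_nonneg_right h5 (sq_nonneg D)
  linarith

section LocalExistence

variable {H V : Type*} [NormedAddCommGroup H] [InnerProductSpace ℝ H]
  [NormedAddCommGroup V] [InnerProductSpace ℝ V] [CompleteSpace H] [CompleteSpace V]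
  {ι : V →L[ℝ] H} {C : ℝ} {F : ℝ → V → StrongDual ℝ V}

/-- On short time intervals, the solution operator of `ẏ + A y = -F(t, v)` is a contraction. -/
theorem IsPerturbation.exists_contraction_time (hinj : Function.Injective ι) (hd : DenseRange ι)
    (hc : IsCompactOperator ι) (hF : IsPerturbation ι C F) {R : ℝ} (hR : 0 < R) :
    ∃ τ : ℝ, 0 < τ ∧ ∀ a : ℝ, 0 ≤ a → ∀ (v₁ v₂ : ℝ → V) (D : ℝ),
      MemLp v₁ 2 (volume.restrict (Ioc a (a + τ))) →
      MemLp v₂ 2 (volume.restrict (Ioc a (a + τ))) →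
      (∀ᵐ t ∂(volume.restrict (Ioc a (a + τ))), ‖ι (v₁ t)‖ ≤ 2 * R) →
      (∀ᵐ t ∂(volume.restrict (Ioc a (a + τ))), ‖ι (v₂ t)‖ ≤ 2 * R) →
      ∫ t in Ioc a (a + τ), ‖v₁ t‖ ^ 2 ≤ (2 * R) ^ 2 →
      ∫ t in Ioc a (a + τ), ‖v₂ t‖ ^ 2 ≤ (2 * R) ^ 2 →
      0 ≤ D →
      (∀ᵐ t ∂(volume.restrict (Ioc a (a + τ))), ‖ι (v₁ t - v₂ t)‖ ≤ D) →
      ∫ t in Ioc a (a + τ), ‖v₁ t - v₂ t‖ ^ 2 ≤ D ^ 2 →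
      ∀ (y : ℝ → H) (v : ℝ → V) (w : ℝ → StrongDual ℝ V),
      IsEvolutionTriple ι a (a + τ) y v w → y a = 0 →
      (∀ᵐ t ∂(volume.restrict (Ioc a (a + τ))),
        w t + rieszCLM V (v t) + (F t (v₁ t) - F t (v₂ t)) = 0) →
      (∀ t ∈ Icc a (a + τ), ‖y t‖ ≤ D / 4) ∧
        ∫ t in Ioc a (a + τ), ‖v t‖ ^ 2 ≤ (D / 4) ^ 2 := by
  -- The inputs satisfy `∫|vᵢ|² ≤ 4R²`, so the `ε`-terms integrate to at most `ε²(1 + 32R²)D²`; this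
  -- choice keeps that below `D²/256`.
  set ε : ℝ := 1 / (16 * (1 + 6 * R)) with hε
  have hε0 : 0 < ε := by positivity
  have hε1 : ε ^ 2 * (1 + 32 * R ^ 2) ≤ 1 / 256 := by
    rw [hε, div_pow, one_pow, div_mul_eq_mul_div, one_mul, div_le_div_iff₀ (by positivity)
      (by positivity)]
    nlinarith
  obtain ⟨K, hK0, hK⟩ := hF.lipschitz (2 * R) ε (by positivity) hε0
  -- Makes `64C²τ ≤ 1/4` and `2K²τ ≤ 1/256`. Nothing here depends on the starting time `a`.
  set τ : ℝ := 1 / (512 * K ^ 2 + 256 * C ^ 2 + 1) with hτ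
  have hτ0 : 0 < τ := by positivity
  have hτ1 : (512 * K ^ 2 + 256 * C ^ 2 + 1) * τ = 1 := by rw [hτ]; field_simp
  refine ⟨τ, hτ0, fun a ha v₁ v₂ D hv₁ hv₂ hb₁ hb₂ hi₁ hi₂ hD hD1 hD2 y v w htr hya heq => ?_⟩
  have hab : a ≤ a + τ := by linarith
  have hsub := Ioc_subset_Ioi_zero (b := a + τ) ha
  have hC := hF.nonneg
  obtain ⟨m, hm, hmax⟩ := isCompact_Icc.exists_isMaxOn (nonempty_Icc.2 hab)
    htr.continuousOn.norm
  set S := ‖y m‖ with hS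
  have hyS : ∀ t ∈ Icc a (a + τ), ‖y t‖ ≤ S := fun t ht => hmax ht
  set r : ℝ → ℝ := fun t => (1 / 256 + ε ^ 2) * ‖v₁ t - v₂ t‖ ^ 2 +
    4 * ε ^ 2 * D ^ 2 * (‖v₁ t‖ ^ 2 + ‖v₂ t‖ ^ 2) + (64 * C ^ 2 * S ^ 2 + 2 * K ^ 2 * D ^ 2) with hr
  have hv₁2 := hv₁.integrable_norm_sq
  have hv₂2 := hv₂.integrable_norm_sq
  have hv₁₂ : Integrable (fun t => ‖v₁ t - v₂ t‖ ^ 2) (volume.restrict (Ioc a (a + τ))) :=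
    (hv₁.sub hv₂).integrable_norm_sq
  have hv2 := htr.memLp_fst.integrable_norm_sq
  have hr1 : Integrable (fun t => (1 / 256 + ε ^ 2) * ‖v₁ t - v₂ t‖ ^ 2)
    (volume.restrict (Ioc a (a + τ))) := hv₁₂.const_mul _
  have hr2 : Integrable (fun t => 4 * ε ^ 2 * D ^ 2 * (‖v₁ t‖ ^ 2 + ‖v₂ t‖ ^ 2))
    (volume.restrict (Ioc a (a + τ))) := (hv₁2.add hv₂2).const_mul _
  have hr12 : Integrable (fun t => (1 / 256 + ε ^ 2) * ‖v₁ t - v₂ t‖ ^ 2 +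
    4 * ε ^ 2 * D ^ 2 * (‖v₁ t‖ ^ 2 + ‖v₂ t‖ ^ 2)) (volume.restrict (Ioc a (a + τ))) := hr1.add hr2
  have hrI : Integrable r (volume.restrict (Ioc a (a + τ))) := hr12.add (integrable_const _)
  have hr0 : ∀ t, 0 ≤ r t := fun t => by positivity
  have hrint : ∫ t in Ioc a (a + τ), r t ≤ 3 / 256 * D ^ 2 + 1 / 4 * S ^ 2 := by
    have h1 : ∫ t in Ioc a (a + τ), r t = (1 / 256 + ε ^ 2) *
        (∫ t in Ioc a (a + τ), ‖v₁ t - v₂ t‖ ^ 2) + 4 * ε ^ 2 * D ^ 2 *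
        ((∫ t in Ioc a (a + τ), ‖v₁ t‖ ^ 2) + ∫ t in Ioc a (a + τ), ‖v₂ t‖ ^ 2) +
        τ * (64 * C ^ 2 * S ^ 2 + 2 * K ^ 2 * D ^ 2) := by
      simp only [hr]
      rw [integral_add hr12 (integrable_const _), integral_add hr1 hr2,
        integral_const_mul, integral_const_mul, integral_add hv₁2 hv₂2, integral_const]
      simp [hτ0.le]
    rw [h1]
    have h2 : (1 / 256 + ε ^ 2) * (∫ t in Ioc a (a + τ), ‖v₁ t - v₂ t‖ ^ 2) ≤
        (1 / 256 + ε ^ 2) * D ^ 2 := by gcongr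
    have h3 : 4 * ε ^ 2 * D ^ 2 * ((∫ t in Ioc a (a + τ), ‖v₁ t‖ ^ 2) +
        ∫ t in Ioc a (a + τ), ‖v₂ t‖ ^ 2) ≤
        4 * ε ^ 2 * D ^ 2 * ((2 * R) ^ 2 + (2 * R) ^ 2) := by gcongr
    have h4 := mul_le_mul_of_nonneg_right hε1 (sq_nonneg D)
    have h5 : 64 * C ^ 2 * τ * S ^ 2 ≤ 1 / 4 * S ^ 2 := by
      refine mul_le_mul_of_nonneg_right ?_ (sq_nonneg S)
      nlinarith [mul_nonneg (sq_nonneg K) hτ0.le]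
    have h6 : 2 * K ^ 2 * τ * D ^ 2 ≤ 1 / 256 * D ^ 2 := by
      refine mul_le_mul_of_nonneg_right ?_ (sq_nonneg D)
      nlinarith [mul_nonneg (sq_nonneg C) hτ0.le]
    linarith
  have hpt : ∀ᵐ t ∂(volume.restrict (Ioc a (a + τ))),
      2 * w t (v t) ≤ 2 * r t - ‖v t‖ ^ 2 := by
    filter_upwards [heq, htr.coupling, hb₁, hb₂, hD1,
      ae_restrict_of_ae_restrict_of_subset hsub hK, ae_restrict_mem measurableSet_Ioc]
      with t h1 h2 h3 h4 h5 h6 ht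
    have h7 := (neg_le_abs _).trans (h6 (v₁ t) (v₂ t) (v t) h3 h4)
    have h8 : w t = -rieszCLM V (v t) - (F t (v₁ t) - F t (v₂ t)) := by
      rw [← sub_eq_zero, ← h1]; abel
    rw [h8]
    simp only [sub_apply (-rieszCLM V (v t)), neg_apply, rieszCLM_apply,
      real_inner_self_eq_norm_sq]
    have h9 : ‖ι (v t)‖ ≤ S := by rw [← h2]; exact hyS t (Ioc_subset_Icc_self ht)
    simp only [hr]
    have h10 := young_contraction hC hε0.le hK0 (norm_nonneg (v t)) h9 (norm_nonneg (v₁ t - v₂ t))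
      h5 (norm_nonneg (v₁ t)) (norm_nonneg (v₂ t))
    linarith
  have hest : ∀ t ∈ Icc a (a + τ), ‖y t‖ ^ 2 + ∫ s in Ioc a t, ‖v s‖ ^ 2 ≤
      6 / 256 * D ^ 2 + 1 / 2 * S ^ 2 := fun t ht => by
    have hst : Ioc a t ⊆ Ioc a (a + τ) := Ioc_subset_Ioc_right ht.2
    have hwv := htr.memLp_snd.integrable_dual_apply htr.memLp_fst
    have h1 := htr.norm_sq_eq hinj hd hc le_rfl ht.1 ht.2
    rw [hya, norm_zero, intervalIntegral.integral_of_le ht.1] at h1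
    have h2 : ∫ s in Ioc a t, 2 * w s (v s) ≤ ∫ s in Ioc a t, (2 * r s - ‖v s‖ ^ 2) := by
      refine integral_mono_ae ?_ ?_ (ae_restrict_of_ae_restrict_of_subset hst hpt)
      · exact IntegrableOn.mono_set (hwv.const_mul 2) hst
      · exact IntegrableOn.mono_set ((hrI.const_mul 2).sub hv2) hst
    rw [integral_sub (IntegrableOn.mono_set (hrI.const_mul 2) hst)
      (IntegrableOn.mono_set hv2 hst), integral_const_mul, integral_const_mul] at h2
    have h3 : ∫ s in Ioc a t, r s ≤ ∫ s in Ioc a (a + τ), r s :=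
      setIntegral_mono_set hrI (.of_forall hr0) hst.eventuallyLE
    linarith
  -- At the maximum point the term `½S²` on the right is absorbed by the left-hand side.
  have hSD : S ^ 2 ≤ 12 / 256 * D ^ 2 := by
    have h1 := hest m hm
    have h2 : 0 ≤ ∫ s in Ioc a m, ‖v s‖ ^ 2 := integral_nonneg fun s => by positivity
    linarith
  refine ⟨fun t ht => (hyS t ht).trans ?_, ?_⟩
  · refine abs_le_of_sq_le_sq' ?_ (by positivity) |>.2
    nlinarith [sq_nonneg D]
  · have h1 := hest _ (right_mem_Icc.2 hab)
    nlinarith [sq_nonneg ‖y (a + τ)‖, sq_nonneg D]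

end LocalExistence

section LocalExistence

variable {H V : Type*} [NormedAddCommGroup H] [InnerProductSpace ℝ H]
  [NormedAddCommGroup V] [InnerProductSpace ℝ V] [CompleteSpace H] [CompleteSpace V]
  {ι : V →L[ℝ] H} {C : ℝ} {F : ℝ → V → StrongDual ℝ V}

theorem Lp_norm_le_of_integral_sq_le {α E : Type*} {m : MeasurableSpace α} {μ : Measure α}
    [NormedAddCommGroup E] {f : Lp E 2 μ} {g : α → E} (hfg : f =ᵐ[μ] g) {D : ℝ} (hD : 0 ≤ D)
    (h : ∫ t, ‖g t‖ ^ 2 ∂μ ≤ D ^ 2) : ‖f‖ ≤ D := by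
  refine abs_le_of_sq_le_sq' ?_ hD |>.2
  rw [Lp.norm_sq_eq_integral]
  refine le_trans (le_of_eq (integral_congr_ae ?_)) h
  filter_upwards [hfg] with t ht
  rw [ht]

/-- Local existence, on intervals whose length depends only on the norm of the initial value. -/
theorem IsPerturbation.exists_solvesOn (hinj : Function.Injective ι) (hd : DenseRange ι)
    (hc : IsCompactOperator ι) (hF : IsPerturbation ι C F) {R : ℝ} (hR : 0 < R) :
    ∃ τ : ℝ, 0 < τ ∧ ∀ a : ℝ, 0 ≤ a → ∀ h : H, ‖h‖ ≤ R →
      ∃ y v w, SolvesOn ι F a (a + τ) y v w ∧ y a = h := by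
  obtain ⟨τ, hτ, hcontr⟩ := hF.exists_contraction_time hinj hd hc hR
  refine ⟨τ, hτ, fun a ha h hh => ?_⟩
  have hab : a ≤ a + τ := by linarith
  have hsub := Ioc_subset_Ioi_zero (b := a + τ) ha
  set μ := volume.restrict (Ioc a (a + τ)) with hμ
  -- Keeping the coupling `y = ι v` in the domain gives a pointwise `H`-bound on the input, without
  -- which `F(t, v)` need not be in `L²(V')`.
  set s : Set (C(Icc a (a + τ), H) × Lp V 2 μ) :=
    {p | (∀ᵐ t ∂μ, IccExtend hab p.1 t = ι (p.2 t)) ∧ ‖p‖ ≤ 2 * R} with hs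
  have hs_closed : IsClosed s := by
    have : IsClosed {p : C(Icc a (a + τ), H) × Lp V 2 μ | ‖p‖ ≤ 2 * R} :=
      isClosed_le continuous_norm continuous_const
    exact (isClosed_coupling ι hab).inter this
  have hbound : ∀ p ∈ s, ∀ᵐ t ∂μ, ‖ι (p.2 t)‖ ≤ ‖p‖ := fun p hp => by
    filter_upwards [hp.1] with t ht
    rw [← ht]
    exact (p.1.norm_coe_le_norm _).trans (norm_fst_le p)
  have hbound' : ∀ p ∈ s, ∫ t, ‖p.2 t‖ ^ 2 ∂μ ≤ ‖p‖ ^ 2 := fun p _ => by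
    rw [← Lp.norm_sq_eq_integral]
    gcongr
    exact norm_snd_le p
  have hstep : ∀ p : C(Icc a (a + τ), H) × Lp V 2 μ, ∃ x : TripleSpace H V a (a + τ), p ∈ s →
      x ∈ regularTriples ι hab ∧ IccExtend hab x.1 a = h ∧
        ∀ᵐ t ∂μ, x.2.2 t + rieszCLM V (x.2.1 t) = -F t (p.2 t) := fun p => by
    by_cases hp : p ∈ s
    · have hFp : MemLp (fun t => -F t (p.2 t)) 2 μ :=
        (hF.memLp_comp ha (Lp.memLp p.2) (ρ := 2 * R) (by positivity)
          ((hbound p hp).mono fun t ht => ht.trans hp.2)).neg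
      obtain ⟨x, hx⟩ := IsEvolutionTriple.exists_linear hinj hd hc hab h hFp
      exact ⟨x, fun _ => hx⟩
    · exact ⟨0, fun h => absurd h hp⟩
  choose x hx using hstep
  have hdiff : ∀ p ∈ s, ∀ q ∈ s,
      ‖(((x p).1, (x p).2.1) : C(Icc a (a + τ), H) × Lp V 2 μ) - ((x q).1, (x q).2.1)‖ ≤
        ‖p - q‖ / 4 := fun p hp q hq => by
    obtain ⟨hp1, hp2, hp3⟩ := hx p hp
    obtain ⟨hq1, hq2, hq3⟩ := hx q hq
    have hsubpq : ∀ᵐ t ∂μ, (p - q).2 t = p.2 t - q.2 t := Lp.coeFn_sub _ _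
    have key := hcontr a ha p.2 q.2 ‖p - q‖ (Lp.memLp _) (Lp.memLp _)
      ((hbound p hp).mono fun t ht => ht.trans hp.2)
      ((hbound q hq).mono fun t ht => ht.trans hq.2)
      ((hbound' p hp).trans (by gcongr; exact hp.2))
      ((hbound' q hq).trans (by gcongr; exact hq.2)) (norm_nonneg _) ?_ ?_ _ _ _
      ((IsEvolutionTriple.of_mem_regularTriples hp1).sub
        (IsEvolutionTriple.of_mem_regularTriples hq1)) (by rw [Pi.sub_apply, hp2, hq2, sub_self]) ?_
    · refine norm_prod_le_iff.2 ⟨(ContinuousMap.norm_le _ (by positivity)).2 fun t => ?_, ?_⟩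
      · have := key.1 t t.2
        rwa [Pi.sub_apply, IccExtend_val, IccExtend_val] at this
      · exact Lp_norm_le_of_integral_sq_le (Lp.coeFn_sub _ _) (by positivity) key.2
    · filter_upwards [hp.1, hq.1] with t h1 h2
      rw [map_sub, ← h1, ← h2]
      exact ((p.1 - q.1).norm_coe_le_norm _).trans (norm_fst_le (p - q))
    · calc ∫ t, ‖p.2 t - q.2 t‖ ^ 2 ∂μ = ‖(p - q).2‖ ^ 2 := by
            rw [Lp.norm_sq_eq_integral]
            refine integral_congr_ae ?_
            filter_upwards [hsubpq] with t ht
            rw [ht]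
        _ ≤ ‖p - q‖ ^ 2 := by gcongr; exact norm_snd_le (p - q)
    · filter_upwards [hp3, hq3] with t h1 h2
      simp only [Pi.sub_apply, map_sub]
      rw [sub_add_sub_comm, h1, h2]
      abel
  have h0 : (0 : C(Icc a (a + τ), H) × Lp V 2 μ) ∈ s := by
    refine ⟨?_, by simp; positivity⟩
    filter_upwards [Lp.coeFn_zero V 2 μ] with t ht
    rw [Prod.snd_zero, ht]
    simp [IccExtend]
  -- As `F(t, 0) = 0`, the image of `0` solves the homogeneous linear problem and has norm at most
  -- `R`. The contraction moves other images by at most `2R/4` from it, so the ball of radius `2R`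
  -- is invariant.
  have hx0 : ‖(((x 0).1, (x 0).2.1) : C(Icc a (a + τ), H) × Lp V 2 μ)‖ ≤ R := by
    obtain ⟨⟨h1, h2, h3⟩, h4, h5⟩ := hx 0 h0
    rw [IccExtend_of_mem hab _ (left_mem_Icc.2 hab)] at h4
    have hv2 := (Lp.memLp (x 0).2.1).integrable_norm_sq
    have hI : ∀ t : Icc a (a + τ), ‖(x 0).1 t‖ ^ 2 +
        2 * ∫ r in Ioc a t, ‖(x 0).2.1 r‖ ^ 2 ∂μ = ‖h‖ ^ 2 := fun t => by
      have h6 := h3 t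
      have h7 : ∫ r in Ioc a (t : ℝ), (x 0).2.2 r ((x 0).2.1 r) ∂μ =
          ∫ r in Ioc a (t : ℝ), -‖(x 0).2.1 r‖ ^ 2 ∂μ := by
        refine integral_congr_ae (ae_restrict_of_ae ?_)
        filter_upwards [h5, Lp.coeFn_zero V 2 μ,
          ae_restrict_of_ae_restrict_of_subset hsub hF.map_zero] with r h8 h9 h10
        rw [Prod.snd_zero, h9, Pi.zero_apply, h10, neg_zero] at h8
        rw [eq_neg_of_add_eq_zero_left h8, neg_apply, rieszCLM_apply, real_inner_self_eq_norm_sq]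
      rw [h6, h4, h7, integral_neg]
      ring
    refine norm_prod_le_iff.2 ⟨(ContinuousMap.norm_le _ hR.le).2 fun t => ?_, ?_⟩
    · have h6 : 0 ≤ ∫ r in Ioc a (t : ℝ), ‖(x 0).2.1 r‖ ^ 2 ∂μ :=
        integral_nonneg fun r => by positivity
      refine le_trans (abs_le_of_sq_le_sq' ?_ (norm_nonneg h) |>.2) hh
      linarith [hI t]
    · refine le_trans (abs_le_of_sq_le_sq' ?_ (norm_nonneg h) |>.2) hh
      have h6 := hI ⟨a + τ, right_mem_Icc.2 hab⟩
      have hrs : μ.restrict (Ioc a (a + τ)) = μ := by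
        rw [hμ, Measure.restrict_restrict measurableSet_Ioc, inter_self]
      dsimp only at h6
      rw [hrs, ← Lp.norm_sq_eq_integral] at h6
      nlinarith [sq_nonneg ‖(x 0).1 ⟨a + τ, right_mem_Icc.2 hab⟩‖, sq_nonneg ‖(x 0).2.1‖]
  set Ψ : C(Icc a (a + τ), H) × Lp V 2 μ → C(Icc a (a + τ), H) × Lp V 2 μ :=
    fun p => ((x p).1, (x p).2.1) with hΨ
  have hmaps : MapsTo Ψ s s := fun p hp => by
    refine ⟨(hx p hp).1.1, ?_⟩
    have h1 := hdiff p hp 0 h0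
    rw [sub_zero] at h1
    have h2 := norm_add_le (Ψ 0) (Ψ p - Ψ 0)
    rw [add_sub_cancel] at h2
    have h3 : ‖p‖ ≤ 2 * R := hp.2
    change ‖Ψ p - Ψ 0‖ ≤ _ at h1
    change ‖Ψ 0‖ ≤ R at hx0
    linarith
  have hcw : ContractingWith (1 / 4) (hmaps.restrict Ψ s s) := by
    refine ⟨by norm_num, LipschitzWith.of_dist_le_mul fun p q => ?_⟩
    rw [Subtype.dist_eq, Subtype.dist_eq, dist_eq_norm, dist_eq_norm]
    refine (hdiff p p.2 q q.2).trans (le_of_eq ?_)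
    simp; ring
  obtain ⟨p, hp, hfix, -⟩ := hcw.exists_fixedPoint' hs_closed.isComplete hmaps h0
    (edist_ne_top _ _)
  obtain ⟨h1, h2, h3⟩ := hx p hp
  refine ⟨_, _, _, ⟨IsEvolutionTriple.of_mem_regularTriples h1, ?_⟩, h2⟩
  have h4 : (x p).2.1 = p.2 := congrArg Prod.snd hfix
  filter_upwards [h3] with t ht
  rw [ht, h4, neg_add_cancel]

end LocalExistence

/-! ### Exponential decay and global existence -/

/-- A Grönwall lemma for exponential decay. -/
theorem le_exp_neg_mul_of_le_sub_integral {u : ℝ → ℝ} {a b c : ℝ} (hab : a ≤ b)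
    (hu : ContinuousOn u (Icc a b))
    (h : ∀ s t, a ≤ s → s ≤ t → t ≤ b → u t ≤ u s - c * ∫ r in s..t, u r) :
    u b ≤ Real.exp (-(c * (b - a))) * u a := by
  -- The constant extension is continuous on the whole line, so its primitive is differentiable at
  -- the endpoint `a` as well.
  set g : ℝ → ℝ := IccExtend hab ((Icc a b).domRestrict u) with hg
  have hgc : Continuous g := hu.domRestrict.Icc_extend'
  have hgu : ∀ t ∈ Icc a b, g t = u t := fun t ht => by
    rw [hg, IccExtend_of_mem hab _ ht, domRestrict_apply]
  have key := le_gronwallBound_of_liminf_deriv_right_le (f := u) (f' := fun x => -c * u x)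
    (δ := u a) (K := -c) (ε := 0) hu ?_ le_rfl (fun x _ => by simp) b (right_mem_Icc.2 hab)
  · rw [gronwallBound_ε0] at key
    rw [mul_comm]
    convert key using 3
    ring
  · intro x hx r hr
    have hd : HasDerivAt (fun t => ∫ s in x..t, g s) (g x) x :=
      intervalIntegral.integral_hasDerivAt_right (hgc.intervalIntegrable _ _)
        (hgc.stronglyMeasurableAtFilter _ _) hgc.continuousAt
    have hs : Tendsto (fun z => -c * slope (fun t => ∫ s in x..t, g s) x z) (𝓝[>] x)
        (𝓝 (-c * g x)) :=
      ((hasDerivWithinAt_iff_tendsto_slope' (by simp)).1 hd.hasDerivWithinAt).const_mul _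
    rw [hgu x ⟨hx.1, hx.2.le⟩] at hs
    have hev : ∀ᶠ z in 𝓝[>] x, z ∈ Ioc x b := Ioc_mem_nhdsGT hx.2
    refine ((hs.eventually (gt_mem_nhds hr)).and hev).frequently.mono ?_
    rintro z ⟨hz1, hz2⟩
    refine lt_of_le_of_lt ?_ hz1
    have h1 := h x z hx.1 hz2.1.le hz2.2
    have h2 : ∫ s in x..z, g s = ∫ s in x..z, u s := by
      refine intervalIntegral.integral_congr fun s hs => hgu s ?_
      rw [uIcc_of_le hz2.1.le] at hs
      exact ⟨hx.1.trans hs.1, hs.2.trans hz2.2⟩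
    rw [slope_def_field, intervalIntegral.integral_same, sub_zero, h2]
    have h3 : 0 < z - x := sub_pos.2 hz2.1
    rw [inv_mul_eq_div, ← mul_div_assoc]
    gcongr
    linarith

theorem memLp_two_restrict_union {α E : Type*} {m : MeasurableSpace α} {μ : Measure α}
    [NormedAddCommGroup E] {f : α → E} {s t : Set α} (hs : MemLp f 2 (μ.restrict s))
    (ht : MemLp f 2 (μ.restrict t)) : MemLp f 2 (μ.restrict (s ∪ t)) := by
  rw [memLp_two_iff_integrable_sq_norm (aestronglyMeasurable_union_iff.2 ⟨hs.1, ht.1⟩)]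
  exact IntegrableOn.union hs.integrable_norm_sq ht.integrable_norm_sq

section GlobalExistence

variable {H V : Type*} [NormedAddCommGroup H] [InnerProductSpace ℝ H]
  [NormedAddCommGroup V] [InnerProductSpace ℝ V]
  {ι : V →L[ℝ] H} {C : ℝ} {F : ℝ → V → StrongDual ℝ V} {a b : ℝ}

namespace SolvesOn

variable {y y' : ℝ → H} {v v' : ℝ → V} {w w' : ℝ → StrongDual ℝ V}

theorem congr (h : SolvesOn ι F a b y v w) (hab : a ≤ b) (hy : EqOn y' y (Icc a b))
    (hv : v' =ᵐ[volume.restrict (Ioc a b)] v) (hw : w' =ᵐ[volume.restrict (Ioc a b)] w) :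
    SolvesOn ι F a b y' v' w' := by
  refine ⟨h.triple.congr hab hy hv hw, ?_⟩
  filter_upwards [h.equation, hv, hw] with t h1 h2 h3
  rw [h2, h3, h1]

theorem trans {c : ℝ} (h : SolvesOn ι F a b y v w) (h' : SolvesOn ι F b c y v w) (hab : a ≤ b)
    (hbc : b ≤ c) : SolvesOn ι F a c y v w := by
  have hU : Ioc a c = Ioc a b ∪ Ioc b c := (Ioc_union_Ioc_eq_Ioc hab hbc).symm
  refine ⟨⟨?_, ?_, ?_, ?_, fun t ht => ?_⟩, ?_⟩
  · rw [← Icc_union_Icc_eq_Icc hab hbc]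
    exact h.triple.continuousOn.union_of_isClosed h'.triple.continuousOn isClosed_Icc isClosed_Icc
  · rw [hU, ae_restrict_union_iff]
    exact ⟨h.triple.coupling, h'.triple.coupling⟩
  · rw [hU]
    exact memLp_two_restrict_union h.triple.memLp_fst h'.triple.memLp_fst
  · rw [hU]
    exact memLp_two_restrict_union h.triple.memLp_snd h'.triple.memLp_snd
  · rcases le_total t b with htb | htb
    · exact h.triple.integral_eq t ⟨ht.1, htb⟩
    · rw [h'.triple.integral_eq t ⟨htb, ht.2⟩, h.triple.integral_eq b ⟨hab, le_rfl⟩, add_assoc,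
        intervalIntegral.integral_add_adjacent_intervals
          (h.triple.intervalIntegrable le_rfl hab le_rfl)
          (h'.triple.intervalIntegrable le_rfl htb ht.2)]
  · rw [hU, ae_restrict_union_iff]
    exact ⟨h.equation, h'.equation⟩

variable [CompleteSpace H] [CompleteSpace V] {R μ : ℝ}

/-- The energy identity turns the pointwise dissipation into `d/dt |y|² ≤ -2μ|y|²` in integrated
form. That the solution remains in the ball is assumed here and removed in `norm_le_exp`. -/
theorem norm_le_exp_of_norm_le (hinj : Function.Injective ι) (hd : DenseRange ι)
    (hc : IsCompactOperator ι) (hF : ∀ᵐ t ∂(volume.restrict (Ioi (0 : ℝ))), ∀ z : V, ‖ι z‖ ≤ R →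
      -‖z‖ ^ 2 - F t z z ≤ -(μ * ‖ι z‖ ^ 2)) (ha : 0 ≤ a) (hab : a ≤ b)
    (h : SolvesOn ι F a b y v w) (hyR : ∀ t ∈ Icc a b, ‖y t‖ ≤ R) :
    ‖y b‖ ≤ Real.exp (-(μ * (b - a))) * ‖y a‖ := by
  have hsub := Ioc_subset_Ioi_zero (b := b) ha
  have htr := h.triple
  have hpt : ∀ᵐ t ∂(volume.restrict (Ioc a b)), w t (v t) ≤ -(μ * ‖y t‖ ^ 2) := by
    filter_upwards [h.equation, htr.coupling, ae_restrict_of_ae_restrict_of_subset hsub hF,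
      ae_restrict_mem measurableSet_Ioc] with t h1 h2 h3 ht
    have h4 : w t = -rieszCLM V (v t) - F t (v t) := by
      rw [← sub_eq_zero, ← h1]; abel
    have h5 := h3 (v t) (h2 ▸ hyR t (Ioc_subset_Icc_self ht))
    rw [h2, h4]
    simpa only [sub_apply (-rieszCLM V (v t)), neg_apply, rieszCLM_apply,
      real_inner_self_eq_norm_sq] using h5
  have hcont : ContinuousOn (fun t => ‖y t‖ ^ 2) (Icc a b) := htr.continuousOn.norm.pow 2
  have key := le_exp_neg_mul_of_le_sub_integral (c := 2 * μ) hab hcont ?_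
  · refine abs_le_of_sq_le_sq' ?_ (by positivity) |>.2
    rw [mul_pow, ← Real.exp_nat_mul]
    refine key.trans (le_of_eq ?_)
    congr 2
    push_cast; ring
  · intro s t has hst htb
    rw [htr.norm_sq_eq hinj hd hc has hst htb, sub_eq_add_neg, mul_assoc, ← mul_neg]
    gcongr
    rw [← intervalIntegral.integral_const_mul, ← intervalIntegral.integral_neg]
    have hsub' : Ioc s t ⊆ Ioc a b := Ioc_subset_Ioc has htb
    refine intervalIntegral.integral_mono_ae_restrict hst ?_ ?_ ?_
    · refine (intervalIntegrable_iff_integrableOn_Ioc_of_le hst).2 ?_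
      exact IntegrableOn.mono_set (htr.memLp_snd.integrable_dual_apply htr.memLp_fst) hsub'
    · refine ContinuousOn.intervalIntegrable ?_
      rw [uIcc_of_le hst]
      exact ((hcont.mono (Icc_subset_Icc has htb)).const_mul μ).neg
    · rw [← Measure.restrict_congr_set Ioc_ae_eq_Icc]
      exact ae_restrict_of_ae_restrict_of_subset hsub' hpt

/-- If the equation is dissipative on the ball of radius `R`, the norm of a solution that starts
in the open ball decays exponentially. -/
theorem norm_le_exp (hinj : Function.Injective ι) (hd : DenseRange ι)
    (hc : IsCompactOperator ι) (hF : ∀ᵐ t ∂(volume.restrict (Ioi (0 : ℝ))), ∀ z : V, ‖ι z‖ ≤ R →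
      -‖z‖ ^ 2 - F t z z ≤ -(μ * ‖ι z‖ ^ 2)) (hμ : 0 ≤ μ) (ha : 0 ≤ a)
    (h : SolvesOn ι F a b y v w) (hya : ‖y a‖ < R) {s t : ℝ} (has : a ≤ s) (hst : s ≤ t)
    (htb : t ≤ b) : ‖y t‖ ≤ Real.exp (-(μ * (t - s))) * ‖y s‖ := by
  have hcont := h.triple.continuousOn
  -- Continuation argument: where `|y(x)| ≤ |y(a)| < R`, continuity keeps `|y| < R` a little longer,
  -- and the decay on that piece restores `|y| ≤ |y(a)|` at its end.
  have hinv : Icc a b ⊆ {t | ‖y t‖ ≤ ‖y a‖} := by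
    refine IsClosed.Icc_subset_of_forall_exists_gt ?_ (le_refl ‖y a‖) ?_
    · have := hcont.norm.preimage_isClosed_of_isClosed isClosed_Icc (isClosed_Iic (a := ‖y a‖))
      rwa [inter_comm] at this
    · rintro x ⟨hx1, hx⟩ q hq
      have hxR : ‖y x‖ < R := lt_of_le_of_lt hx1 hya
      have hev : ∀ᶠ r in 𝓝[≥] x, ‖y r‖ < R ∧ r ∈ Icc x (min q b) := by
        refine Filter.Eventually.and ?_ (Icc_mem_nhdsGE (lt_min hq hx.2))
        rw [← nhdsWithin_Icc_eq_nhdsGE hx.2]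
        exact ((hcont.norm x ⟨hx.1, hx.2.le⟩).mono (Icc_subset_Icc_left hx.1)).eventually
          (gt_mem_nhds hxR)
      obtain ⟨z, hz1, hz2⟩ := (mem_nhdsGE_iff_exists_Icc_subset).1 hev
      have hzx : x < z := hz1
      have hz3 := hz2 (right_mem_Icc.2 hzx.le)
      have hzb : z ≤ b := hz3.2.2.trans (min_le_right _ _)
      refine ⟨z, ?_, hzx, hz3.2.2.trans (min_le_left _ _)⟩
      have h1 := (h.mono hx.1 hzb).norm_le_exp_of_norm_le hinj hd hc hF (ha.trans hx.1) hzx.le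
        fun r hr => (hz2 hr).1.le
      refine h1.trans (le_trans (mul_le_of_le_one_left (norm_nonneg _) ?_) hx1)
      rw [Real.exp_le_one_iff, neg_nonpos]
      exact mul_nonneg hμ (sub_nonneg.2 hzx.le)
  exact (h.mono has htb).norm_le_exp_of_norm_le hinj hd hc hF (ha.trans has) hst fun r hr =>
    (hinv ⟨has.trans hr.1, hr.2.trans htb⟩).trans hya.le

end SolvesOn

/-- Global existence for perturbations that are dissipative on the ball of radius `R`. -/
theorem IsPerturbation.exists_global [CompleteSpace H] [CompleteSpace V]
    (hinj : Function.Injective ι) (hd : DenseRange ι) (hc : IsCompactOperator ι)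
    (hP : IsPerturbation ι C F) {R μ : ℝ} (hR : 0 < R) (hμ : 0 ≤ μ)
    (hF : ∀ᵐ t ∂(volume.restrict (Ioi (0 : ℝ))), ∀ z : V, ‖ι z‖ ≤ R →
      -‖z‖ ^ 2 - F t z z ≤ -(μ * ‖ι z‖ ^ 2)) {y₀ : H} (hy₀ : ‖y₀‖ < R) :
    ∃ y v w, y 0 = y₀ ∧ ∀ T : ℝ, SolvesOn ι F 0 T y v w := by
  obtain ⟨τ, hτ, hloc⟩ := hP.exists_solvesOn hinj hd hc hR
  have hstep : ∀ (k : ℕ) (h : H), ∃ (y : ℝ → H) (v : ℝ → V) (w : ℝ → StrongDual ℝ V),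
      ‖h‖ ≤ R → SolvesOn ι F (k * τ) (k * τ + τ) y v w ∧ y (k * τ) = h := fun k h => by
    by_cases hh : ‖h‖ ≤ R
    · obtain ⟨y, v, w, h1⟩ := hloc (k * τ) (by positivity) h hh
      exact ⟨y, v, w, fun _ => h1⟩
    -- A dummy value to make the choice total; by the decay, the starting values below never leave
    -- the ball.
    · exact ⟨0, 0, 0, fun h => absurd h hh⟩
  choose Y X W hYXW using hstep
  set h : ℕ → H := fun k => Nat.rec y₀ (fun k h => Y k h (k * τ + τ)) k with hh
  have hsucc : ∀ k, h (k + 1) = Y k (h k) (k * τ + τ) := fun k => rfl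
  have hlt : ∀ k, ‖h k‖ < R := fun k => by
    induction k with
    | zero => exact hy₀
    | succ k ih =>
      obtain ⟨h1, h2⟩ := hYXW k (h k) ih.le
      have h3 := h1.norm_le_exp hinj hd hc hF hμ (by positivity) (by rw [h2]; exact ih) le_rfl
        (by linarith) le_rfl
      rw [h2, ← hsucc] at h3
      refine h3.trans_lt (lt_of_le_of_lt (mul_le_of_le_one_left (norm_nonneg _) ?_) ih)
      rw [Real.exp_le_one_iff, neg_nonpos]
      exact mul_nonneg hμ (by linarith)
  set y : ℝ → H := fun t => Y ⌊t / τ⌋₊ (h ⌊t / τ⌋₊) t with hy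
  set v : ℝ → V := fun t => X ⌊t / τ⌋₊ (h ⌊t / τ⌋₊) t with hv
  set w : ℝ → StrongDual ℝ V := fun t => W ⌊t / τ⌋₊ (h ⌊t / τ⌋₊) t with hw
  have hfloor : ∀ (k : ℕ) (t : ℝ), t ∈ Ico (k * τ) (k * τ + τ) → ⌊t / τ⌋₊ = k := fun k t ht => by
    rw [Nat.floor_eq_iff (div_nonneg (le_trans (by positivity) ht.1) hτ.le)]
    rw [le_div_iff₀ hτ, div_lt_iff₀ hτ]
    exact ⟨ht.1, by linarith [ht.2]⟩
  have hyk : ∀ k : ℕ, y (k * τ) = h k := fun k => by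
    simp only [hy]
    rw [hfloor k (k * τ) ⟨le_rfl, by linarith⟩]
    exact (hYXW k (h k) (hlt k).le).2
  have hpiece : ∀ k : ℕ, SolvesOn ι F (k * τ) (k * τ + τ) y v w := fun k => by
    have hae : ∀ᵐ t ∂(volume.restrict (Ioc (k * τ) (k * τ + τ))), ⌊t / τ⌋₊ = k := by
      rw [← Measure.restrict_congr_set Ico_ae_eq_Ioc]
      exact (ae_restrict_mem measurableSet_Ico).mono fun t ht => hfloor k t ht
    refine (hYXW k (h k) (hlt k).le).1.congr (by linarith) (fun t ht => ?_) ?_ ?_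
    · rcases ht.2.lt_or_eq with htl | hte
      · simp only [hy]
        rw [hfloor k t ⟨ht.1, htl⟩]
      -- At the right endpoint the floor has already jumped to `k + 1`; the next piece starts at the
      -- final value of this one.
      · rw [hte, ← hsucc, ← hyk (k + 1)]
        congr 1
        push_cast; ring
    · filter_upwards [hae] with t ht
      simp only [hv, ht]
    · filter_upwards [hae] with t ht
      simp only [hw, ht]
  have hlong : ∀ k : ℕ, SolvesOn ι F 0 (k * τ + τ) y v w := fun k => by
    induction k with
    | zero => simpa using hpiece 0
    | succ k ih =>
      have h1 := hpiece (k + 1)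
      have h2 : ((k + 1 : ℕ) : ℝ) * τ = k * τ + τ := by push_cast; ring
      rw [h2] at h1 ⊢
      exact ih.trans h1 (by positivity) (by linarith)
  refine ⟨y, v, w, (by simpa using hyk 0 : y 0 = h 0), fun T => ?_⟩
  obtain ⟨k, hk⟩ := exists_nat_ge (T / τ)
  refine (hlong k).mono le_rfl ?_
  rw [div_le_iff₀ hτ] at hk
  linarith

end GlobalExistence

/-! ### Distributional derivatives and integral equations -/

section DistributionalDerivative

variable {X : Type*} [NormedAddCommGroup X] [NormedSpace ℝ X]

/-- Integration by parts for absolutely continuous functions; the primitive of an integrable `f` is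
differentiable only almost everywhere. -/
theorem integral_deriv_mul_primitive {φ f : ℝ → ℝ} {T : ℝ} (hφ : ContDiff ℝ 1 φ)
    (hφT : φ T = 0) (hf : IntervalIntegrable f volume 0 T) :
    ∫ t in (0 : ℝ)..T, deriv φ t * ∫ s in (0 : ℝ)..t, f s = -∫ t in (0 : ℝ)..T, φ t * f t := by
  have h1 : AbsolutelyContinuousOnInterval φ 0 T :=
    hφ.contDiffOn.absolutelyContinuousOnInterval
  have h2 := hf.absolutelyContinuousOnInterval_intervalIntegral (c := 0) left_mem_uIcc
  have h3 := h1.integral_mul_deriv_eq_deriv_mul h2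
  have h4 : ∫ t in (0 : ℝ)..T, φ t * deriv (fun x => ∫ s in (0 : ℝ)..x, f s) t =
      ∫ t in (0 : ℝ)..T, φ t * f t := by
    refine intervalIntegral.integral_congr_ae ?_
    filter_upwards [hf.ae_hasDerivAt_integral] with t ht htm
    rw [(ht (uIoc_subset_uIcc htm) 0 left_mem_uIcc).deriv]
  rw [h4, hφT, intervalIntegral.integral_same] at h3
  linarith

/-- Continuous functionals separate points and commute with the integral, which reduces the
vector-valued case to the scalar one. The constant `c` drops out because `φ` vanishes at both ends.
-/
theorem integral_deriv_smul_add_primitive [CompleteSpace X] {φ : ℝ → ℝ} {w : ℝ → X} {T : ℝ}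
    (hφ : ContDiff ℝ 1 φ) (hφ0 : φ 0 = 0) (hφT : φ T = 0)
    (hw : IntervalIntegrable w volume 0 T) (c : X) :
    ∫ t in (0 : ℝ)..T, deriv φ t • (c + ∫ s in (0 : ℝ)..t, w s) =
      -∫ t in (0 : ℝ)..T, φ t • w t := by
  have hdc := hφ.continuous_deriv le_rfl
  have hWc : ContinuousOn (fun t => ∫ s in (0 : ℝ)..t, w s) (uIcc 0 T) :=
    intervalIntegral.continuousOn_primitive_interval ((intervalIntegrable_iff' (by simp)).1 hw)
  have hI1 : IntervalIntegrable (fun t => deriv φ t • (c + ∫ s in (0 : ℝ)..t, w s)) volume 0 T :=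
    (hdc.continuousOn.smul (continuousOn_const.add hWc)).intervalIntegrable
  have hI2 : IntervalIntegrable (fun t => φ t • w t) volume 0 T :=
    hw.continuousOn_smul hφ.continuous.continuousOn
  refine (SeparatingDual.eq_iff_forall_dual_eq (R := ℝ)).2 fun L => ?_
  rw [map_neg, ← L.intervalIntegral_comp_comm hI1, ← L.intervalIntegral_comp_comm hI2]
  have hLw : IntervalIntegrable (fun t => L (w t)) volume 0 T :=
    ⟨L.integrable_comp hw.1, L.integrable_comp hw.2⟩
  have h1 : ∫ t in (0 : ℝ)..T, deriv φ t = 0 := by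
    rw [intervalIntegral.integral_deriv_eq_sub
      (fun t _ => hφ.differentiable one_ne_zero t) (hdc.intervalIntegrable _ _), hφ0, hφT, sub_self]
  have h2 : ∫ t in (0 : ℝ)..T, L (deriv φ t • (c + ∫ s in (0 : ℝ)..t, w s)) =
      ∫ t in (0 : ℝ)..T, (deriv φ t * L c + deriv φ t * ∫ s in (0 : ℝ)..t, L (w s)) := by
    refine intervalIntegral.integral_congr fun t ht => ?_
    have hwt : IntervalIntegrable w volume 0 t :=
      hw.mono_set (uIcc_subset_uIcc left_mem_uIcc ht)
    simp only [map_smul, map_add, smul_eq_mul, mul_add, L.intervalIntegral_comp_comm hwt]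
  have h3 : ContinuousOn (fun t => ∫ s in (0 : ℝ)..t, L (w s)) (uIcc 0 T) :=
    intervalIntegral.continuousOn_primitive_interval ((intervalIntegrable_iff' (by simp)).1 hLw)
  have hI3 : IntervalIntegrable (fun t => deriv φ t * L c) volume 0 T :=
    (hdc.mul continuous_const).intervalIntegrable _ _
  have hI4 : IntervalIntegrable (fun t => deriv φ t * ∫ s in (0 : ℝ)..t, L (w s)) volume 0 T :=
    (hdc.continuousOn.mul h3).intervalIntegrable
  rw [h2, intervalIntegral.integral_add hI3 hI4, intervalIntegral.integral_mul_const, h1, zero_mul,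
    zero_add, integral_deriv_mul_primitive hφ hφT hLw]
  simp

theorem exists_tsupport_subset_Ioo {φ : ℝ → ℝ} (hc : HasCompactSupport φ)
    (hs : tsupport φ ⊆ Ioi 0) : ∃ δ T : ℝ, 0 < δ ∧ δ < T ∧ tsupport φ ⊆ Ioo δ T := by
  by_cases hne : (tsupport φ).Nonempty
  · obtain ⟨m, hm, hmin⟩ := hc.isCompact.exists_isLeast hne
    obtain ⟨M, hM, hmax⟩ := hc.isCompact.exists_isGreatest hne
    have h0 : 0 < m := hs hm
    have hmM : m ≤ M := hmin hM
    exact ⟨m / 2, M + 1, by linarith, by linarith,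
      fun t ht => ⟨by linarith [hmin ht], by linarith [hmax ht]⟩⟩
  · rw [not_nonempty_iff_eq_empty] at hne
    exact ⟨1, 2, one_pos, one_lt_two, by simp [hne]⟩

theorem setIntegral_Ioi_eq_intervalIntegral {f : ℝ → X} {δ T : ℝ} (hδ : 0 < δ) (hδT : δ < T)
    (hf : ∀ t, t ∉ Ioo δ T → f t = 0) : ∫ t in Ioi (0 : ℝ), f t = ∫ t in (0 : ℝ)..T, f t := by
  rw [intervalIntegral.integral_of_le (hδ.trans hδT).le]
  exact setIntegral_eq_of_subset_of_forall_sdiff_eq_zero measurableSet_Ioi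
    (fun t ht => ht.1) fun t ht => hf t fun h => ht.2 ⟨ht.1, h.2.le⟩

theorem isDistribDeriv_of_eq_add_integral [CompleteSpace X] {u w : ℝ → X}
    (hw : ∀ T, 0 < T → IntegrableOn w (Ioc 0 T))
    (hu : ∀ t, 0 < t → u t = u 0 + ∫ s in (0 : ℝ)..t, w s) : IsDistribDeriv u w := by
  intro φ hφ hc hs
  obtain ⟨δ, T, hδ, hδT, hsub⟩ := exists_tsupport_subset_Ioo hc hs
  have hT : 0 < T := hδ.trans hδT
  have hφ0 : ∀ t, t ∉ Ioo δ T → φ t = 0 := fun t ht =>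
    image_eq_zero_of_notMem_tsupport fun h => ht (hsub h)
  have hdφ0 : ∀ t, t ∉ Ioo δ T → deriv φ t = 0 := fun t ht =>
    image_eq_zero_of_notMem_tsupport fun h => ht (hsub (tsupport_deriv_subset h))
  rw [setIntegral_Ioi_eq_intervalIntegral hδ hδT (fun t ht => by rw [hdφ0 t ht, zero_smul]),
    setIntegral_Ioi_eq_intervalIntegral hδ hδT (fun t ht => by rw [hφ0 t ht, zero_smul]),
    ← integral_deriv_smul_add_primitive (hφ.of_le (by exact_mod_cast le_top))
      (hφ0 0 (fun h => by linarith [h.1])) (hφ0 T (fun h => by linarith [h.2]))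
      ((intervalIntegrable_iff_integrableOn_Ioc_of_le hT.le).2 (hw T hT)) (u 0)]
  refine intervalIntegral.integral_congr_ae (.of_forall fun t ht => ?_)
  rw [uIoc_of_le hT.le] at ht
  simp only [hu t ht.1]

/-- A smooth compactly supported function with zero integral is the derivative of one. -/
theorem exists_deriv_eq_of_integral_eq_zero {ψ : ℝ → ℝ} (hψ : ContDiff ℝ (⊤ : ℕ∞) ψ)
    {δ T : ℝ} (hδ : 0 < δ) (hs : ∀ t, t ∉ Ioo δ T → ψ t = 0)
    (h0 : ∫ t in (0 : ℝ)..T, ψ t = 0) :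
    ∃ φ : ℝ → ℝ, ContDiff ℝ (⊤ : ℕ∞) φ ∧ HasCompactSupport φ ∧ tsupport φ ⊆ Ioi 0 ∧
      deriv φ = ψ := by
  set φ : ℝ → ℝ := fun t => ∫ s in (0 : ℝ)..t, ψ s with hφ
  have hψc := hψ.continuous
  have hd : ∀ t, HasDerivAt φ (ψ t) t := fun t =>
    intervalIntegral.integral_hasDerivAt_right (hψc.intervalIntegrable _ _)
      (hψc.stronglyMeasurableAtFilter _ _) hψc.continuousAt
  have hderiv : deriv φ = ψ := funext fun t => (hd t).deriv
  have hzero : ∀ t, t ∉ Icc δ T → φ t = 0 := fun t ht => by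
    by_cases htδ : t < δ
    · have : ∫ s in (0 : ℝ)..t, ψ s = ∫ s in (0 : ℝ)..t, 0 := by
        refine intervalIntegral.integral_congr fun s hs' => hs s fun h => ?_
        rcases mem_uIcc.1 hs' with h3 | h3 <;> linarith [h.1, h3.2]
      rw [hφ]; simp [this]
    · have hTt : T < t := by
        by_contra hh
        exact ht ⟨not_lt.1 htδ, not_lt.1 hh⟩
      have h1 : ∫ s in T..t, ψ s = ∫ s in T..t, 0 := by
        refine intervalIntegral.integral_congr fun s hs' => hs s fun h => ?_
        rw [uIcc_of_le hTt.le] at hs'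
        linarith [h.2, hs'.1]
      have h2 := intervalIntegral.integral_add_adjacent_intervals
        (hψc.intervalIntegrable (μ := volume) 0 T) (hψc.intervalIntegrable (μ := volume) T t)
      rw [h0, h1] at h2
      simp only [hφ, ← h2]
      simp
  refine ⟨φ, ?_, HasCompactSupport.intro isCompact_Icc hzero, ?_, hderiv⟩
  · rw [contDiff_infty_iff_deriv, hderiv]
    exact ⟨fun t => (hd t).differentiableAt, hψ⟩
  · refine (closure_minimal (fun t ht => ?_) isClosed_Icc).trans
      (fun t (ht : t ∈ Icc δ T) => hδ.trans_le ht.1)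
    by_contra h
    exact ht (hzero t h)

/-- The du Bois-Reymond lemma for continuous functions on the half-line. -/
theorem exists_eq_const_of_integral_deriv_smul_eq_zero [CompleteSpace X] {g : ℝ → X}
    (hg : ContinuousOn g (Ioi 0))
    (h : ∀ φ : ℝ → ℝ, ContDiff ℝ (⊤ : ℕ∞) φ → HasCompactSupport φ → tsupport φ ⊆ Ioi 0 →
      ∫ t in Ioi (0 : ℝ), deriv φ t • g t = 0) : ∃ c : X, ∀ t, 0 < t → g t = c := by
  set B : ContDiffBump (1 : ℝ) := ⟨1 / 4, 1 / 2, by norm_num, by norm_num⟩ with hB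
  set η : ℝ → ℝ := B.normed volume with hη
  have hηs : ContDiff ℝ (⊤ : ℕ∞) η := B.contDiff_normed
  have hηz : ∀ t, t ∉ Ioo (1 / 4 : ℝ) 2 → η t = 0 := fun t ht => by
    refine image_eq_zero_of_notMem_tsupport fun h' => ht ?_
    rw [hη, B.tsupport_normed_eq, Real.closedBall_eq_Icc] at h'
    have h1 := h'.1
    have h2 := h'.2
    simp only [hB] at h1 h2
    exact ⟨by linarith, by linarith⟩
  set c : X := ∫ t in Ioi (0 : ℝ), η t • g t with hc
  refine ⟨c, ?_⟩
  have hloc : LocallyIntegrableOn (fun t => g t - c) (Ioi 0) :=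
    (hg.sub continuousOn_const).locallyIntegrableOn measurableSet_Ioi
  have hint : ∀ {θ : ℝ → ℝ}, Continuous θ → ∀ {δ T : ℝ}, 0 < δ → δ < T →
      (∀ t, t ∉ Ioo δ T → θ t = 0) → IntegrableOn (fun t => θ t • g t) (Ioi 0) := by
    intro θ hθ δ T hδ hδT hz
    have h1 : IntegrableOn (fun t => θ t • g t) (Icc δ T) :=
      (hθ.continuousOn.smul (hg.mono fun t ht => hδ.trans_le ht.1)).integrableOn_Icc
    refine h1.of_forall_sdiff_eq_zero measurableSet_Ioi fun t ht => ?_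
    rw [hz t fun h => ht.2 ⟨h.1.le, h.2.le⟩, zero_smul]
  have hae := isOpen_Ioi.ae_eq_zero_of_integral_contDiff_smul_eq_zero hloc ?_
  · have hEq : EqOn (fun t => g t - c) (fun _ => 0) (Ioi 0) := by
      refine Measure.eqOn_open_of_ae_eq (μ := volume) ?_ isOpen_Ioi
        (hg.sub continuousOn_const) continuousOn_const
      exact (ae_restrict_iff' measurableSet_Ioi).2 hae
    exact fun t ht => sub_eq_zero.1 (hEq ht)
  · intro θ hθ hθc hθs
    obtain ⟨δ, T, hδ, hδT, hsub⟩ := exists_tsupport_subset_Ioo hθc hθs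
    have hθz : ∀ t, t ∉ Ioo δ T → θ t = 0 := fun t ht =>
      image_eq_zero_of_notMem_tsupport fun h => ht (hsub h)
    set a : ℝ := ∫ t in Ioi (0 : ℝ), θ t with ha
    set δ' := min δ (1 / 4)
    set T' := max T 2
    have hδ' : 0 < δ' := lt_min hδ (by norm_num)
    have hδT' : δ' < T' := (min_le_left _ _).trans_lt (hδT.trans_le (le_max_left _ _))
    have hθz' : ∀ t, t ∉ Ioo δ' T' → θ t = 0 := fun t ht => hθz t fun h =>
      ht ⟨(min_le_left _ _).trans_lt h.1, h.2.trans_le (le_max_left _ _)⟩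
    have hηz' : ∀ t, t ∉ Ioo δ' T' → η t = 0 := fun t ht => hηz t fun h =>
      ht ⟨(min_le_right _ _).trans_lt h.1, h.2.trans_le (le_max_right _ _)⟩
    have hη1 : ∫ t in (0 : ℝ)..T', η t = 1 := by
      rw [← setIntegral_Ioi_eq_intervalIntegral hδ' hδT' hηz',
        setIntegral_eq_integral_of_forall_compl_eq_zero (s := Ioi (0 : ℝ))
          (fun t ht => hηz' t fun h => ht (hδ'.trans h.1))]
      exact B.integral_normed
    have hθint : IntervalIntegrable θ volume 0 T' := hθ.continuous.intervalIntegrable _ _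
    have hηint : IntervalIntegrable (fun t => a * η t) volume 0 T' :=
      (continuous_const.mul hηs.continuous).intervalIntegrable _ _
    -- Subtracting `a` times the bump `η` of integral one leaves a test function of mean zero, that
    -- is, the derivative of an admissible `φ`.
    obtain ⟨φ, hφ1, hφ2, hφ3, hφ4⟩ := exists_deriv_eq_of_integral_eq_zero
      (ψ := fun t => θ t - a * η t) (hθ.sub (contDiff_const.mul hηs)) hδ'
      (fun t ht => by rw [hθz' t ht, hηz' t ht, mul_zero, sub_zero]) (by
        rw [intervalIntegral.integral_sub hθint hηint, intervalIntegral.integral_const_mul, hη1, ha,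
          setIntegral_Ioi_eq_intervalIntegral hδ' hδT' hθz', mul_one, sub_self])
    have h1 := h φ hφ1 hφ2 hφ3
    rw [hφ4] at h1
    have hθI : IntegrableOn θ (Ioi 0) :=
      (hθ.continuous.integrable_of_hasCompactSupport hθc).integrableOn
    have h2 : ∫ t in Ioi (0 : ℝ), (θ t - a * η t) • g t =
        (∫ t in Ioi (0 : ℝ), θ t • g t) - a • c := by
      have hI : IntegrableOn (fun t => a • η t • g t) (Ioi 0) :=
        (hint hηs.continuous hδ' hδT' hηz').smul a
      rw [hc, ← integral_smul, ← integral_sub (hint hθ.continuous hδ' hδT' hθz') hI]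
      refine integral_congr_ae (.of_forall fun t => ?_)
      simp only [sub_smul, mul_smul]
    rw [← setIntegral_eq_integral_of_forall_compl_eq_zero (s := Ioi 0)
      (fun t ht => by rw [hθz' t fun h => ht (hδ'.trans h.1), zero_smul])]
    simp only [smul_sub]
    rw [integral_sub (hint hθ.continuous hδ' hδT' hθz') (hθI.smul_const c), integral_smul_const,
      ← ha, ← h2, h1]

/-- The difference of `u` and the primitive of `w` has zero distributional derivative, so it is
constant on the open half-line; continuity carries this to `0`. -/
theorem IsDistribDeriv.eq_add_integral [CompleteSpace X] {u w : ℝ → X}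
    (h : IsDistribDeriv u w) (hu : ContinuousOn u (Ici 0))
    (hw : ∀ T, 0 < T → IntegrableOn w (Ioc 0 T)) {t : ℝ} (ht : 0 ≤ t) :
    u t = u 0 + ∫ s in (0 : ℝ)..t, w s := by
  set W : ℝ → X := fun t => ∫ s in (0 : ℝ)..t, w s with hW
  have hWc : ContinuousOn W (Ici 0) := by
    intro x hx
    have hx1 : (0 : ℝ) ≤ x + 1 := by linarith [mem_Ici.1 hx]
    have h1 : ContinuousOn W (uIcc 0 (x + 1)) := by
      refine intervalIntegral.continuousOn_primitive_interval ?_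
      rw [uIcc_of_le hx1, integrableOn_Icc_iff_integrableOn_Ioc]
      exact hw _ (by linarith [mem_Ici.1 hx])
    rw [uIcc_of_le hx1] at h1
    refine (h1 x ⟨hx, by linarith⟩).mono_of_mem_nhdsWithin ?_
    rw [← Ici_inter_Iic]
    exact inter_mem_nhdsWithin _ (Iic_mem_nhds (by linarith))
  have hgc : ContinuousOn (fun t => u t - W t) (Ici 0) := hu.sub hWc
  have hWd : IsDistribDeriv W w := isDistribDeriv_of_eq_add_integral hw fun t _ => by simp [hW]
  obtain ⟨c, hc⟩ := exists_eq_const_of_integral_deriv_smul_eq_zero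
    (hgc.mono Ioi_subset_Ici_self) fun φ h1 h2 h3 => by
      obtain ⟨δ, T, hδ, hδT, hsub⟩ := exists_tsupport_subset_Ioo h2 h3
      have hdz : ∀ t, t ∉ Icc δ T → deriv φ t = 0 := fun t ht =>
        image_eq_zero_of_notMem_tsupport fun h =>
          ht (Ioo_subset_Icc_self (hsub (tsupport_deriv_subset h)))
      have hdc : Continuous (deriv φ) := h1.continuous_deriv (by exact_mod_cast le_top)
      have hint : ∀ {f : ℝ → X}, ContinuousOn f (Ici 0) →
          IntegrableOn (fun t => deriv φ t • f t) (Ioi 0) := fun hf => by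
        have h4 := (hdc.continuousOn.smul (hf.mono fun t (ht : t ∈ Icc δ T) =>
          hδ.le.trans ht.1)).integrableOn_Icc (μ := volume)
        refine h4.of_forall_sdiff_eq_zero measurableSet_Ioi fun t ht => ?_
        rw [Pi.smul_apply', hdz t ht.2, zero_smul]
      simp only [smul_sub]
      rw [integral_sub (hint hu) (hint hWc), h φ h1 h2 h3, hWd φ h1 h2 h3, sub_self]
  have hclos : EqOn (fun t => u t - W t) (fun _ => c) (Ici 0) := by
    refine EqOn.of_subset_closure (s := Ioi 0) (fun t ht => hc t ht) hgc continuousOn_const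
      Ioi_subset_Ici_self ?_
    rw [closure_Ioi]
  have h0 := hclos (mem_Ici.2 le_rfl)
  have h1 := hclos (mem_Ici.2 ht)
  simp only [hW, intervalIntegral.integral_same, sub_zero] at h0 h1
  rw [h0, ← h1, sub_add_cancel]

end DistributionalDerivative

/-! ### Absorbing the powers of the Lipschitz bound -/

section Young

/-- The power and `ε m` cross at `m₀ = ε ^ (-1/(1 - θ))`: below it the power is at most `m₀ ^ θ`,
above it at most `ε m`. -/
theorem exists_rpow_le_mul_add {θ ε : ℝ} (hθ0 : 0 ≤ θ) (hθ : θ < 1) (hε : 0 < ε) :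
    ∃ K : ℝ, 0 ≤ K ∧ ∀ m : ℝ, 0 ≤ m → m ^ θ ≤ ε * m + K := by
  have h1 : 0 < 1 - θ := by linarith
  set m₀ : ℝ := ε⁻¹ ^ (1 / (1 - θ)) with hm₀
  have hm₀0 : 0 < m₀ := by positivity
  refine ⟨m₀ ^ θ, by positivity, fun m hm => ?_⟩
  rcases le_total m m₀ with h | h
  · have := Real.rpow_le_rpow hm h hθ0
    nlinarith
  · have hm0 : 0 < m := hm₀0.trans_le h
    have h2 : ε⁻¹ ≤ m ^ (1 - θ) := by
      calc ε⁻¹ = m₀ ^ (1 - θ) := by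
            rw [hm₀, ← Real.rpow_mul (by positivity), one_div_mul_cancel h1.ne', Real.rpow_one]
        _ ≤ m ^ (1 - θ) := Real.rpow_le_rpow hm₀0.le h h1.le
    have h3 : m ^ θ * m ^ (1 - θ) = m := by
      rw [← Real.rpow_add hm0]; simp
    have h4 : m ^ θ ≤ ε * m := by
      have h5 := mul_le_mul_of_nonneg_left h2 (Real.rpow_nonneg hm θ)
      rw [h3] at h5
      calc m ^ θ = ε * (m ^ θ * ε⁻¹) := by field_simp
        _ ≤ ε * m := by gcongr
    have : 0 ≤ m₀ ^ θ := by positivity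
    linarith

/-- Absorption of a single power-type term of the Lipschitz bound. -/
theorem exists_power_term_le {ζ₁ ζ₂ δ₁ δ₂ ρ ε : ℝ} (hζ₁ : 0 ≤ ζ₁) (hζ₂ : 0 ≤ ζ₂)
    (hδ₂ : 0 ≤ δ₂) (h2 : ζ₂ + δ₂ < 1) (h1 : 1 ≤ δ₁ + δ₂) (hρ : 0 < ρ) (hε : 0 < ε) :
    ∃ K : ℝ, 0 ≤ K ∧ ∀ p₁ p₂ q₁ q₂ p q : ℝ, 0 ≤ p₁ → p₁ ≤ ρ → 0 ≤ p₂ → p₂ ≤ ρ → 0 ≤ q₁ →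
      0 ≤ q₂ → 0 < p → p ≤ 2 * ρ → 0 ≤ q →
      (p₁ ^ ζ₁ * q₁ ^ ζ₂ + p₂ ^ ζ₁ * q₂ ^ ζ₂) * (p ^ δ₁ * q ^ δ₂) ≤
        ε * q + (ε * (q₁ + q₂) + K) * p := by
  set c : ℝ := 2 * ρ ^ ζ₁ * (2 * ρ) ^ (δ₁ + δ₂ - 1) with hc
  have hc0 : 0 ≤ c := by positivity
  obtain ⟨K, hK0, hK⟩ := exists_rpow_le_mul_add (add_nonneg hζ₂ hδ₂) h2
    (ε := ε / (c + 1)) (by positivity)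
  refine ⟨c * K, by positivity, fun p₁ p₂ q₁ q₂ p q hp₁ hp₁ρ hp₂ hp₂ρ hq₁ hq₂ hp hpρ hq => ?_⟩
  -- This `m` dominates `q₁`, `q₂` and `q / p`, and `p m = q + (q₁ + q₂) p` has exactly the shape of
  -- the target.
  set m : ℝ := q₁ + q₂ + q / p with hm
  have hqp : 0 ≤ q / p := by positivity
  have hm0 : 0 ≤ m := by positivity
  have e1 : p₁ ^ ζ₁ * q₁ ^ ζ₂ ≤ ρ ^ ζ₁ * m ^ ζ₂ :=
    mul_le_mul (Real.rpow_le_rpow hp₁ hp₁ρ hζ₁) (Real.rpow_le_rpow hq₁ (by linarith) hζ₂)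
      (by positivity) (by positivity)
  have e2 : p₂ ^ ζ₁ * q₂ ^ ζ₂ ≤ ρ ^ ζ₁ * m ^ ζ₂ :=
    mul_le_mul (Real.rpow_le_rpow hp₂ hp₂ρ hζ₁) (Real.rpow_le_rpow hq₂ (by linarith) hζ₂)
      (by positivity) (by positivity)
  have e3 : q ^ δ₂ ≤ p ^ δ₂ * m ^ δ₂ := by
    rw [← Real.mul_rpow hp.le hm0]
    refine Real.rpow_le_rpow hq ?_ hδ₂
    calc q = p * (q / p) := by field_simp
      _ ≤ p * m := by gcongr; linarith
  -- Here `δ₁ + δ₂ ≥ 1` is used: a full factor `p` splits off, and the remaining power is bounded.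
  have e4 : p ^ δ₁ * p ^ δ₂ ≤ p * (2 * ρ) ^ (δ₁ + δ₂ - 1) := by
    calc p ^ δ₁ * p ^ δ₂ = p * p ^ (δ₁ + δ₂ - 1) := by
          rw [← Real.rpow_add hp, Real.rpow_sub_one hp.ne']; field_simp
      _ ≤ _ := by gcongr
  have e5 : m ^ ζ₂ * m ^ δ₂ = m ^ (ζ₂ + δ₂) := (Real.rpow_add_of_nonneg hm0 hζ₂ hδ₂).symm
  calc (p₁ ^ ζ₁ * q₁ ^ ζ₂ + p₂ ^ ζ₁ * q₂ ^ ζ₂) * (p ^ δ₁ * q ^ δ₂)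
      ≤ (ρ ^ ζ₁ * m ^ ζ₂ + ρ ^ ζ₁ * m ^ ζ₂) * (p ^ δ₁ * (p ^ δ₂ * m ^ δ₂)) := by gcongr
    _ = 2 * ρ ^ ζ₁ * (m ^ ζ₂ * m ^ δ₂) * (p ^ δ₁ * p ^ δ₂) := by ring
    _ ≤ 2 * ρ ^ ζ₁ * (m ^ ζ₂ * m ^ δ₂) * (p * (2 * ρ) ^ (δ₁ + δ₂ - 1)) := by gcongr
    _ = c * p * m ^ (ζ₂ + δ₂) := by rw [e5, hc]; ring
    _ ≤ c * p * (ε / (c + 1) * m + K) := by gcongr; exact hK m hm0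
    _ = c / (c + 1) * (ε * (p * m)) + c * K * p := by ring
    _ ≤ 1 * (ε * (p * m)) + c * K * p := by
        gcongr
        rw [div_le_one (by positivity)]; linarith
    _ = ε * q + (ε * (q₁ + q₂) + c * K) * p := by rw [hm]; field_simp; ring

theorem NonlinearityExponents.exists_sum_le {n : ℕ} (e : NonlinearityExponents n) {C ρ ε : ℝ}
    (hC : 0 ≤ C) (hρ : 0 < ρ) (hε : 0 < ε) :
    ∃ K : ℝ, 0 ≤ K ∧ ∀ p₁ p₂ q₁ q₂ p q : ℝ, 0 ≤ p₁ → p₁ ≤ ρ → 0 ≤ p₂ → p₂ ≤ ρ → 0 ≤ q₁ →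
      0 ≤ q₂ → 0 < p → p ≤ 2 * ρ → 0 ≤ q →
      C * ∑ j : Fin n, (p₁ ^ e.ζ₁ j * q₁ ^ e.ζ₂ j + p₂ ^ e.ζ₁ j * q₂ ^ e.ζ₂ j) *
        (p ^ e.δ₁ j * q ^ e.δ₂ j) ≤ ε * q + (ε * (q₁ + q₂) + K) * p := by
  set ε' : ℝ := ε / (C * n + 1) with hε'
  have hε'0 : 0 < ε' := by positivity
  have hCn : C * (n * ε') ≤ ε := by
    rw [hε', ← mul_div_assoc, ← mul_div_assoc, div_le_iff₀ (by positivity)]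
    nlinarith
  choose K hK0 hK using fun j => exists_power_term_le (e.ζ₁_nonneg j) (e.ζ₂_nonneg j)
    (e.δ₂_nonneg j) (e.ζ₂_add_δ₂_lt j) (e.one_le_δ₁_add_δ₂ j) hρ hε'0
  refine ⟨C * ∑ j, K j, mul_nonneg hC (Finset.sum_nonneg fun j _ => hK0 j),
    fun p₁ p₂ q₁ q₂ p q hp₁ hp₁ρ hp₂ hp₂ρ hq₁ hq₂ hp hpρ hq => ?_⟩
  calc _ ≤ C * ∑ j : Fin n, (ε' * q + (ε' * (q₁ + q₂) + K j) * p) := by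
        gcongr with j
        exact hK j p₁ p₂ q₁ q₂ p q hp₁ hp₁ρ hp₂ hp₂ρ hq₁ hq₂ hp hpρ hq
    _ = C * (n * ε') * q + (C * (n * ε') * (q₁ + q₂) + C * ∑ j, K j) * p := by
        simp only [Finset.sum_add_distrib, add_mul, Finset.sum_const, Finset.card_univ,
          Fintype.card_fin, nsmul_eq_mul, ← Finset.sum_mul]
        ring
    _ ≤ _ := by gcongr

end Young

/-! ### Consequences of the structural assumptions -/

section Assumptions

variable {H V : Type*} [NormedAddCommGroup H] [InnerProductSpace ℝ H]
  [NormedAddCommGroup V] [InnerProductSpace ℝ V] {ι : V →L[ℝ] H}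

theorem IsBoundedContinuous.map_zero {X Y : Type*} [NormedAddCommGroup X] [NormedAddCommGroup Y]
    {f : X → Y} (hf : IsBoundedContinuous f) : f 0 = 0 := by
  obtain ⟨-, i, -, -, hi0, hi⟩ := hf
  have := hi 0
  rw [norm_zero, hi0] at this
  exact norm_le_zero_iff.1 this

/-- The infimum defining the norm need not be attained; replacing `C` by `C + 1` leaves room for an
actual decomposition at each time. Only the resulting bound is kept, so the decomposition need not
be measurable in time. -/
theorem IsReactionConvection.abs_apply_le {C : ℝ≥0} {Arc : ℝ → V →L[ℝ] StrongDual ℝ V}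
    (h : IsReactionConvection ι C Arc) : ∀ᵐ t ∂(volume.restrict (Ioi (0 : ℝ))), ∀ z φ : V,
      |Arc t z φ| ≤ (C + 1) * (‖ι z‖ * ‖φ‖ + ‖z‖ * ‖ι φ‖) := by
  filter_upwards [h.mem_sum, h.bound] with t ⟨B₀, G₀, h₀⟩ hb z φ
  obtain ⟨r, ⟨B, G, hBG, hr⟩, hrC⟩ := exists_lt_of_csInf_lt
    (s := {r : ℝ | ∃ (B : H →L[ℝ] StrongDual ℝ V) (G : V →L[ℝ] H),
      IsSumDecomposition ι (Arc t) B G ∧ r = Real.sqrt (‖B‖ ^ 2 + ‖G‖ ^ 2)})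
    ⟨_, B₀, G₀, h₀, rfl⟩ (lt_of_le_of_lt hb (lt_add_one (C : ℝ)))
  have hB : ‖B‖ ≤ C + 1 := (Real.le_sqrt_of_sq_le (by nlinarith [sq_nonneg ‖G‖])).trans
    (hr ▸ hrC).le
  have hG : ‖G‖ ≤ C + 1 := (Real.le_sqrt_of_sq_le (by nlinarith [sq_nonneg ‖B‖])).trans
    (hr ▸ hrC).le
  rw [hBG z, add_apply, pivot_apply]
  have h1 : |B (ι z) φ| ≤ (C + 1) * (‖ι z‖ * ‖φ‖) := by
    calc |B (ι z) φ| ≤ ‖B‖ * ‖ι z‖ * ‖φ‖ := B.le_opNorm₂ _ _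
      _ ≤ (C + 1) * ‖ι z‖ * ‖φ‖ := by gcongr
      _ = _ := by ring
  have h2 : |inner ℝ (G z) (ι φ)| ≤ (C + 1) * (‖z‖ * ‖ι φ‖) := by
    calc |inner ℝ (G z) (ι φ)| ≤ ‖G z‖ * ‖ι φ‖ := abs_real_inner_le_norm _ _
      _ ≤ ‖G‖ * ‖z‖ * ‖ι φ‖ := by gcongr; exact G.le_opNorm z
      _ ≤ (C + 1) * ‖z‖ * ‖ι φ‖ := by gcongr
      _ = _ := by ring
  exact (abs_add_le _ _).trans (by linarith)

/-- The Lipschitz bound of an admissible nonlinearity, with the powers absorbed. -/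
theorem NonlinearityExponents.exists_lipschitz_bound (hinj : Function.Injective ι) {n : ℕ}
    (e : NonlinearityExponents n) (C₀ : ℝ≥0) {ρ ε : ℝ} (hρ : 0 < ρ) (hε : 0 < ε) :
    ∃ K : ℝ, 0 ≤ K ∧ ∀ (C : ℝ≥0) (N : ℝ → V → StrongDual ℝ V), C ≤ C₀ →
      IsAdmissibleNonlinearity ι e C N → ∀ t : ℝ, 0 < t → ∀ z₁ z₂ : V, ‖ι z₁‖ ≤ ρ → ‖ι z₂‖ ≤ ρ →
      ‖N t z₁ - N t z₂‖ ≤ ε * ‖z₁ - z₂‖ + (ε * (‖z₁‖ + ‖z₂‖) + K) * ‖ι (z₁ - z₂)‖ := by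
  obtain ⟨K, hK0, hK⟩ := e.exists_sum_le C₀.2 hρ hε
  refine ⟨K, hK0, fun C N hC hN t ht z₁ z₂ h₁ h₂ => ?_⟩
  by_cases hz : z₁ - z₂ = 0
  · rw [sub_eq_zero.1 hz]; simp
  have hp : 0 < ‖ι (z₁ - z₂)‖ := norm_pos_iff.2 fun h => hz (hinj (by rw [h, map_zero]))
  have hp2 : ‖ι (z₁ - z₂)‖ ≤ 2 * ρ := by
    rw [map_sub]
    exact (norm_sub_le _ _).trans (by linarith)
  refine (hN.lipschitz_bound t ht z₁ z₂).trans (le_trans ?_ (hK ‖ι z₁‖ ‖ι z₂‖ ‖z₁‖ ‖z₂‖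
    ‖ι (z₁ - z₂)‖ ‖z₁ - z₂‖ (norm_nonneg _) h₁ (norm_nonneg _) h₂ (norm_nonneg _) (norm_nonneg _)
    hp hp2 (norm_nonneg _)))
  exact mul_le_mul_of_nonneg_right (NNReal.coe_le_coe.2 hC)
    (Finset.sum_nonneg fun j _ => by positivity)

/-- The lower-order part of the closed-loop system. -/
def closedLoop (ι : V →L[ℝ] H) (Arc : ℝ → V →L[ℝ] StrongDual ℝ V) (N : ℝ → V → StrongDual ℝ V)
    (U : Submodule ℝ H) [U.HasOrthogonalProjection] (K : ℝ → U → U) (t : ℝ) (z : V) :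
    StrongDual ℝ V :=
  Arc t z + N t z - pivot ι (feedbackInput U K t (ι z))

/-- The convection part `G` yields the term with `|ι φ|`, the reaction part `B` enters `K`, and
nonlinearity and feedback take `ε/2` each. Constants may depend on the feedback, as this serves
well-posedness only and not the thresholds. -/
theorem isPerturbation_closedLoop (hinj : Function.Injective ι) {Crc CN lam : ℝ≥0}
    {Arc : ℝ → V →L[ℝ] StrongDual ℝ V} {N : ℝ → V → StrongDual ℝ V} {n : ℕ}
    {e : NonlinearityExponents n} {U : Submodule ℝ H} [U.HasOrthogonalProjection] {K : ℝ → U → U}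
    (hArc : IsReactionConvection ι Crc Arc) (hN : IsAdmissibleNonlinearity ι e CN N)
    (hK : IsAdmissibleFeedback ι U lam K) :
    IsPerturbation ι (Crc + 1) (closedLoop ι Arc N U K) := by
  obtain ⟨m, e', C', hK'⟩ := hK.nonlinearity
  refine ⟨fun z => ?_, ?_, ?_, by positivity, fun ρ ε hρ hε => ?_⟩
  · exact ((hArc.measurable z).add (hN.locallyIntegrable z).aestronglyMeasurable).sub
      (hK'.locallyIntegrable z).aestronglyMeasurable
  · filter_upwards [hN.continuous_bounded, hK'.continuous_bounded] with t h1 h2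
    exact ((Arc t).continuous.add h1.1).sub h2.1
  · filter_upwards [hN.continuous_bounded, hK'.continuous_bounded] with t h1 h2
    rw [closedLoop, map_zero, h1.map_zero, h2.map_zero]
    simp
  · obtain ⟨K₁, hK₁0, hK₁⟩ := e.exists_lipschitz_bound hinj CN hρ (half_pos hε)
    obtain ⟨K₂, hK₂0, hK₂⟩ := e'.exists_lipschitz_bound hinj C' hρ (half_pos hε)
    refine ⟨Crc + 1 + K₁ + K₂, by positivity, ?_⟩
    filter_upwards [hArc.abs_apply_le, ae_restrict_mem measurableSet_Ioi] with t h1 ht z₁ z₂ φ hz₁ hz₂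
    have h3 := hK₁ CN N le_rfl hN t ht z₁ z₂ hz₁ hz₂
    have h4 := hK₂ C' _ le_rfl hK' t ht z₁ z₂ hz₁ hz₂
    have h5 := h1 (z₁ - z₂) φ
    set κ := fun z => pivot ι (feedbackInput U K t (ι z)) with hκ
    have h6 : (closedLoop ι Arc N U K t z₁ - closedLoop ι Arc N U K t z₂) φ =
        Arc t (z₁ - z₂) φ + (N t z₁ - N t z₂) φ - (κ z₁ - κ z₂) φ := by
      rw [← add_apply, ← sub_apply, map_sub]
      congr 1
      simp only [closedLoop, hκ]
      abel
    have h7 := ((N t z₁ - N t z₂).le_opNorm φ).trans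
      (mul_le_mul_of_nonneg_right h3 (norm_nonneg φ))
    have h8 := ((κ z₁ - κ z₂).le_opNorm φ).trans
      (mul_le_mul_of_nonneg_right h4 (norm_nonneg φ))
    rw [Real.norm_eq_abs] at h7 h8
    rw [h6]
    refine ((abs_sub _ _).trans (add_le_add ((abs_add_le _ _).trans (add_le_add h5 h7)) h8)).trans
      (le_of_eq ?_)
    ring

/-- `|ι y|²` is controlled by `|y|²` and the projection of `ι y` onto `U`. -/
theorem exists_norm_sq_le_add_projection [CompleteSpace V] (U : Submodule ℝ H)
    [FiniteDimensional ℝ U] [U.HasOrthogonalProjection] {ξ : ℝ} (hξ : 0 ≤ ξ)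
    (hU : ∀ Θ : V, ι Θ ∈ Uᗮ → ξ * ‖ι Θ‖ ^ 2 ≤ ‖Θ‖ ^ 2) :
    ∃ c : ℝ≥0, ∀ y : V, ξ * ‖ι y‖ ^ 2 ≤
      2 * ‖y‖ ^ 2 + 4 * c * ‖U.orthogonalProjectionOnto (ι y)‖ ^ 2 := by
  set P : V →L[ℝ] U := U.orthogonalProjectionOnto.comp ι with hP
  set W : Submodule ℝ V := LinearMap.ker P.toLinearMap with hW
  have hWcl : IsClosed (W : Set V) := P.isClosed_ker
  have : CompleteSpace W := hWcl.completeSpace_coe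
  have hWmem : ∀ w : V, w ∈ W ↔ P w = 0 := fun w => LinearMap.mem_ker
  -- The projection is injective on the complement of `W = V ∩ Uᗮ` in `V`; that complement is thus
  -- finite-dimensional and its `V`-norm is controlled by the projection. The actuators need not lie
  -- in `V`.
  set f : Wᗮ →ₗ[ℝ] U := P.toLinearMap.comp Wᗮ.subtype with hf
  have hfker : f.ker = ⊥ := by
    rw [LinearMap.ker_eq_bot']
    intro q hq
    have h1 : (q : V) ∈ W := hq
    have h2 : (q : V) ∈ W ⊓ Wᗮ := ⟨h1, q.2⟩
    rw [Submodule.inf_orthogonal_eq_bot] at h2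
    exact Subtype.ext h2
  have : FiniteDimensional ℝ Wᗮ := FiniteDimensional.of_injective f (LinearMap.ker_eq_bot.1 hfker)
  obtain ⟨c₀, -, hc₀⟩ := f.exists_antilipschitzWith hfker
  refine ⟨⟨ξ * ‖ι‖ ^ 2 * c₀ ^ 2, by positivity⟩, fun y => ?_⟩
  set w : V := W.starProjection y with hw
  set q : V := y - w with hq
  have hwW : w ∈ W := W.starProjection_apply_mem y
  have hqW : q ∈ Wᗮ := W.sub_starProjection_mem_orthogonal y
  have hy : y = w + q := by rw [hq]; abel
  have hPq : P q = P y := by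
    rw [hq, map_sub, (hWmem w).1 hwW, sub_zero]
  have hwy : ‖w‖ ≤ ‖y‖ := W.norm_starProjection_apply_le y
  have hqn : ‖q‖ ≤ c₀ * ‖P y‖ := by
    have := hc₀.le_mul_dist (⟨q, hqW⟩ : Wᗮ) 0
    rw [map_zero, dist_zero_right, dist_zero_right] at this
    rw [← hPq]
    exact this
  have hιw : ι w ∈ Uᗮ := by
    rw [← Submodule.orthogonalProjectionOnto_eq_zero_iff]
    exact (hWmem w).1 hwW
  have h1 := hU w hιw
  have h2 : ‖ι q‖ ^ 2 ≤ ‖ι‖ ^ 2 * c₀ ^ 2 * ‖P y‖ ^ 2 := by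
    calc ‖ι q‖ ^ 2 ≤ (‖ι‖ * (c₀ * ‖P y‖)) ^ 2 := by
          gcongr
          exact (ι.le_opNorm q).trans (by gcongr)
      _ = _ := by ring
  have h3 : ‖ι y‖ ^ 2 ≤ 2 * ‖ι w‖ ^ 2 + 2 * ‖ι q‖ ^ 2 := by
    have h4 : ‖ι y‖ ≤ ‖ι w‖ + ‖ι q‖ := by
      nth_rw 1 [hy]
      rw [map_add]
      exact norm_add_le _ _
    have h5 : ‖ι y‖ ^ 2 ≤ (‖ι w‖ + ‖ι q‖) ^ 2 := by gcongr
    nlinarith [sq_nonneg (‖ι w‖ - ‖ι q‖)]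
  have h6 : ‖w‖ ^ 2 ≤ ‖y‖ ^ 2 := by gcongr
  change ξ * ‖ι y‖ ^ 2 ≤ 2 * ‖y‖ ^ 2 + 4 * (ξ * ‖ι‖ ^ 2 * c₀ ^ 2) * ‖P y‖ ^ 2
  have h7 := mul_le_mul_of_nonneg_left h3 hξ
  have h8 := mul_le_mul_of_nonneg_left h2 hξ
  have h9 : 0 ≤ ξ * (‖ι‖ ^ 2 * c₀ ^ 2 * ‖P y‖ ^ 2) := by positivity
  linarith

theorem mul_norm_sq_le_of_le_poincareConst (hinj : Function.Injective ι) {U : Submodule ℝ H}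
    {ξ : ℝ} (hξ : ξ ≤ poincareConst ι U) (Θ : V) (hΘ : ι Θ ∈ Uᗮ) : ξ * ‖ι Θ‖ ^ 2 ≤ ‖Θ‖ ^ 2 := by
  by_cases h0 : Θ = 0
  · simp [h0]
  have hp : 0 < ‖ι Θ‖ := norm_pos_iff.2 fun h => h0 (hinj (by rw [h, map_zero]))
  rw [← le_div_iff₀ (by positivity)]
  refine hξ.trans (csInf_le ⟨0, ?_⟩ ⟨Θ, hΘ, h0, rfl⟩)
  rintro _ ⟨Θ', -, -, rfl⟩
  positivity

end Assumptions

/-! ### Dissipativity, weak solutions and monotone thresholds -/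

section Stabilization

variable {H V : Type*} [NormedAddCommGroup H] [InnerProductSpace ℝ H]
  [NormedAddCommGroup V] [InnerProductSpace ℝ V] {ι : V →L[ℝ] H}

/-- Dissipativity of the closed-loop system for parameters bounded by `k`: the `L²`-defect is
controlled by a constant that depends on `k` only. -/
theorem exists_dissipation_const (hinj : Function.Injective ι) {n : ℕ}
    (e : NonlinearityExponents n) (k : ℕ) :
    ∃ D : ℝ, 0 ≤ D ∧ ∀ R μ Crc CN : ℝ≥0, R ≤ k → μ ≤ k → Crc ≤ k → CN ≤ k →
      ∀ (U : Submodule ℝ H) [U.HasOrthogonalProjection] (c lam : ℝ≥0), c ≤ lam →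
      (∀ y : V, 4 * D * ‖ι y‖ ^ 2 ≤
        2 * ‖y‖ ^ 2 + 4 * c * ‖U.orthogonalProjectionOnto (ι y)‖ ^ 2) →
      ∀ (Arc : ℝ → V →L[ℝ] StrongDual ℝ V) (N : ℝ → V → StrongDual ℝ V) (K : ℝ → U → U),
      IsReactionConvection ι Crc Arc → IsAdmissibleNonlinearity ι e CN N →
      IsAdmissibleFeedback ι U lam K →
      ∀ᵐ t ∂(volume.restrict (Ioi (0 : ℝ))), ∀ z : V, ‖ι z‖ ≤ R →
        -‖z‖ ^ 2 - closedLoop ι Arc N U K t z z ≤ -(μ * ‖ι z‖ ^ 2) := by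
  have hk : (0 : ℝ) < k + 1 := by positivity
  -- The radius `k + 1` is positive even for `k = 0`. With this `ε`, both `ε|z|²` and `ε|ι z||z|²`
  -- are at most `|z|²/8`. The constant `L` serves all nonlinearities with constant at most `k`.
  obtain ⟨L, hL0, hL⟩ := e.exists_lipschitz_bound hinj k hk
    (show (0 : ℝ) < 1 / (8 * (k + 1)) by positivity)
  -- The three summands pay for the nonlinearity, the reaction–convection term and the decay rate `μ
  -- ≤ k`.
  refine ⟨2 * L ^ 2 + 8 * (k + 1) ^ 2 + k, by positivity, ?_⟩
  intro R μ Crc CN hR hμ hCrc hCN U _ c lam hc hU Arc N K hArc hN hK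
  filter_upwards [hArc.abs_apply_le, hN.continuous_bounded, hK.monotone,
    ae_restrict_mem measurableSet_Ioi] with t hA h0 hm ht z hz
  replace hR : (R : ℝ) ≤ k := by exact_mod_cast hR
  replace hμ : (μ : ℝ) ≤ k := by exact_mod_cast hμ
  replace hCrc : (Crc : ℝ) ≤ k := by exact_mod_cast hCrc
  replace hc : (c : ℝ) ≤ lam := by exact_mod_cast hc
  set x := ‖z‖ with hx
  set h := ‖ι z‖ with hh
  set p : U := U.orthogonalProjectionOnto (ι z) with hp
  have hx0 : 0 ≤ x := norm_nonneg _
  have hh0 : 0 ≤ h := norm_nonneg _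
  have hhk : h ≤ k + 1 := by linarith
  have hN1 : ‖N t z‖ ≤ 1 / (8 * (k + 1)) * x + (1 / (8 * (k + 1)) * x + L) * h := by
    have := hL CN N hCN hN t ht z 0 hhk (by simpa using hk.le)
    rwa [h0.map_zero, sub_zero, sub_zero, norm_zero, add_zero] at this
  have hN2 : |N t z z| ≤ 3 / 8 * x ^ 2 + 2 * L ^ 2 * h ^ 2 := by
    have h1 : 1 / (8 * ((k : ℝ) + 1)) ≤ 1 / 8 := by
      apply one_div_le_one_div_of_le (by norm_num)
      linarith [(Nat.cast_nonneg k : (0 : ℝ) ≤ k)]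
    have h2 : 1 / (8 * ((k : ℝ) + 1)) * h ≤ 1 / 8 := by
      rw [div_mul_eq_mul_div, div_le_div_iff₀ (by positivity) (by norm_num)]
      linarith
    calc |N t z z| ≤ ‖N t z‖ * x := (N t z).le_opNorm z
      _ ≤ (1 / (8 * (k + 1)) * x + (1 / (8 * (k + 1)) * x + L) * h) * x := by gcongr
      _ = 1 / (8 * (k + 1)) * x ^ 2 + 1 / (8 * (k + 1)) * h * x ^ 2 + L * h * x := by ring
      _ ≤ 1 / 8 * x ^ 2 + 1 / 8 * x ^ 2 + L * h * x := by gcongr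
      _ ≤ _ := by nlinarith [sq_nonneg (x - 4 * (L * h))]
  have hA2 : |Arc t z z| ≤ 1 / 8 * x ^ 2 + 8 * (k + 1) ^ 2 * h ^ 2 := by
    calc |Arc t z z| ≤ (Crc + 1) * (h * x + x * h) := hA z z
      _ ≤ (k + 1) * (h * x + x * h) := by gcongr
      _ ≤ _ := by nlinarith [sq_nonneg (x - 8 * ((k + 1) * h))]
  have hK2 : inner ℝ (K t p : H) (ι z) ≤ -(lam : ℝ) * ‖p‖ ^ 2 := by
    have h1 : inner ℝ (K t p : H) (ι z) = inner ℝ (K t p : H) (p : H) := by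
      rw [← U.coe_inner, hp, U.inner_orthogonalProjectionOnto_eq_of_mem_left]
    rw [h1]
    exact hm p
  have hF : closedLoop ι Arc N U K t z z = Arc t z z + N t z z - inner ℝ (K t p : H) (ι z) := rfl
  have h3 : (c : ℝ) * ‖p‖ ^ 2 ≤ lam * ‖p‖ ^ 2 := by gcongr
  have h4 : (μ : ℝ) * h ^ 2 ≤ k * h ^ 2 := by gcongr
  have h5 := hU z
  rw [hF]
  -- The estimates of `N` and `A_rc` use `3/8 + 1/8` of `|z|²`. The other half, with a quarter of
  -- `hU`, covers `D|ι z|²` up to `c|p|²`, which the feedback dominates.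
  linarith [neg_abs_le (N t z z), neg_abs_le (Arc t z z)]

theorem IsWeakSolution.exists_solvesOn [CompleteSpace V] [CompleteSpace H]
    {A : V →L[ℝ] StrongDual ℝ V} (hA : ∀ y z : V, A y z = inner ℝ y z)
    {Arc : ℝ → V →L[ℝ] StrongDual ℝ V} {N : ℝ → V → StrongDual ℝ V} {U : Submodule ℝ H}
    [U.HasOrthogonalProjection] {K : ℝ → U → U} {y₀ : H} {y : ℝ → H}
    (h : IsWeakSolution ι A Arc N U K y₀ y) :
    ∃ v w, ∀ T : ℝ, 0 < T → SolvesOn ι (closedLoop ι Arc N U K) 0 T y v w := by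
  obtain ⟨hc, -, v, w, hyv, hv, hw, hd, heq⟩ := h
  have hR : ∀ T : ℝ, volume.restrict (Ioo 0 T) = volume.restrict (Ioc 0 T) := fun T =>
    Measure.restrict_congr_set Ioo_ae_eq_Ioc
  simp only [hR] at hv hw
  refine ⟨v, w, fun T hT => ⟨⟨hc.mono Icc_subset_Ici_self, ?_, hv T hT, hw T hT, fun t ht => ?_⟩, ?_⟩⟩
  · exact ae_restrict_of_ae_restrict_of_subset (Ioc_subset_Ioi_zero le_rfl) hyv
  · exact hd.eq_add_integral ((pivotCLM ι).continuous.comp_continuousOn hc)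
      (fun T hT => (hw T hT).integrable (by norm_num)) ht.1
  · filter_upwards [ae_restrict_of_ae_restrict_of_subset (Ioc_subset_Ioi_zero le_rfl) hyv,
      ae_restrict_of_ae_restrict_of_subset (Ioc_subset_Ioi_zero le_rfl) heq] with t h1 h2
    have h3 : A (v t) = rieszCLM V (v t) := by
      ext z
      rw [hA, rieszCLM_apply]
    rw [h1] at h2
    rw [closedLoop, ← h2, ← h3]
    abel

theorem ae_restrict_Ioi_of_forall_Ioc {P : ℝ → Prop}
    (h : ∀ T : ℝ, 0 < T → ∀ᵐ t ∂(volume.restrict (Ioc 0 T)), P t) :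
    ∀ᵐ t ∂(volume.restrict (Ioi (0 : ℝ))), P t := by
  have h1 : Ioi (0 : ℝ) = ⋃ n : ℕ, Ioc 0 ((n : ℝ) + 1) := by
    ext t
    simp only [mem_Ioi, mem_iUnion, mem_Ioc]
    refine ⟨fun ht => ?_, fun ⟨_, ht, _⟩ => ht⟩
    obtain ⟨n, hn⟩ := exists_nat_ge t
    exact ⟨n, ht, by linarith⟩
  rw [h1, ae_restrict_iUnion_iff]
  exact fun n => h _ (by positivity)

theorem isWeakSolution_of_solvesOn [CompleteSpace V] [CompleteSpace H]
    {A : V →L[ℝ] StrongDual ℝ V} (hA : ∀ y z : V, A y z = inner ℝ y z)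
    {Arc : ℝ → V →L[ℝ] StrongDual ℝ V} {N : ℝ → V → StrongDual ℝ V} {U : Submodule ℝ H}
    [U.HasOrthogonalProjection] {K : ℝ → U → U} {y : ℝ → H} {v : ℝ → V}
    {w : ℝ → StrongDual ℝ V}
    (h : ∀ T : ℝ, SolvesOn ι (closedLoop ι Arc N U K) 0 T y v w) :
    IsWeakSolution ι A Arc N U K (y 0) y := by
  have hR : ∀ T : ℝ, volume.restrict (Ioo 0 T) = volume.restrict (Ioc 0 T) := fun T =>
    Measure.restrict_congr_set Ioo_ae_eq_Ioc
  have hyv : ∀ᵐ t ∂(volume.restrict (Ioi (0 : ℝ))), y t = ι (v t) :=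
    ae_restrict_Ioi_of_forall_Ioc fun T _ => (h T).triple.coupling
  refine ⟨?_, rfl, v, w, hyv, fun T _ => hR T ▸ (h T).triple.memLp_fst,
    fun T _ => hR T ▸ (h T).triple.memLp_snd, ?_, ?_⟩
  · intro t ht
    have h1 : Icc 0 (t + 1) ∈ 𝓝[Ici 0] t := by
      rw [← Ici_inter_Iic]
      exact inter_mem_nhdsWithin _ (Iic_mem_nhds (lt_add_one t))
    exact ((h (t + 1)).triple.continuousOn t ⟨ht, (lt_add_one t).le⟩).mono_of_mem_nhdsWithin h1
  · exact isDistribDeriv_of_eq_add_integral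
      (fun T _ => (h T).triple.memLp_snd.integrable (by norm_num))
      (fun t ht => (h t).triple.integral_eq t ⟨ht.le, le_rfl⟩)
  · filter_upwards [hyv, ae_restrict_Ioi_of_forall_Ioc fun T _ => (h T).equation] with t h1 h2
    have h3 : A (v t) = rieszCLM V (v t) := by
      ext z
      rw [hA, rieszCLM_apply]
    rw [closedLoop] at h2
    rw [h1, h3, ← sub_eq_zero, ← h2]
    abel

/-- A monotone majorant of the two-parameter family `Λ`. -/
def monotoneMajorant (Λ : ℕ → ℕ+ → ℝ≥0) (j : ℕ) : ℝ≥0 :=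
  ∑ i ∈ Finset.range (j + 1), ∑ m ∈ Finset.range (j + 1), Λ i m.succPNat

theorem monotone_monotoneMajorant (Λ : ℕ → ℕ+ → ℝ≥0) : Monotone (monotoneMajorant Λ) := by
  intro i j hij
  have h : Finset.range (i + 1) ⊆ Finset.range (j + 1) := Finset.range_mono (by omega)
  exact (Finset.sum_le_sum fun _ _ => Finset.sum_le_sum_of_subset h).trans
    (Finset.sum_le_sum_of_subset h)

theorem le_monotoneMajorant (Λ : ℕ → ℕ+ → ℝ≥0) (k : ℕ) (M : ℕ+) :
    Λ k M ≤ monotoneMajorant Λ (k + M) := by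
  have hk : k ∈ Finset.range (k + M + 1) := Finset.mem_range.2 (by omega)
  -- The sum over positive indices runs over predecessors, so `M` appears as `M - 1`.
  have hM : M.natPred ∈ Finset.range (k + M + 1) := Finset.mem_range.2 (by
    have := M.natPred_add_one
    omega)
  calc Λ k M = Λ k M.natPred.succPNat := by rw [PNat.succPNat_natPred]
    _ ≤ ∑ m ∈ Finset.range (k + M + 1), Λ k m.succPNat :=
      Finset.single_le_sum (f := fun m : ℕ => Λ k m.succPNat) (fun _ _ => zero_le) hM
    _ ≤ _ := Finset.single_le_sum
      (f := fun i => ∑ m ∈ Finset.range (k + M + 1), Λ i m.succPNat) (fun _ _ => zero_le) hk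

/-- A natural number above all the parameters. -/
def parameterLevel (p : ℝ≥0 × ℝ≥0 × ℝ≥0 × ℝ≥0) : ℕ :=
  ⌈p.1⌉₊ + ⌈p.2.1⌉₊ + ⌈p.2.2.1⌉₊ + ⌈p.2.2.2⌉₊

theorem monotone_parameterLevel : Monotone parameterLevel := fun p q h => by
  obtain ⟨h1, h2, h3, h4⟩ := h
  unfold parameterLevel
  gcongr

theorem le_parameterLevel (R μ Crc CN : ℝ≥0) :
    R ≤ parameterLevel (R, μ, Crc, CN) ∧ μ ≤ parameterLevel (R, μ, Crc, CN) ∧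
      Crc ≤ parameterLevel (R, μ, Crc, CN) ∧ CN ≤ parameterLevel (R, μ, Crc, CN) := by
  refine ⟨(Nat.le_ceil R).trans ?_, (Nat.le_ceil μ).trans ?_, (Nat.le_ceil Crc).trans ?_,
    (Nat.le_ceil CN).trans ?_⟩ <;>
  · refine Nat.cast_le.2 ?_
    dsimp only [parameterLevel]
    omega

end Stabilization

end

/-! ### The main theorem -/

theorem theorem3p1 {H V : Type*}
    [NormedAddCommGroup H] [InnerProductSpace ℝ H] [CompleteSpace H]
    [NormedAddCommGroup V] [InnerProductSpace ℝ V] [CompleteSpace V]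
    (ι : V →L[ℝ] H) (hι_inj : Function.Injective ι) (hι_dense : DenseRange ι)
    (hι_compact : IsCompactOperator ι)
    (A : V →L[ℝ] StrongDual ℝ V) (hA : ∀ y z : V, A y z = inner ℝ y z)
    (σ : ℕ+ → ℕ+) (hσ : StrictMono σ)
    (Φ : (M : ℕ+) → Fin (σ M) → H) (hΦ : ∀ M, LinearIndependent ℝ (Φ M))
    (hξ : Tendsto (fun M : ℕ+ => poincareConst ι (actuatorSpan Φ M)) atTop atTop)
    {n : ℕ} (e : NonlinearityExponents n) :
    ∃ (Mbar : ℝ≥0 × ℝ≥0 × ℝ≥0 × ℝ≥0 → ℕ+)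
      (lamBar : ℕ+ × ℝ≥0 × ℝ≥0 × ℝ≥0 × ℝ≥0 → ℝ≥0),
      Monotone Mbar ∧ Monotone lamBar ∧
      ∀ R μ Crc CN : ℝ≥0, 0 < R → 0 < μ →
      ∀ Arc : ℝ → V →L[ℝ] StrongDual ℝ V, IsReactionConvection ι Crc Arc →
      ∀ N : ℝ → V → StrongDual ℝ V, IsAdmissibleNonlinearity ι e CN N →
      ∀ M : ℕ+, Mbar (R, μ, Crc, CN) ≤ M →
      ∀ lam : ℝ≥0, 0 < lam → lamBar (M, R, μ, Crc, CN) ≤ lam →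
      ∀ K : ℝ → actuatorSpan Φ M → actuatorSpan Φ M,
        IsAdmissibleFeedback ι (actuatorSpan Φ M) lam K →
      ∀ y₀ : H, ‖y₀‖ < R →
        (∃ y : ℝ → H, IsWeakSolution ι A Arc N (actuatorSpan Φ M) K y₀ y) ∧
        (∀ y z : ℝ → H, IsWeakSolution ι A Arc N (actuatorSpan Φ M) K y₀ y →
          IsWeakSolution ι A Arc N (actuatorSpan Φ M) K y₀ z → ∀ t : ℝ, 0 ≤ t → y t = z t) ∧
        ∀ y : ℝ → H, IsWeakSolution ι A Arc N (actuatorSpan Φ M) K y₀ y →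
          (∀ s t : ℝ, 0 ≤ s → s ≤ t → ‖y t‖ ≤ Real.exp (-(μ * (t - s))) * ‖y s‖) ∧
          (∀ s t : ℝ, 0 ≤ s → s < t → ‖y s‖ ≠ 0 → ‖y t‖ < ‖y s‖) := by
  have hfin : ∀ M, FiniteDimensional ℝ (actuatorSpan Φ M) := fun M =>
    FiniteDimensional.span_of_finite ℝ (Set.finite_range (Φ M))
  choose D hD0 hD using exists_dissipation_const hι_inj e
  have hMk : ∀ k : ℕ, ∃ M₀ : ℕ+, ∀ M, M₀ ≤ M → 4 * D k ≤ poincareConst ι (actuatorSpan Φ M) :=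
    fun k => eventually_atTop.1 (hξ.eventually_ge_atTop _)
  choose Mk hMk using hMk
  have hΛ : ∀ (k : ℕ) (M : ℕ+), ∃ c : ℝ≥0, Mk k ≤ M → ∀ y : V, 4 * D k * ‖ι y‖ ^ 2 ≤
      2 * ‖y‖ ^ 2 + 4 * c * ‖(actuatorSpan Φ M).orthogonalProjectionOnto (ι y)‖ ^ 2 := by
    intro k M
    by_cases h : Mk k ≤ M
    · obtain ⟨c, hc⟩ := exists_norm_sq_le_add_projection (actuatorSpan Φ M)
        (mul_nonneg (by norm_num) (hD0 k))
        (mul_norm_sq_le_of_le_poincareConst hι_inj (hMk k M h))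
      exact ⟨c, fun _ => hc⟩
    -- Below the threshold `Mk k` no estimate is needed, so any value serves.
    · exact ⟨0, fun h' => absurd h' h⟩
  choose Λ hΛ using hΛ
  -- The families `Mk` and `Λ` come from arbitrary choices and need not be monotone; partial suprema
  -- and the double sum majorize them monotonically.
  refine ⟨fun p => partialSups Mk (parameterLevel p),
    fun q => monotoneMajorant Λ (parameterLevel q.2 + q.1),
    (partialSups Mk).monotone.comp monotone_parameterLevel,
    fun q q' h => monotone_monotoneMajorant Λ
      (add_le_add (monotone_parameterLevel h.2) (PNat.coe_le_coe _ _ |>.2 h.1)), ?_⟩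
  intro R μ Crc CN hR hμ Arc hArc N hN M hM lam _ hlam K hK y₀ hy₀
  set k := parameterLevel (R, μ, Crc, CN)
  obtain ⟨hRk, hμk, hCrck, hCNk⟩ := le_parameterLevel R μ Crc CN
  have hF := hD k R μ Crc CN hRk hμk hCrck hCNk (actuatorSpan Φ M) (Λ k M) lam
    ((le_monotoneMajorant Λ k M).trans hlam) (hΛ k M ((le_partialSups Mk k).trans hM))
    Arc N K hArc hN hK
  have hP := isPerturbation_closedLoop hι_inj hArc hN hK
  have hdecay : ∀ y : ℝ → H, IsWeakSolution ι A Arc N (actuatorSpan Φ M) K y₀ y →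
      ∀ s t : ℝ, 0 ≤ s → s ≤ t → ‖y t‖ ≤ Real.exp (-(μ * (t - s))) * ‖y s‖ := by
    intro y hy s t hs hst
    obtain ⟨v, w, hvw⟩ := hy.exists_solvesOn hA
    -- The horizon `t + 1` is positive even when `t = 0`.
    have h1 := hvw (t + 1) (by linarith)
    exact h1.norm_le_exp hι_inj hι_dense hι_compact hF μ.2 le_rfl (by rwa [hy.2.1]) hs hst
      (lt_add_one t).le
  refine ⟨?_, fun y z hy hz t ht => ?_, fun y hy => ⟨hdecay y hy, fun s t hs hst hys => ?_⟩⟩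
  · obtain ⟨y, v, w, hy, h⟩ :=
      IsPerturbation.exists_global hι_inj hι_dense hι_compact hP hR μ.2 hF hy₀
    exact ⟨y, hy ▸ isWeakSolution_of_solvesOn hA h⟩
  · obtain ⟨v, w, hvw⟩ := hy.exists_solvesOn hA
    obtain ⟨v', w', hvw'⟩ := hz.exists_solvesOn hA
    exact (hvw (t + 1) (by linarith)).eqOn hι_inj hι_dense hι_compact hP le_rfl
      (hvw' (t + 1) (by linarith)) (hy.2.1.trans hz.2.1.symm) ⟨ht, (lt_add_one t).le⟩
  · replace hμ : (0 : ℝ) < μ := hμ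
    have h1 : Real.exp (-(μ * (t - s))) < 1 := by
      rw [Real.exp_lt_one_iff]
      nlinarith
    have h2 : 0 < ‖y s‖ := lt_of_le_of_ne (norm_nonneg _) hys.symm
    exact (hdecay y hy s t hs hst.le).trans_lt (by nlinarith)
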